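/- A polygon with at most one hole is the closed region $\mathcal P\subset\mathbb R^2$ enclosed by a simple closed polygonal curve (the outer boundary), minus the open region enclosed by a second simple closed polygonal curve lying strictly inside the first, if there is a hole; $\mathcal P$ is orthogonal if all its edges are horizontal or vertical. A point-shaped robot starts at a given point $s$ of the outer boundary of an unknown $\mathcal P$, moves continuously in $\mathcal P$, and at each position $x$ sees its visibility polygon $\{y : \overline{xy}\subseteq\mathcal P\}$ together with those points of it that belong to the boundary of $\mathcal P$; in the colored model it can moreover distinguish the boundary of the hole from the outer boundary. A watchman route is a closed curve in $\mathcal P$ through $s$ from which every point of $\mathcal P$ is seen; $\mathcal T_{\mathrm{opt}}$ denotes a shortest one. A deterministic online strategy is one whose motion up to each time depends only on what the robot has seen before that time. Its competitive ratio on a class of instances $(\mathcal P,s)$, for all of which it computes watchman routes, is the supremum, over the instances of the class with $|\mathcal T_{\mathrm{opt}}|>0$, of the length of the computed route divided by $|\mathcal T_{\mathrm{opt}}|$. **Theorem 1.** (1) Every deterministic online strategy that computes watchman routes in all orthogonal polygons with at most one hole has competitive ratio at least $2$ on this class. (2) Every deterministic online strategy that computes watchman routes in all polygons with at most one hole has competitive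 ratio at least $\frac{3+\sqrt5}{2}\approx 2.618$. This holds also in the colored model. -/

import Mathlib

open scoped NNReal ENNReal

namespace Watchman

/-- The Euclidean plane. -/
abbrev Plane : Type := EuclideanSpace ℝ (Fin 2)

/-- A simple closed polygonal curve with `m + 3` vertices. Indices are cyclic: addition in
`Fin (m + 3)` is modulo `m + 3`. Consecutive edges meet in their common vertex only, all other
pairs of edges are disjoint. -/
structure SimplePolygon where
  m : ℕ
  vertex : Fin (m + 3) → Plane
  vertex_ne : ∀ i, vertex i ≠ vertex (i + 1)
  consecutive : ∀ i, segment ℝ (vertex i) (vertex (i + 1)) ∩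
    segment ℝ (vertex (i + 1)) (vertex (i + 1 + 1)) = {vertex (i + 1)}
  nonconsecutive : ∀ i j, i ≠ j → j ≠ i + 1 → i ≠ j + 1 →
    Disjoint (segment ℝ (vertex i) (vertex (i + 1))) (segment ℝ (vertex j) (vertex (j + 1)))

namespace SimplePolygon

/-- The curve itself: the union of the edges. -/
def boundary (C : SimplePolygon) : Set Plane :=
  ⋃ i, segment ℝ (C.vertex i) (C.vertex (i + 1))

/-- The open region enclosed by the curve: the points off the curve whose connected component in
the complement of the curve is bounded. -/
def inside (C : SimplePolygon) : Set Plane :=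
  {x | x ∉ C.boundary ∧ Bornology.IsBounded (connectedComponentIn C.boundaryᶜ x)}

/-- Every edge is vertical or horizontal. -/
def IsOrthogonal (C : SimplePolygon) : Prop :=
  ∀ i, C.vertex i 0 = C.vertex (i + 1) 0 ∨ C.vertex i 1 = C.vertex (i + 1) 1

end SimplePolygon

/-- A problem instance: a polygon with at most one polygonal hole, together with a starting point
on the outer boundary. -/
structure Scene where
  outer : SimplePolygon
  hole : Option SimplePolygon
  hole_inside : ∀ H ∈ hole, H.boundary ⊆ outer.inside
  start : Plane
  start_mem : start ∈ outer.boundary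

namespace Scene

/-- The boundary of the hole (empty if there is no hole). -/
def holeBoundary (P : Scene) : Set Plane := ⋃ H ∈ P.hole, SimplePolygon.boundary H

/-- The closed free space: the outer polygon with its boundary, minus the open hole. -/
def region (P : Scene) : Set Plane :=
  (P.outer.boundary ∪ P.outer.inside) \ ⋃ H ∈ P.hole, SimplePolygon.inside H

/-- The visibility polygon of the point `x`. -/
def view (P : Scene) (x : Plane) : Set Plane := {y | segment ℝ x y ⊆ P.region}

/-- Outer boundary and hole consist of vertical and horizontal edges. -/
def IsOrthogonal (P : Scene) : Prop :=
  P.outer.IsOrthogonal ∧ ∀ H ∈ P.hole, SimplePolygon.IsOrthogonal H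

/-- `γ` is a watchman tour: a closed curve in the free space which begins at the starting point,
finally returns there for good, and sees every point of the polygon on its way. -/
structure IsWatchmanTour (P : Scene) (γ : ℝ≥0 → Plane) : Prop where
  continuous : Continuous γ
  start : γ 0 = P.start
  mem_region : ∀ t, γ t ∈ P.region
  returns : ∃ T, ∀ t, T ≤ t → γ t = P.start
  sees : ∀ y ∈ P.region, ∃ t, y ∈ P.view (γ t)

end Scene

/-- The length of a trajectory. -/
noncomputable def length (γ : ℝ≥0 → Plane) : ℝ≥0∞ := eVariationOn γ Set.univ

/-- The length of a shortest watchman tour. -/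
noncomputable def Scene.opt (P : Scene) : ℝ≥0∞ :=
  ⨅ (γ : ℝ≥0 → Plane) (_ : P.IsWatchmanTour γ), length γ

/-- What the robot sees at `x` in the standard model: its visibility polygon, and which points of
that are boundary points of the polygon. -/
def plainView (P : Scene) (x : Plane) : Set Plane × Set Plane :=
  (P.view x, P.view x ∩ (P.outer.boundary ∪ P.holeBoundary))

/-- What the robot sees at `x` if the hole is colored: its visibility polygon, and which points of
that are on the outer boundary and which are on the boundary of the hole. -/
def coloredView (P : Scene) (x : Plane) : Set Plane × Set Plane × Set Plane :=
  (P.view x, P.view x ∩ P.outer.boundary, P.view x ∩ P.holeBoundary)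

/-- A deterministic online strategy for the class `K` of instances, in the model where the robot at
`x` observes `observe P x`, that computes watchman tours for all instances in `K`. The strategy is
given by its trajectories. It is online and deterministic: if along its trajectory in `P` it has
seen, before time `t`, nothing that would look different in `P'`, then its trajectories in `P` and
`P'` agree up to time `t`. -/
structure OnlineStrategy {O : Type} (observe : Scene → Plane → O) (K : Set Scene) where
  path : Scene → ℝ≥0 → Plane
  tour : ∀ P ∈ K, P.IsWatchmanTour (path P)
  online : ∀ P ∈ K, ∀ P' ∈ K, P.start = P'.start → ∀ t,
    (∀ τ, τ < t → observe P (path P τ) = observe P' (path P τ)) →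
      ∀ τ, τ ≤ t → path P' τ = path P τ

/-- The competitive ratio: the supremum of the ratio of the length of the computed tour and the
length of a shortest one. Instances where nothing has to be done (everything is seen from the
starting point, so that the denominator is zero) do not count. -/
noncomputable def OnlineStrategy.competitiveRatio {O : Type} {observe : Scene → Plane → O}
    {K : Set Scene} (S : OnlineStrategy observe K) : ℝ≥0∞ :=
  ⨆ (P : Scene) (_ : P ∈ K) (_ : 0 < P.opt), length (S.path P) / P.opt

end Watchman

/-!
# Lower bounds for the exploration of polygons with at most one hole

An adversary watches the robot and decides late which of several scenes it is in. Two facts reduce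
this to geometry: the trajectories in two scenes agree as long as nothing that distinguishes the
scenes has been seen, and a trajectory is at least as long as the change of every locally
`1`-Lipschitz function along it (`abs_sub_le_eVariationOn`).

**General polygons.** Heights are scaled by a factor close to `0`, so that only horizontal motion is
expensive. The robot starts at the right end of a thin triangular hole that points to the left, and
may advance along its lower or along its upper side. To the far left is a slit whose tip can be seen
from a narrow wedge only. In the steep scene, this wedge is met on the upper side at depth `1`
(which is the abscissa `4`, since the hole ends at the abscissa `5`), and a tour of length about `2`
suffices. In a flat scene it is met on the lower side only, at a depth `x` which the adversary may
choose, and a tour of length about `2 * x` suffices. As long as the robot has not been at depth `1`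
on the upper side or at depth `x` on the lower side, the two scenes look alike
(`IsSlitScene.coloredView_eq`). Run the strategy in the steep scene, and let `ξ` be the depth to
which it has entered the lower side when it first reaches depth `1` on the upper side. With the
golden ratio `φ`, if `ξ` is at least `φ`, the tour in the steep scene has length at least
`2 * φ + 2`, which is `φ + 1` times the optimum `2`. Otherwise the adversary takes the flat scene
with an `x` slightly larger than `max ξ (φ - 1)`: the tour has length at least
`2 * ξ + 2 + 2 * x`, which is at least `φ + 1` times `2 * x`, because `φ * (φ - 1) = 1`. This is
`colored_game`. The hole is the same in all these scenes, so colors do not help, and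
`plain_ratio` follows from `colored_ratio`, since a strategy that ignores the colors is a strategy
in the colored model.

**Orthogonal polygons.** A bottom room and a top room are connected by three corridors of height
`N`, one of which is blocked along an interval of heights; so there is one hole. The walls of the
corridors are staircases that are displaced by the squares of the heights. Therefore a line of sight
cannot pass three consecutive gates between boxes (`not_three_gates`), and the block can be noticed
from nearby only (`zone_of_sees`, `IsZigzag.plainView_eq`). In the scene with a short block at the
place where the strategy looks last, the robot has looked at all places of all corridors before it
notices the block. Let `j₀` be the corridor that is completed last, `t₂` the time at which the robot
has completed the two other corridors, and `j₁` the one of these that it is in at this time. Up to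
`t₂` nothing changes if the block is replaced by a block which fills a maximal interval of `j₀` that
has not been looked at by then (`orthogonal_game`). In the new scene, let `A` and `B` be the depths
of the two dead ends of `j₀`. Up to `t₂`, the robot has visited both dead ends and nearly all of the
loop formed by the free corridors, without passing the place in `j₁` at which it is at `t₂`; after
`t₂` it still has to visit the tips of both dead ends and to return. Up to a
constant this takes `4 * N + 4 * A + 4 * B` (`le_length_of_order`), while `2 * N + 2 * A + 2 * B` is
enough for a tour that goes up one of the free corridors and down the other one
(`IsZigzag.opt_le`). The lower bound adds the changes of three functions: the position on the loop
formed by the free corridors, cut open at the place in `j₁`, and the depths in the two dead ends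
(`le_eVariationOn_of_clear`).

**The scenes are polygons.** The scenes are given by inequalities. To see that a simple polygon
encloses what it should, it suffices to know a bounded closed set and another closed set which cover
the plane and meet in the polygon, such that every point outside the first set can be connected to
infinity (`SimplePolygon.inside_eq`); nothing like the Jordan curve theorem is needed. The polygons
are composed of arcs (`IsArc`): edge by edge for the slit scenes, from staircase-shaped walls for
the zigzag scenes (`exists_block`, `exists_ring`).
-/

namespace Watchman

section

/-! ### Simple polygonal arcs and the insides of polygons -/

/-- `S` is a simple polygonal arc from `p` to `q`, every edge of which satisfies `Q`. Two edges meet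
only if they are consecutive, and then in their common vertex; straight angles are allowed. -/
def IsArc (Q : Plane → Plane → Prop) (p q : Plane) (S : Set Plane) : Prop :=
  ∃ (n : ℕ) (v : ℕ → Plane), 0 < n ∧ v 0 = p ∧ v n = q ∧
    (∀ i < n, v i ≠ v (i + 1) ∧ Q (v i) (v (i + 1))) ∧
    (∀ i j, i < j → j < n → ∀ x ∈ segment ℝ (v i) (v (i + 1)), x ∈ segment ℝ (v j) (v (j + 1)) →
      j = i + 1 ∧ x = v j) ∧
    ∀ x, x ∈ S ↔ ∃ i < n, x ∈ segment ℝ (v i) (v (i + 1))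

variable {Q : Plane → Plane → Prop} {p q r : Plane} {S T : Set Plane}

theorem IsArc.single (hpq : p ≠ q) (hQ : Q p q) : IsArc Q p q (segment ℝ p q) := by
  refine ⟨1, fun i => if i = 0 then p else q, one_pos, rfl, rfl, ?_, ?_, ?_⟩
  · intro i hi
    obtain rfl : i = 0 := by omega
    simpa using ⟨hpq, hQ⟩
  · intro i j h1 h2; omega
  · intro x
    constructor
    · intro hx; exact ⟨0, one_pos, by simpa using hx⟩
    · rintro ⟨i, hi, hx⟩
      obtain rfl : i = 0 := by omega
      simpa using hx

theorem IsArc.reverse (hQ : ∀ a b, Q a b → Q b a) (h : IsArc Q p q S) : IsArc Q q p S := by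
  obtain ⟨n, v, hn, h0, h1, hv, hd, hS⟩ := h
  have key : ∀ i, i < n → segment ℝ (v (n - i)) (v (n - (i + 1))) =
      segment ℝ (v (n - 1 - i)) (v (n - 1 - i + 1)) := by
    intro i hi
    rw [segment_symm, show n - (i + 1) = n - 1 - i by omega, show n - i = n - 1 - i + 1 by omega]
  refine ⟨n, fun i => v (n - i), hn, by simpa using h1, by simpa using h0, ?_, ?_, ?_⟩
  · intro i hi
    have := hv (n - (i + 1)) (by omega)
    rw [show n - (i + 1) + 1 = n - i by omega] at this
    exact ⟨this.1.symm, hQ _ _ this.2⟩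
  · intro i j hij hj x hx hx'
    simp only [] at hx hx'
    rw [key i (by omega)] at hx
    rw [key j (by omega)] at hx'
    obtain ⟨h2, h3⟩ := hd (n - 1 - j) (n - 1 - i) (by omega) (by omega) x hx' hx
    refine ⟨by omega, ?_⟩
    rw [h3]; congr 1; omega
  · intro x
    rw [hS]
    constructor
    · rintro ⟨i, hi, hx⟩
      refine ⟨n - 1 - i, by omega, ?_⟩
      simp only []
      rw [key _ (by omega), show n - 1 - (n - 1 - i) = i by omega]; exact hx
    · rintro ⟨i, hi, hx⟩
      simp only [] at hx
      rw [key _ hi] at hx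
      exact ⟨_, by omega, hx⟩

theorem IsArc.concat (h : IsArc Q p q S) (h' : IsArc Q q r T) (hST : ∀ x ∈ S, x ∈ T → x = q) :
    IsArc Q p r (S ∪ T) := by
  obtain ⟨n, v, hn, h0, h1, hv, hd, hS⟩ := h
  obtain ⟨n', v', hn', h0', h1', hv', hd', hS'⟩ := h'
  set u : ℕ → Plane := fun i => if i < n then v i else v' (i - n) with hu
  have ua : ∀ i, i ≤ n → u i = v i := by
    intro i hi
    rcases hi.lt_or_eq with h | rfl
    · simp [hu, h]
    · simp [hu, h0', h1]
  have ub : ∀ i, u (n + i) = v' i := by intro i; simp [hu]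
  have sa : ∀ i, i < n → segment ℝ (u i) (u (i + 1)) = segment ℝ (v i) (v (i + 1)) := by
    intro i hi; rw [ua i hi.le, ua (i + 1) hi]
  have sb : ∀ i, segment ℝ (u (n + i)) (u (n + i + 1)) = segment ℝ (v' i) (v' (i + 1)) := by
    intro i; rw [ub, add_assoc, ub]
  refine ⟨n + n', u, by omega, by rw [ua 0 (by omega), h0], by rw [ub, h1'], ?_, ?_, ?_⟩
  · intro i hi
    rcases lt_or_ge i n with h | h
    · rw [ua i h.le, ua (i + 1) h]; exact hv i h
    · obtain ⟨k, rfl⟩ := Nat.exists_eq_add_of_le h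
      rw [ub, add_assoc, ub]; exact hv' k (by omega)
  · intro i j hij hj x hx hx'
    rcases lt_or_ge j n with h | h
    · rw [sa i (by omega)] at hx; rw [sa j h] at hx'; rw [ua j h.le]
      exact hd i j hij h x hx hx'
    · obtain ⟨k, rfl⟩ := Nat.exists_eq_add_of_le h
      rw [sb] at hx'
      rcases lt_or_ge i n with h2 | h2
      · rw [sa i h2] at hx
        have hxq : x = q := hST x ((hS x).2 ⟨i, h2, hx⟩) ((hS' x).2 ⟨k, by omega, hx'⟩)
        subst hxq
        have e1 : i = n - 1 := by
          by_contra hne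
          have hl : x ∈ segment ℝ (v (n - 1)) (v (n - 1 + 1)) := by
            rw [show n - 1 + 1 = n by omega, h1]; exact right_mem_segment _ _ _
          have := (hd i (n - 1) (by omega) (by omega) x hx hl).2
          apply (hv (n - 1) (by omega)).1
          rw [show n - 1 + 1 = n by omega, h1, ← this]
        have e2 : k = 0 := by
          by_contra hne
          have hl : x ∈ segment ℝ (v' 0) (v' (0 + 1)) := by
            rw [h0']; exact left_mem_segment _ _ _
          have := (hd' 0 k (by omega) (by omega) x hl hx')
          apply (hv' 0 (by omega)).1
          rw [h0', this.2, this.1]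
        subst e1; subst e2
        exact ⟨by omega, by rw [ub, h0']⟩
      · obtain ⟨l, rfl⟩ := Nat.exists_eq_add_of_le h2
        rw [sb] at hx
        have := hd' l k (by omega) (by omega) x hx hx'
        exact ⟨by omega, by rw [ub]; exact this.2⟩
  · intro x
    rw [Set.mem_union, hS, hS']
    constructor
    · rintro (⟨i, hi, hx⟩ | ⟨i, hi, hx⟩)
      · exact ⟨i, by omega, by rw [sa i hi]; exact hx⟩
      · exact ⟨n + i, by omega, by rw [sb]; exact hx⟩
    · rintro ⟨i, hi, hx⟩
      rcases lt_or_ge i n with h | h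
      · rw [sa i h] at hx; exact Or.inl ⟨i, h, hx⟩
      · obtain ⟨k, rfl⟩ := Nat.exists_eq_add_of_le h
        rw [sb] at hx; exact Or.inr ⟨k, by omega, hx⟩

/-- Closing a simple arc by one more edge gives a simple polygon. -/
theorem IsArc.close (h : IsArc Q p q S) (hQ : Q q p) (hpq : p ≠ q)
    (hS' : ∀ x ∈ S, x ∈ segment ℝ q p → x = p ∨ x = q) :
    ∃ C : SimplePolygon, C.boundary = S ∪ segment ℝ q p ∧
      ∀ i, Q (C.vertex i) (C.vertex (i + 1)) := by
  obtain ⟨n, v, hn, h0, h1, hv, hd, hS⟩ := h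
  have hn2 : 2 ≤ n := by
    by_contra hlt
    obtain rfl : n = 1 := by omega
    have hm : midpoint ℝ p q ∈ S := by
      rw [hS]; exact ⟨0, one_pos, by rw [h0, h1]; exact midpoint_mem_segment p q⟩
    have := hS' _ hm (by rw [segment_symm]; exact midpoint_mem_segment p q)
    rw [midpoint_eq_left_iff, midpoint_eq_right_iff] at this
    tauto
  obtain ⟨m, rfl⟩ := Nat.exists_eq_add_of_le' hn2
  have hlast : q ∈ segment ℝ (v (m + 1)) (v (m + 1 + 1)) := by
    rw [h1]; exact right_mem_segment _ _ _
  have hfirst : p ∈ segment ℝ (v 0) (v (0 + 1)) := by rw [h0]; exact left_mem_segment _ _ _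
  have hp : ∀ j < m + 2, p ∈ segment ℝ (v j) (v (j + 1)) → j = 0 := by
    intro j hj hx
    by_contra hne
    have := hd 0 j (by omega) hj p hfirst hx
    apply (hv 0 (by omega)).1
    rw [h0, this.2, this.1]
  have hq : ∀ j < m + 2, q ∈ segment ℝ (v j) (v (j + 1)) → j = m + 1 := by
    intro j hj hx
    by_contra hne
    have := hd j (m + 1) (by omega) (by omega) q hx hlast
    apply (hv (m + 1) (by omega)).1
    rw [h1, this.2]
  -- edges, by the value of the index
  have val1 : ∀ i : Fin (m + 3), i.val < m + 2 → (i + 1).val = i.val + 1 := by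
    intro i hi
    rw [Fin.val_add_one_of_lt]
    rw [Fin.lt_def]; simpa using hi
  have val2 : ∀ i : Fin (m + 3), ¬ i.val < m + 2 → i.val = m + 2 ∧ (i + 1).val = 0 := by
    intro i hi
    have : i = Fin.last (m + 2) := by ext; simp; omega
    subst this
    simp
  have hmeet : ∀ j < m + 2, ∀ x ∈ segment ℝ q p, x ∈ segment ℝ (v j) (v (j + 1)) →
      (j = 0 ∧ x = p) ∨ (j = m + 1 ∧ x = q) := by
    intro j hj x hx hx'
    rcases hS' x ((hS x).2 ⟨j, hj, hx'⟩) hx with rfl | rfl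
    · exact Or.inl ⟨hp j hj hx', rfl⟩
    · exact Or.inr ⟨hq j hj hx', rfl⟩
  have vEnd : ∀ i : Fin (m + 3), ¬ i.val < m + 2 → v i.val = q ∧ v (i + 1).val = p := by
    intro i hi; rw [(val2 i hi).1, (val2 i hi).2]; exact ⟨h1, h0⟩
  have key : ∀ i j : Fin (m + 3), i ≠ j → j ≠ i + 1 → ∀ x,
      x ∈ segment ℝ (v i) (v (i + 1 : Fin (m + 3))) →
      x ∈ segment ℝ (v j) (v (j + 1 : Fin (m + 3))) → i = j + 1 ∧ x = v i := by
    intro i j hij hj x hx hx'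
    by_cases ci : i.val < m + 2 <;> by_cases cj : j.val < m + 2
    · rw [val1 i ci] at hx; rw [val1 j cj] at hx'
      rcases lt_or_gt_of_ne (Fin.val_ne_of_ne hij) with h | h
      · exact absurd (Fin.ext ((hd _ _ h cj x hx hx').1.trans (val1 i ci).symm)) hj
      · have := hd _ _ h ci x hx' hx
        exact ⟨Fin.ext (this.1.trans (val1 j cj).symm), this.2⟩
    · rw [val1 i ci] at hx
      rw [(vEnd j cj).1, (vEnd j cj).2] at hx'
      rcases hmeet _ ci x hx' hx with ⟨h2, h3⟩ | ⟨h2, h3⟩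
      · exact ⟨Fin.ext (h2.trans (val2 j cj).2.symm), by rw [h2, h0, h3]⟩
      · exact absurd (Fin.ext (by rw [val1 i ci, (val2 j cj).1, h2])) hj
    · rw [(vEnd i ci).1, (vEnd i ci).2] at hx
      rw [val1 j cj] at hx'
      rcases hmeet _ cj x hx hx' with ⟨h2, h3⟩ | ⟨h2, h3⟩
      · exact absurd (Fin.ext (by rw [(val2 i ci).2, h2])) hj
      · exact ⟨Fin.ext (by rw [val1 j cj, (val2 i ci).1, h2]), by rw [(vEnd i ci).1, h3]⟩
    · exact absurd (Fin.ext ((val2 i ci).1.trans (val2 j cj).1.symm)) hij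
  have hne1 : ∀ i : Fin (m + 3), i + 1 ≠ i := by
    intro i h
    have := congrArg Fin.val h
    by_cases c : i.val < m + 2
    · rw [val1 i c] at this; omega
    · rw [(val2 i c).1, (val2 i c).2] at this; omega
  have hne2 : ∀ i : Fin (m + 3), i ≠ i + 1 + 1 := by
    intro i h
    have := congrArg Fin.val h
    by_cases c : i.val < m + 2
    · have e := val1 i c
      by_cases c' : (i + 1).val < m + 2
      · rw [val1 _ c'] at this; omega
      · have := (val2 _ c'); omega
    · have e := val2 i c
      have := val1 (i + 1) (by omega); omega
  refine ⟨⟨m, fun i => v i, ?_, ?_, ?_⟩, ?_, ?_⟩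
  · intro i
    by_cases c : i.val < m + 2
    · rw [val1 i c]; exact (hv _ c).1
    · rw [(vEnd i c).1, (vEnd i c).2]; exact hpq.symm
  · intro i
    ext x
    constructor
    · rintro ⟨hx, hx'⟩
      exact (key (i + 1) i (hne1 i) (hne2 i) x hx' hx).2
    · rintro rfl
      exact ⟨right_mem_segment _ _ _, left_mem_segment _ _ _⟩
  · intro i j hij hj hi
    rw [Set.disjoint_left]
    intro x hx hx'
    exact hi (key i j hij hj x hx hx').1
  · ext x
    simp only [SimplePolygon.boundary, Set.mem_iUnion, Set.mem_union, hS]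
    constructor
    · rintro ⟨i, hx⟩
      by_cases c : i.val < m + 2
      · rw [val1 i c] at hx; exact Or.inl ⟨_, c, hx⟩
      · rw [(vEnd i c).1, (vEnd i c).2] at hx; exact Or.inr hx
    · rintro (⟨i, hi, hx⟩ | hx)
      · refine ⟨⟨i, by omega⟩, ?_⟩
        rw [val1 ⟨i, by omega⟩ hi]; exact hx
      · refine ⟨⟨m + 2, by omega⟩, ?_⟩
        rw [(vEnd ⟨m + 2, by omega⟩ (by simp)).2]
        simpa [h1] using hx
  · intro i
    by_cases c : i.val < m + 2
    · simp only []; rw [val1 i c]; exact (hv _ c).2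
    · simp only []; rw [(vEnd i c).1, (vEnd i c).2]; exact hQ

/-- The point `x` can be connected to infinity in `A`. -/
def Escapes (A : Set Plane) (x : Plane) : Prop :=
  ∃ E ⊆ A, x ∈ E ∧ IsPreconnected E ∧ ¬ Bornology.IsBounded E

theorem Escapes.of_segment {A : Set Plane} {x y : Plane} (h : segment ℝ x y ⊆ A)
    (hy : Escapes A y) : Escapes A x := by
  obtain ⟨E, hE, hyE, hc, hb⟩ := hy
  refine ⟨segment ℝ x y ∪ E, Set.union_subset h hE, Or.inl (left_mem_segment _ _ _), ?_, ?_⟩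
  · exact IsPreconnected.union y (right_mem_segment _ _ _) hyE
      (convex_segment x y).isPreconnected hc
  · exact fun h => hb (h.subset Set.subset_union_right)

theorem Escapes.of_ray {A : Set Plane} {x d : Plane} (hd : d ≠ 0)
    (h : ∀ t : ℝ, 0 ≤ t → x + t • d ∈ A) : Escapes A x := by
  refine ⟨(fun t : ℝ => x + t • d) '' Set.Ici 0, ?_, ⟨0, by simp, by simp⟩, ?_, ?_⟩
  · rintro _ ⟨t, ht, rfl⟩; exact h t ht
  · exact isPreconnected_Ici.image _ (by fun_prop)
  · intro hb
    obtain ⟨M, hM⟩ := hb.exists_norm_le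
    have hd' : 0 < ‖d‖ := norm_pos_iff.2 hd
    have hM0 : 0 ≤ M := (norm_nonneg _).trans (hM _ ⟨0, by simp, rfl⟩)
    have ht : 0 ≤ (M + ‖x‖ + 1) / ‖d‖ := by positivity
    have h1 := hM _ ⟨_, ht, rfl⟩
    have h2 : ‖((M + ‖x‖ + 1) / ‖d‖) • d‖ = M + ‖x‖ + 1 := by
      rw [norm_smul, Real.norm_of_nonneg ht]; field_simp
    have h3 := norm_sub_le (x + ((M + ‖x‖ + 1) / ‖d‖) • d) x
    simp only [add_sub_cancel_left] at h3
    linarith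

/-- A simple polygon that is the common boundary of a bounded closed set `R` and a closed set `O`
which together cover the plane encloses the complement of `O`, if the complement of `R` has no
bounded component. The component of a point of `R` off the polygon cannot leave `R`, since it would have to
pass through `R ∩ O`. -/
theorem SimplePolygon.inside_eq {C : SimplePolygon} {R O : Set Plane} (hR : IsClosed R)
    (hO : IsClosed O) (hRO : ∀ x, x ∈ R ∨ x ∈ O) (hC : C.boundary = R ∩ O)
    (hb : Bornology.IsBounded R) (hesc : ∀ x, x ∉ R → Escapes Rᶜ x) : C.inside = Oᶜ := by
  ext x
  simp only [SimplePolygon.inside, Set.mem_ofPred_eq]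
  constructor
  · rintro ⟨hx, hbd⟩ hxO
    have hxR : x ∉ R := fun h => hx (hC ▸ ⟨h, hxO⟩)
    obtain ⟨E, hE, hxE, hc, hnb⟩ := hesc x hxR
    refine hnb (hbd.subset (hc.subset_connectedComponentIn hxE ?_))
    intro y hy hyC
    rw [hC] at hyC
    exact hE hy hyC.1
  · intro hxO
    refine ⟨fun h => hxO (hC ▸ h : x ∈ R ∩ O).2, hb.subset ?_⟩
    have hxc : x ∈ C.boundaryᶜ := fun h => hxO (hC ▸ h : x ∈ R ∩ O).2
    have hsub : connectedComponentIn C.boundaryᶜ x ⊆ Oᶜ := by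
      refine isPreconnected_connectedComponentIn.subset_left_of_subset_union hO.isOpen_compl
        hR.isOpen_compl ?_ ?_ ⟨x, mem_connectedComponentIn hxc, hxO⟩
      · rw [Set.disjoint_left]; intro y hy hy'
        exact (hRO y).elim hy' hy
      · intro y hy
        have := connectedComponentIn_subset _ _ hy
        rw [hC] at this
        by_cases hyO : y ∈ O
        · exact Or.inr fun hyR => this ⟨hyR, hyO⟩
        · exact Or.inl hyO
    exact fun y hy => (hRO y).resolve_right (hsub hy)

end

/-! ### Coordinates, trajectories and their lengths -/

/-- The point with coordinates `x` and `y`. -/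
noncomputable def pt (x y : ℝ) : Plane := !₂[x, y]

@[simp] theorem pt_zero (x y : ℝ) : pt x y 0 = x := by simp [pt]
@[simp] theorem pt_one (x y : ℝ) : pt x y 1 = y := by simp [pt]

theorem plane_ext {p q : Plane} (h0 : p 0 = q 0) (h1 : p 1 = q 1) : p = q := by
  ext i; fin_cases i <;> assumption

theorem mem_segment_plane {p q z : Plane} : z ∈ segment ℝ p q ↔
    ∃ t : ℝ, 0 ≤ t ∧ t ≤ 1 ∧ z 0 = p 0 + t * (q 0 - p 0) ∧ z 1 = p 1 + t * (q 1 - p 1) := by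
  rw [segment_eq_image']
  constructor
  · rintro ⟨t, ht, rfl⟩
    exact ⟨t, ht.1, ht.2, by simp, by simp⟩
  · rintro ⟨t, h0, h1, e0, e1⟩
    exact ⟨t, ⟨h0, h1⟩, plane_ext (by simp [e0]) (by simp [e1])⟩

theorem abs_coord_sub_le (p q : Plane) (i : Fin 2) : |p i - q i| ≤ dist p q := by
  rw [dist_eq_norm]; exact PiLp.norm_apply_le (p - q) i

theorem dist_le_coord (p q : Plane) : dist p q ≤ |p 0 - q 0| + |p 1 - q 1| := by
  rw [EuclideanSpace.dist_eq, Fin.sum_univ_two, Real.dist_eq, Real.dist_eq]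
  apply Real.sqrt_le_iff.2
  refine ⟨by positivity, ?_⟩
  nlinarith [mul_nonneg (abs_nonneg (p 0 - q 0)) (abs_nonneg (p 1 - q 1))]

/-- There is a trajectory in `R` that leads from `p` to `q`, has length at most `L`, and visits all
points of `V`. -/
def Walk (R : Set Plane) (p q : Plane) (L : ℝ) (V : Set Plane) : Prop :=
  ∃ (γ : ℝ≥0 → Plane) (T : ℝ≥0), Continuous γ ∧ γ 0 = p ∧ (∀ t, T ≤ t → γ t = q) ∧
    (∀ t, γ t ∈ R) ∧ eVariationOn γ Set.univ ≤ ENNReal.ofReal L ∧ ∀ x ∈ V, ∃ t, γ t = x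

theorem eVariationOn_univ_eq (γ : ℝ≥0 → Plane) (T : ℝ≥0) :
    eVariationOn γ Set.univ = eVariationOn γ (Set.Iic T) + eVariationOn γ (Set.Ici T) := by
  rw [← eVariationOn.union γ (x := T) isGreatest_Iic isLeast_Ici, Set.Iic_union_Ici]

theorem Walk.step {R : Set Plane} {p q : Plane} (h : segment ℝ p q ⊆ R) :
    Walk R p q (dist p q) (segment ℝ p q) := by
  refine ⟨fun t => AffineMap.lineMap p q (min (t : ℝ) 1), 1, ?_, by simp, ?_, ?_, ?_, ?_⟩
  · exact AffineMap.lineMap_continuous.comp (by fun_prop)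
  · intro t ht
    have : (1 : ℝ) ≤ t := by exact_mod_cast ht
    simp [this]
  · intro t
    apply h
    rw [segment_eq_image_lineMap]
    exact ⟨_, ⟨by positivity, min_le_right _ _⟩, rfl⟩
  · rw [eVariationOn_univ_eq _ 1]
    have h2 : eVariationOn (fun t : ℝ≥0 => (AffineMap.lineMap p q (min (t : ℝ) 1) : Plane))
        (Set.Ici 1) = 0 := by
      apply eVariationOn.constant_on
      rintro _ ⟨a, ha, rfl⟩ _ ⟨b, hb, rfl⟩
      have ha : (1 : ℝ) ≤ a := by exact_mod_cast ha
      have hb : (1 : ℝ) ≤ b := by exact_mod_cast hb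
      simp [ha, hb]
    rw [h2, add_zero]
    have hl : LipschitzOnWith (nndist p q) (fun r : ℝ => (AffineMap.lineMap p q r : Plane))
        Set.univ := by
      rw [lipschitzOnWith_univ]
      refine LipschitzWith.of_dist_le_mul fun x y => ?_
      rw [dist_lineMap_lineMap, coe_nndist, mul_comm]
    have := hl.comp_eVariationOn_le (f := fun r : ℝ => (AffineMap.lineMap p q r : Plane))
      (g := fun t : ℝ≥0 => min (t : ℝ) 1) (s := Set.Iic 1) (fun _ _ => Set.mem_univ _)
    refine (this : eVariationOn (fun t : ℝ≥0 => (AffineMap.lineMap p q (min (t : ℝ) 1) : Plane))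
        (Set.Iic 1) ≤ _).trans ?_
    have hm : MonotoneOn (fun t : ℝ≥0 => min (t : ℝ) 1) Set.univ := by
      intro a _ b _ hab
      have : (a : ℝ) ≤ b := by exact_mod_cast hab
      exact min_le_min_right _ this
    have h3 := hm.eVariationOn_eq (Set.mem_univ 0) (Set.mem_univ 1)
    have h4 : (Set.univ : Set ℝ≥0) ∩ Set.Icc 0 1 = Set.Iic 1 := by
      ext x; simp
    rw [h4] at h3
    calc _ ≤ (nndist p q : ℝ≥0∞) * ENNReal.ofReal 1 := by
            gcongr; exact le_of_eq (by simpa using h3)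
      _ = _ := by
          rw [ENNReal.ofReal_one, mul_one, ← edist_nndist, edist_dist]
  · intro x hx
    rw [segment_eq_image_lineMap] at hx
    obtain ⟨t, ht, rfl⟩ := hx
    obtain ⟨t, rfl⟩ : ∃ t' : ℝ≥0, (t' : ℝ) = t := ⟨⟨t, ht.1⟩, rfl⟩
    exact ⟨t, by simp only []; rw [min_eq_left ht.2]⟩

theorem Walk.append {R : Set Plane} {p q r : Plane} {L L' : ℝ} {V V' : Set Plane}
    (h : Walk R p q L V) (h' : Walk R q r L' V') (hL : 0 ≤ L) (hL' : 0 ≤ L') :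
    Walk R p r (L + L') (V ∪ V') := by
  obtain ⟨γ, T, hc, h0, hT, hR, hl, hV⟩ := h
  obtain ⟨γ', T', hc', h0', hT', hR', hl', hV'⟩ := h'
  set δ : ℝ≥0 → Plane := fun t => if t ≤ T then γ t else γ' (t - T) with hδ
  have e1 : ∀ t, t ≤ T → δ t = γ t := fun t ht => by simp [hδ, ht]
  have e2 : ∀ t, T ≤ t → δ t = γ' (t - T) := by
    intro t ht
    rcases ht.eq_or_lt with rfl | h
    · simp [hδ, h0', hT _ le_rfl]
    · simp [hδ, not_le.2 h]
  refine ⟨δ, T + T', ?_, ?_, ?_, ?_, ?_, ?_⟩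
  · refine Continuous.if_le hc (hc'.comp (continuous_id.sub continuous_const)) continuous_id
      continuous_const ?_
    rintro x rfl
    simp [h0', hT _ le_rfl]
  · rw [e1 0 bot_le, h0]
  · intro t ht
    rw [e2 t (le_trans le_self_add ht)]
    exact hT' _ (le_tsub_of_add_le_left ht)
  · intro t
    rcases le_total t T with h | h
    · rw [e1 t h]; exact hR t
    · rw [e2 t h]; exact hR' _
  · rw [eVariationOn_univ_eq _ T, ENNReal.ofReal_add hL hL']
    refine add_le_add ?_ ?_
    · rw [eVariationOn.congr (show Set.EqOn δ γ (Set.Iic T) from fun x hx => e1 x hx)]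
      exact (eVariationOn.mono _ (Set.subset_univ _)).trans hl
    · rw [eVariationOn.congr (show Set.EqOn δ (γ' ∘ fun t => t - T) (Set.Ici T) from
        fun x hx => e2 x hx)]
      refine (eVariationOn.comp_le_of_monotoneOn _ _ ?_ (fun _ _ => Set.mem_univ _)).trans hl'
      exact fun a _ b _ hab => tsub_le_tsub_right hab _
  · rintro x (hx | hx)
    · obtain ⟨t, rfl⟩ := hV x hx
      rcases le_total t T with h | h
      · exact ⟨t, e1 t h⟩
      · exact ⟨T, by rw [e1 T le_rfl, hT _ le_rfl, hT _ h]⟩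
    · obtain ⟨t, rfl⟩ := hV' x hx
      exact ⟨T + t, by rw [e2 _ le_self_add]; simp⟩

theorem Walk.mono {R : Set Plane} {p q : Plane} {L L' : ℝ} {V V' : Set Plane} (h : Walk R p q L V)
    (hL : L ≤ L') (hV : V' ⊆ V) : Walk R p q L' V' := by
  obtain ⟨γ, T, hc, h0, hT, hR, hl, hv⟩ := h
  exact ⟨γ, T, hc, h0, hT, hR, hl.trans (ENNReal.ofReal_le_ofReal hL), fun x hx => hv x (hV hx)⟩

/-- A closed walk from the start is a watchman tour if every point of the region is visible from one
of the vantage points `V` that it visits. -/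
theorem Scene.opt_le {P : Scene} {L : ℝ} {V : Set Plane}
    (h : Walk P.region P.start P.start L V)
    (hV : ∀ y ∈ P.region, ∃ x ∈ V, segment ℝ x y ⊆ P.region) : P.opt ≤ ENNReal.ofReal L := by
  obtain ⟨γ, T, hc, h0, hT, hR, hl, hv⟩ := h
  refine (iInf₂_le γ ⟨hc, h0, hR, ⟨T, hT⟩, ?_⟩).trans hl
  intro y hy
  obtain ⟨x, hx, hxy⟩ := hV y hy
  obtain ⟨t, rfl⟩ := hv x hx
  exact ⟨t, hxy⟩

/-- A function that is uniformly locally `1`-Lipschitz changes along a trajectory by at most the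
length of the trajectory. The trajectory is sampled so densely that consecutive points are closer
than `r`. -/
theorem abs_sub_le_eVariationOn {f : Plane → ℝ} {K : Set Plane} {r : ℝ} (hr : 0 < r)
    (hf : ∀ p ∈ K, ∀ q ∈ K, dist p q < r → |f p - f q| ≤ dist p q) {γ : ℝ≥0 → Plane}
    (hγ : Continuous γ) {s t : ℝ≥0} (hst : s ≤ t) (hK : ∀ u ∈ Set.Icc s t, γ u ∈ K) :
    ENNReal.ofReal |f (γ t) - f (γ s)| ≤ eVariationOn γ (Set.Icc s t) := by
  have huc := isCompact_Icc.uniformContinuousOn_of_continuous (hγ.continuousOn (s := Set.Icc s t))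
  rw [Metric.uniformContinuousOn_iff] at huc
  obtain ⟨d, hd, hd'⟩ := huc r hr
  obtain ⟨e, he⟩ : ∃ e : ℝ≥0, (e : ℝ) = d / 2 := ⟨⟨d / 2, by positivity⟩, rfl⟩
  have he0 : 0 < e := by
    rw [← NNReal.coe_pos, he]; positivity
  set u : ℕ → ℝ≥0 := fun i => min (s + i * e) t with hu
  have hum : Monotone u := by
    intro i j hij
    have : (i : ℝ≥0) ≤ j := by exact_mod_cast hij
    exact min_le_min_right _ (by gcongr)
  have hus : ∀ i, u i ∈ Set.Icc s t := fun i => ⟨le_min le_self_add hst, min_le_right _ _⟩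
  obtain ⟨n, hn⟩ := exists_nat_ge (t / e)
  have hun : u n = t := by
    apply min_eq_right
    rw [div_le_iff₀ he0] at hn
    exact hn.trans le_add_self
  have hu0 : u 0 = s := by simp [hu, hst]
  have hstep : ∀ i, dist (u (i + 1)) (u i) < d := by
    intro i
    rw [NNReal.dist_eq, abs_of_nonneg (sub_nonneg.2 (by exact_mod_cast hum (Nat.le_succ i)))]
    have h1 : ((u (i + 1) : ℝ≥0) : ℝ) = min (s + (i + 1) * (d / 2)) t := by
      simp [hu, he]
    have h2 : ((u i : ℝ≥0) : ℝ) = min (s + i * (d / 2)) t := by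
      simp [hu, he]
    rw [h1, h2]
    rcases le_total ((s : ℝ) + i * (d / 2)) t with h | h
    · rw [min_eq_left h]
      have := min_le_left ((s : ℝ) + (i + 1) * (d / 2)) t
      linarith
    · rw [min_eq_right h]
      have := min_le_right ((s : ℝ) + (i + 1) * (d / 2)) t
      linarith
  have hsum : |f (γ t) - f (γ s)| ≤ ∑ i ∈ Finset.range n, dist (γ (u (i + 1))) (γ (u i)) := by
    have h1 : f (γ t) - f (γ s) = ∑ i ∈ Finset.range n, (f (γ (u (i + 1))) - f (γ (u i))) := by
      rw [Finset.sum_range_sub (fun i => f (γ (u i))), hun, hu0]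
    rw [h1]
    refine (Finset.abs_sum_le_sum_abs _ _).trans (Finset.sum_le_sum fun i _ => ?_)
    exact hf _ (hK _ (hus _)) _ (hK _ (hus _)) (hd' _ (hus _) _ (hus _) (hstep i))
  calc ENNReal.ofReal |f (γ t) - f (γ s)|
      ≤ ENNReal.ofReal (∑ i ∈ Finset.range n, dist (γ (u (i + 1))) (γ (u i))) :=
        ENNReal.ofReal_le_ofReal hsum
    _ = ∑ i ∈ Finset.range n, edist (γ (u (i + 1))) (γ (u i)) := by
        rw [ENNReal.ofReal_sum_of_nonneg (fun _ _ => dist_nonneg)]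
        simp only [edist_dist]
    _ ≤ _ := eVariationOn.sum_le hum hus

theorem eVariationOn_Icc_add_le_length (γ : ℝ≥0 → Plane) {a b c : ℝ≥0} (hab : a ≤ b) (hbc : b ≤ c) :
    eVariationOn γ (Set.Icc a b) + eVariationOn γ (Set.Icc b c) = eVariationOn γ (Set.Icc a c) := by
  have := eVariationOn.Icc_add_Icc γ (s := Set.univ) hab hbc (Set.mem_univ _)
  simpa using this

/-! ### Coordinates with a scaled height -/

/-- The second coordinate in units of `δ`. -/
noncomputable def ht (δ : ℝ) (z : Plane) : ℝ := z 1 / δ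

/-- The point with first coordinate `u` and height `v` in units of `δ`. -/
noncomputable def sq (δ u v : ℝ) : Plane := pt u (δ * v)

@[simp] theorem sq_zero (δ u v : ℝ) : sq δ u v 0 = u := by simp [sq]

theorem ht_sq {δ : ℝ} (hδ : 0 < δ) (u v : ℝ) : ht δ (sq δ u v) = v := by
  simp only [ht, sq, pt_one]; field_simp

theorem eq_sq {δ : ℝ} (hδ : 0 < δ) (z : Plane) : z = sq δ (z 0) (ht δ z) := by
  refine plane_ext (by simp) ?_
  simp only [ht, sq, pt_one]; field_simp

theorem sq_ext {δ : ℝ} (hδ : 0 < δ) {z z' : Plane} (h0 : z 0 = z' 0) (h1 : ht δ z = ht δ z') :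
    z = z' := by
  rw [eq_sq hδ z, eq_sq hδ z', h0, h1]

theorem mem_segment_sq {δ : ℝ} (hδ : 0 < δ) {p q z : Plane} : z ∈ segment ℝ p q ↔
    ∃ t : ℝ, 0 ≤ t ∧ t ≤ 1 ∧ z 0 = p 0 + t * (q 0 - p 0) ∧
      ht δ z = ht δ p + t * (ht δ q - ht δ p) := by
  rw [mem_segment_plane]
  have : ∀ t, z 1 = p 1 + t * (q 1 - p 1) ↔ ht δ z = ht δ p + t * (ht δ q - ht δ p) := by
    intro t
    simp only [ht]
    rw [← sub_div, ← mul_div_assoc, ← add_div, div_left_inj' hδ.ne']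
  simp only [this]

theorem halfplane_segment {δ : ℝ} (hδ : 0 < δ) {p q z : Plane} (hz : z ∈ segment ℝ p q)
    (a b c : ℝ) (hp : a * p 0 + b * ht δ p ≤ c) (hq : a * q 0 + b * ht δ q ≤ c) :
    a * z 0 + b * ht δ z ≤ c := by
  obtain ⟨t, h0, h1, e0, e1⟩ := (mem_segment_sq hδ).1 hz
  rw [e0, e1]
  nlinarith [mul_le_mul_of_nonneg_left hp (sub_nonneg.2 h1), mul_le_mul_of_nonneg_left hq h0]

/-- The point of a segment with prescribed first coordinate. -/
theorem exists_mem_segment_zero {δ : ℝ} (hδ : 0 < δ) {p q : Plane} {a : ℝ} (hq : q 0 ≤ a)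
    (hp : a ≤ p 0) (hlt : q 0 < p 0) : ∃ z ∈ segment ℝ p q, z 0 = a ∧
      (ht δ z - ht δ p) * (q 0 - p 0) = (a - p 0) * (ht δ q - ht δ p) := by
  have hne : p 0 - q 0 ≠ 0 := by linarith
  set t := (p 0 - a) / (p 0 - q 0) with ht'
  have h0 : 0 ≤ t := div_nonneg (by linarith) (by linarith)
  have h1 : t ≤ 1 := by rw [ht', div_le_one (by linarith)]; linarith
  have e : t * (p 0 - q 0) = p 0 - a := by rw [ht']; field_simp
  set z := sq δ (p 0 + t * (q 0 - p 0)) (ht δ p + t * (ht δ q - ht δ p)) with hz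
  have hz0 : z 0 = p 0 + t * (q 0 - p 0) := by simp [hz]
  have hz1 : ht δ z = ht δ p + t * (ht δ q - ht δ p) := ht_sq hδ _ _
  have hmem : z ∈ segment ℝ p q := (mem_segment_sq hδ).2 ⟨t, h0, h1, hz0, hz1⟩
  refine ⟨z, hmem, by linarith, ?_⟩
  rw [hz1]
  linear_combination (-(ht δ q - ht δ p)) * e

theorem dist_sq_le {δ : ℝ} (hδ : 0 < δ) (u v u' v' : ℝ) :
    dist (sq δ u v) (sq δ u' v') ≤ |u - u'| + δ * |v - v'| := by
  refine (dist_le_coord _ _).trans (le_of_eq ?_)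
  simp only [sq, pt_zero, pt_one]
  rw [← mul_sub, abs_mul, abs_of_pos hδ]

theorem escapes_up {δ : ℝ} (hδ : 0 < δ) {A : Set Plane} {x : Plane}
    (h : ∀ z : Plane, z 0 = x 0 → ht δ x ≤ ht δ z → z ∈ A) : Escapes A x := by
  refine Escapes.of_ray (d := pt 0 1) (fun h => by simpa using congrArg (fun p : Plane => p 1) h)
    fun t ht0 => h _ (by simp) ?_
  simp only [ht]; gcongr; simpa using ht0

theorem escapes_down {δ : ℝ} (hδ : 0 < δ) {A : Set Plane} {x : Plane}
    (h : ∀ z : Plane, z 0 = x 0 → ht δ z ≤ ht δ x → z ∈ A) : Escapes A x := by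
  refine Escapes.of_ray (d := pt 0 (-1)) (fun h => by simpa using congrArg (fun p : Plane => p 1) h)
    fun t ht0 => h _ (by simp) ?_
  simp only [ht]; gcongr; simpa using ht0

theorem escapes_right (δ : ℝ) {A : Set Plane} {x : Plane}
    (h : ∀ z : Plane, ht δ z = ht δ x → x 0 ≤ z 0 → z ∈ A) : Escapes A x := by
  refine Escapes.of_ray (d := pt 1 0) (fun h => by simpa using congrArg (fun p : Plane => p 0) h)
    fun t ht0 => h _ (by simp [ht]) ?_
  simpa using ht0

theorem escapes_left (δ : ℝ) {A : Set Plane} {x : Plane}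
    (h : ∀ z : Plane, ht δ z = ht δ x → z 0 ≤ x 0 → z ∈ A) : Escapes A x := by
  refine Escapes.of_ray (d := pt (-1) 0) (fun h => by simpa using congrArg (fun p : Plane => p 0) h)
    fun t ht0 => h _ (by simp [ht]) ?_
  simpa using ht0

/-! ### Scenes with a triangular hole and a slit -/

/-- Parameters of the polygon: scaling factor `δ` of the heights, width `β` of the room of the start, width `w`
of the part of the room beyond the corner at the origin, slopes `s` and `s'` of the lines from the
origin to the tip of the slit and to its upper mouth point, slope `m` of its upper edge. -/
structure SlitParams (δ β w s s' m : ℝ) : Prop where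
  δ_pos : 0 < δ
  β_pos : 0 < β
  w_pos : 0 < w
  w_lt : w < 1 / 2
  s'_pos : 0 < s'
  s'_lt : s' < s
  s_le : s ≤ 1
  m_eq : m * (1 - w) = s - w * s'

/-- The outer polygon with its interior: a room and, beyond its left wall, a slit. -/
def slitIn (δ β w s m : ℝ) : Set Plane :=
  {z | (0 ≤ z 0 ∧ z 0 ≤ 5 + β ∧ 0 ≤ ht δ z ∧ ht δ z ≤ 4) ∨
    (-w ≤ z 0 ∧ z 0 ≤ 0 ∧ s * z 0 ≤ ht δ z ∧ ht δ z ≤ 4) ∨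
    (-1 ≤ z 0 ∧ z 0 ≤ -w ∧ s * z 0 ≤ ht δ z ∧ ht δ z ≤ -s + m * (z 0 + 1))}

/-- The outer polygon with its exterior. -/
def slitOut (δ β w s m : ℝ) : Set Plane :=
  {z | 5 + β ≤ z 0 ∨ 4 ≤ ht δ z ∨ z 0 ≤ -1 ∨ (0 ≤ z 0 ∧ ht δ z ≤ 0) ∨
    (z 0 ≤ 0 ∧ ht δ z ≤ s * z 0) ∨ (z 0 ≤ -w ∧ -s + m * (z 0 + 1) ≤ ht δ z)}

/-- The triangular hole with its interior. -/
def wedgeIn (δ : ℝ) : Set Plane :=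
  {z | 2 ≤ ht δ z ∧ ht δ z ≤ 2 + (z 0 - 2) / 3 ∧ z 0 ≤ 5}

/-- The triangular hole with its exterior. -/
def wedgeOut (δ : ℝ) : Set Plane :=
  {z | ht δ z ≤ 2 ∨ 2 + (z 0 - 2) / 3 ≤ ht δ z ∨ 5 ≤ z 0}

theorem continuous_ht (δ : ℝ) : Continuous (ht δ) := by unfold ht; fun_prop

theorem isBounded_of_coord {δ M : ℝ} (hδ : 0 < δ) {A : Set Plane}
    (h : ∀ z ∈ A, |z 0| ≤ M ∧ |ht δ z| ≤ M) : Bornology.IsBounded A := by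
  refine (Metric.isBounded_iff_subset_closedBall 0).2 ⟨M + δ * M, fun z hz => ?_⟩
  rw [Metric.mem_closedBall]
  refine (dist_le_coord _ _).trans ?_
  have h1 := h z hz
  have : |z 1| = δ * |ht δ z| := by
    rw [ht, abs_div, abs_of_pos hδ]; field_simp
  simp only [PiLp.zero_apply, sub_zero, this]
  nlinarith

theorem isClosed_or {p q : Plane → Prop} (hp : IsClosed {x | p x}) (hq : IsClosed {x | q x}) :
    IsClosed {x | p x ∨ q x} := hp.union hq

theorem exists_wedge {δ : ℝ} (hδ : 0 < δ) : ∃ C : SimplePolygon,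
    C.boundary = wedgeIn δ ∩ wedgeOut δ ∧ C.inside = (wedgeOut δ)ᶜ := by
  have hv := fun u v => ht_sq hδ u v
  have h1 : IsArc (fun _ _ => True) (sq δ 5 2) (sq δ 5 3) _ :=
    IsArc.single (fun h => by have := congrArg (ht δ) h; simp [hv] at this) trivial
  have h2 : IsArc (fun _ _ => True) (sq δ 5 3) (sq δ 2 2) _ :=
    IsArc.single (fun h => by have := congrArg (ht δ) h; simp [hv] at this) trivial
  have h3 := h1.concat h2 (by
    intro x hx hx'
    obtain ⟨t, t0, t1, e0, e1⟩ := (mem_segment_sq hδ).1 hx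
    obtain ⟨r, r0, r1, f0, f1⟩ := (mem_segment_sq hδ).1 hx'
    simp only [sq_zero, hv] at e0 e1 f0 f1
    apply sq_ext hδ <;> simp only [sq_zero, hv] <;> linarith)
  obtain ⟨C, hC, -⟩ := h3.close trivial
    (fun h => by have := congrArg (fun p : Plane => p 0) h; norm_num at this) (by
    rintro x (hx | hx) hx'
    · obtain ⟨t, t0, t1, e0, e1⟩ := (mem_segment_sq hδ).1 hx
      obtain ⟨r, r0, r1, f0, f1⟩ := (mem_segment_sq hδ).1 hx'
      simp only [sq_zero, hv] at e0 e1 f0 f1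
      left
      apply sq_ext hδ <;> simp only [sq_zero, hv] <;> linarith
    · obtain ⟨t, t0, t1, e0, e1⟩ := (mem_segment_sq hδ).1 hx
      obtain ⟨r, r0, r1, f0, f1⟩ := (mem_segment_sq hδ).1 hx'
      simp only [sq_zero, hv] at e0 e1 f0 f1
      right
      apply sq_ext hδ <;> simp only [sq_zero, hv] <;> linarith)
  have hC' : C.boundary = wedgeIn δ ∩ wedgeOut δ := by
    rw [hC]
    ext x
    simp only [Set.mem_union, mem_segment_sq hδ, sq_zero, hv, Set.mem_inter_iff, wedgeIn, wedgeOut,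
      Set.mem_ofPred_eq]
    constructor
    · rintro ((⟨t, t0, t1, e0, e1⟩ | ⟨t, t0, t1, e0, e1⟩) | ⟨t, t0, t1, e0, e1⟩)
      · exact ⟨⟨by linarith, by linarith, by linarith⟩, by right; right; linarith⟩
      · exact ⟨⟨by linarith, by linarith, by linarith⟩, by right; left; linarith⟩
      · exact ⟨⟨by linarith, by linarith, by linarith⟩, by left; linarith⟩
    · rintro ⟨⟨a1, a2, a3⟩, h | h | h⟩
      · right; exact ⟨(x 0 - 2) / 3, by linarith, by linarith, by linarith, by linarith⟩
      · left; right; exact ⟨(5 - x 0) / 3, by linarith, by linarith, by linarith, by linarith⟩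
      · left; left; exact ⟨ht δ x - 2, by linarith, by linarith, by linarith, by linarith⟩
  have c0 : Continuous fun z : Plane => z 0 := by fun_prop
  have c1 := continuous_ht δ
  refine ⟨C, hC', SimplePolygon.inside_eq (R := wedgeIn δ) (O := wedgeOut δ) ?_ ?_ ?_ hC' ?_ ?_⟩
  · refine (isClosed_le continuous_const c1).and ((isClosed_le c1 ?_).and
      (isClosed_le c0 continuous_const))
    fun_prop
  · have c2 : Continuous fun z : Plane => 2 + (z 0 - 2) / 3 := by fun_prop
    exact isClosed_or (isClosed_le c1 continuous_const) (isClosed_or (isClosed_le c2 c1)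
      (isClosed_le continuous_const c0))
  · intro x
    simp only [wedgeIn, wedgeOut, Set.mem_ofPred_eq]
    rcases le_total (ht δ x) 2 with h | h
    · tauto
    rcases le_total (ht δ x) (2 + (x 0 - 2) / 3) with h' | h'
    · have := le_total (x 0) 5; tauto
    · tauto
  · refine isBounded_of_coord (M := 5) hδ fun z hz => ?_
    simp only [wedgeIn, Set.mem_ofPred_eq] at hz
    rw [abs_le, abs_le]
    refine ⟨⟨?_, ?_⟩, ?_, ?_⟩ <;> linarith
  · intro x hx
    simp only [wedgeIn, Set.mem_ofPred_eq] at hx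
    by_cases h1 : 2 ≤ ht δ x
    · by_cases h2 : ht δ x ≤ 2 + (x 0 - 2) / 3
      · refine escapes_right δ fun z hz hz' hz'' => ?_
        simp only [wedgeIn, Set.mem_ofPred_eq] at hz''
        exact hx ⟨h1, h2, by linarith⟩
      · refine escapes_up hδ fun z hz hz' hz'' => ?_
        simp only [wedgeIn, Set.mem_ofPred_eq] at hz''
        apply h2; rw [← hz]; linarith
    · refine escapes_down hδ fun z hz hz' hz'' => ?_
      simp only [wedgeIn, Set.mem_ofPred_eq] at hz''
      apply h1; linarith

namespace SlitParams
variable {δ β w s s' m : ℝ}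

theorem s_lt_m (h : SlitParams δ β w s s' m) : s < m := by
  obtain ⟨h1, h2, h3, h4, h5, h6, h7, h8⟩ := h
  nlinarith

theorem mem_slitIn_or (δ β w s m : ℝ) (x : Plane) :
    x ∈ slitIn δ β w s m ∨ x ∈ slitOut δ β w s m := by
  simp only [slitIn, slitOut, Set.mem_ofPred_eq]
  by_contra hcon
  push Not at hcon
  obtain ⟨⟨A, B, D⟩, E, F, G, H, I, J⟩ := hcon
  rcases le_total 0 (x 0) with h | h
  · have := A h E.le (H h).le; linarith
  · rcases le_total (-w) (x 0) with h' | h'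
    · have := B h' h (I h).le; linarith
    · have := D G.le h' (I h).le
      have := J h'; linarith

theorem exists_boundary (h : SlitParams δ β w s s' m) : ∃ C : SimplePolygon,
    C.boundary = slitIn δ β w s m ∩ slitOut δ β w s m := by
  have hsm := h.s_lt_m
  obtain ⟨hδ, hβ, hw, hw2, hs', hs's, hs, hm⟩ := h
  have hv := fun u v => ht_sq hδ u v
  have hws : w * s < 1 / 2 := by nlinarith
  have hws' : w * s' < w * s := by nlinarith
  have hws0 : 0 < w * s' := by positivity
  -- the edges in terms of equations and inequalities
  have e0 : ∀ x, x ∈ segment ℝ (sq δ (5 + β) 0) (sq δ 0 0) ↔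
      ht δ x = 0 ∧ 0 ≤ x 0 ∧ x 0 ≤ 5 + β := by
    intro x
    simp only [mem_segment_sq hδ, sq_zero, hv]
    constructor
    · rintro ⟨t, t0, t1, f0, f1⟩
      refine ⟨by linarith, ?_, ?_⟩ <;> nlinarith
    · rintro ⟨f1, f2, f3⟩
      refine ⟨(5 + β - x 0) / (5 + β), div_nonneg (by linarith) (by linarith), ?_, ?_, by linarith⟩
      · rw [div_le_one (by linarith)]; linarith
      · field_simp; ring
  have e1 : ∀ x, x ∈ segment ℝ (sq δ 0 0) (sq δ (-1) (-s)) ↔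
      ht δ x = s * x 0 ∧ -1 ≤ x 0 ∧ x 0 ≤ 0 := by
    intro x
    simp only [mem_segment_sq hδ, sq_zero, hv]
    constructor
    · rintro ⟨t, t0, t1, f0, f1⟩
      exact ⟨by rw [f0, f1]; ring, by linarith, by linarith⟩
    · rintro ⟨f1, f2, f3⟩
      exact ⟨-x 0, by linarith, by linarith, by linarith, by linarith⟩
  have e2 : ∀ x, x ∈ segment ℝ (sq δ (-1) (-s)) (sq δ (-w) (-(w * s'))) ↔
      ht δ x = -s + m * (x 0 + 1) ∧ -1 ≤ x 0 ∧ x 0 ≤ -w := by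
    intro x
    simp only [mem_segment_sq hδ, sq_zero, hv]
    constructor
    · rintro ⟨t, t0, t1, f0, f1⟩
      refine ⟨?_, ?_, ?_⟩
      · rw [f0, f1]; linear_combination (-t) * hm
      · nlinarith
      · nlinarith
    · rintro ⟨f1, f2, f3⟩
      have h1w : 1 - w ≠ 0 := by linarith
      have key : (x 0 + 1) / (1 - w) * (1 - w) = x 0 + 1 := by field_simp
      refine ⟨(x 0 + 1) / (1 - w), div_nonneg (by linarith) (by linarith), ?_, ?_, ?_⟩
      · rw [div_le_one (by linarith)]; linarith
      · linear_combination -key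
      · rw [f1]; linear_combination (-m) * key + (x 0 + 1) / (1 - w) * hm
  have e3 : ∀ x, x ∈ segment ℝ (sq δ (-w) (-(w * s'))) (sq δ (-w) 4) ↔
      x 0 = -w ∧ -(w * s') ≤ ht δ x ∧ ht δ x ≤ 4 := by
    intro x
    simp only [mem_segment_sq hδ, sq_zero, hv]
    have hp : 0 < 4 + w * s' := by linarith
    constructor
    · rintro ⟨t, t0, t1, f0, f1⟩
      refine ⟨by linarith, ?_, ?_⟩ <;> nlinarith
    · rintro ⟨f1, f2, f3⟩
      refine ⟨(ht δ x + w * s') / (4 + w * s'), div_nonneg (by linarith) (by linarith), ?_,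
        by linarith, ?_⟩
      · rw [div_le_one (by linarith)]; linarith
      · field_simp; ring
  have e4 : ∀ x, x ∈ segment ℝ (sq δ (-w) 4) (sq δ (5 + β) 4) ↔
      ht δ x = 4 ∧ -w ≤ x 0 ∧ x 0 ≤ 5 + β := by
    intro x
    simp only [mem_segment_sq hδ, sq_zero, hv]
    have hp : 0 < 5 + β + w := by linarith
    constructor
    · rintro ⟨t, t0, t1, f0, f1⟩
      refine ⟨by linarith, ?_, ?_⟩ <;> nlinarith
    · rintro ⟨f1, f2, f3⟩
      refine ⟨(x 0 + w) / (5 + β + w), div_nonneg (by linarith) (by linarith), ?_, ?_, by linarith⟩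
      · rw [div_le_one (by linarith)]; linarith
      · field_simp; ring
  have e5 : ∀ x, x ∈ segment ℝ (sq δ (5 + β) 4) (sq δ (5 + β) 0) ↔
      x 0 = 5 + β ∧ 0 ≤ ht δ x ∧ ht δ x ≤ 4 := by
    intro x
    simp only [mem_segment_sq hδ, sq_zero, hv]
    constructor
    · rintro ⟨t, t0, t1, f0, f1⟩
      refine ⟨by linarith, ?_, ?_⟩ <;> linarith
    · rintro ⟨f1, f2, f3⟩
      exact ⟨(4 - ht δ x) / 4, by linarith, by linarith, by linarith, by linarith⟩
  have one : ∀ {u v u' v' : ℝ}, (u ≠ u' ∨ v ≠ v') → IsArc (fun _ _ => True) (sq δ u v) (sq δ u' v')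
      (segment ℝ (sq δ u v) (sq δ u' v')) := by
    intro u v u' v' hne
    refine IsArc.single (fun h => ?_) trivial
    have h0 := congrArg (fun p : Plane => p 0) h
    have h1 := congrArg (ht δ) h
    simp only [sq_zero, hv] at h0 h1
    tauto
  have fin : ∀ {x : Plane} {u v : ℝ}, x 0 = u → ht δ x = v → x = sq δ u v := by
    intro x u v h0 h1
    exact sq_ext hδ (by simp [h0]) (by simp [hv, h1])
  have a1 := (one (u := 5 + β) (v := 0) (u' := 0) (v' := 0) (Or.inl (by linarith))).concat
    (one (u := 0) (v := 0) (u' := -1) (v' := -s) (Or.inl (by norm_num))) (by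
      intro x hx hx'
      rw [e0] at hx; rw [e1] at hx'
      exact fin (by linarith) (by linarith))
  have a2 := a1.concat (one (u := -1) (v := -s) (u' := -w) (v' := -(w * s'))
      (Or.inl (by linarith))) (by
      rintro x (hx | hx) hx'
      · rw [e0] at hx; rw [e2] at hx'; linarith
      · rw [e1] at hx; rw [e2] at hx'
        have : (m - s) * (x 0 + 1) = 0 := by linarith
        rcases mul_eq_zero.1 this with h | h
        · linarith
        · have : x 0 = -1 := by linarith
          exact fin this (by rw [hx.1, this]; ring))
  have a3 := a2.concat (one (u := -w) (v := -(w * s')) (u' := -w) (v' := 4)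
      (Or.inr (by linarith))) (by
      rintro x ((hx | hx) | hx) hx'
      · rw [e0] at hx; rw [e3] at hx'; linarith
      · rw [e1] at hx; rw [e3] at hx'
        rw [hx'.1] at hx; linarith
      · rw [e2] at hx; rw [e3] at hx'
        rw [hx'.1] at hx
        exact fin hx'.1 (by linarith))
  have a4 := a3.concat (one (u := -w) (v := 4) (u' := 5 + β) (v' := 4)
      (Or.inl (by linarith))) (by
      rintro x (((hx | hx) | hx) | hx) hx'
      · rw [e0] at hx; rw [e4] at hx'; linarith
      · rw [e1] at hx; rw [e4] at hx'; nlinarith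
      · rw [e2] at hx; rw [e4] at hx'
        have : x 0 = -w := by linarith
        rw [this] at hx; linarith
      · rw [e3] at hx; rw [e4] at hx'
        exact fin (by linarith) (by linarith))
  obtain ⟨C, hC, -⟩ := a4.close trivial (fun h => by
      have := congrArg (ht δ) h
      simp [hv] at this) (by
      rintro x ((((hx | hx) | hx) | hx) | hx) hx'
      · rw [e0] at hx; rw [e5] at hx'; left; exact fin hx'.1 hx.1
      · rw [e1] at hx; rw [e5] at hx'; linarith
      · rw [e2] at hx; rw [e5] at hx'; linarith
      · rw [e3] at hx; rw [e5] at hx'; linarith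
      · rw [e4] at hx; rw [e5] at hx'; right; exact fin hx'.1 hx.1)
  have hC' : C.boundary = slitIn δ β w s m ∩ slitOut δ β w s m := by
    rw [hC]
    ext x
    simp only [Set.mem_union, e0, e1, e2, e3, e4, e5, Set.mem_inter_iff, slitIn, slitOut,
      Set.mem_ofPred_eq]
    constructor
    · rintro (((((⟨h1, h2, h3⟩ | ⟨h1, h2, h3⟩) | ⟨h1, h2, h3⟩) | ⟨h1, h2, h3⟩) | ⟨h1, h2, h3⟩) |
        ⟨h1, h2, h3⟩)
      · exact ⟨Or.inl ⟨h2, h3, by linarith, by linarith⟩, by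
          right; right; right; left; exact ⟨h2, h1.le⟩⟩
      · refine ⟨Or.inr ?_, by right; right; right; right; left; exact ⟨h3, h1.le⟩⟩
        rcases le_total (-w) (x 0) with h | h
        · left; exact ⟨h, h3, h1.ge, by nlinarith⟩
        · right; exact ⟨h2, h, h1.ge, by nlinarith⟩
      · exact ⟨Or.inr (Or.inr ⟨h2, h3, by nlinarith, h1.le⟩), by
          right; right; right; right; right; exact ⟨h3, h1.ge⟩⟩
      · refine ⟨Or.inr (Or.inl ⟨h1.ge, by linarith, by rw [h1]; linarith, h3⟩), ?_⟩
        right; right; right; right; right; exact ⟨h1.le, by rw [h1]; linarith⟩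
      · refine ⟨?_, by right; left; exact h1.ge⟩
        rcases le_total (x 0) 0 with h | h
        · right; left; exact ⟨h2, h, by nlinarith, h1.le⟩
        · left; exact ⟨h, h3, by linarith, h1.le⟩
      · exact ⟨Or.inl ⟨by linarith, h1.le, h2, h3⟩, Or.inl h1.ge⟩
    · rintro ⟨⟨h1, h2, h3, h4⟩ | ⟨h1, h2, h3, h4⟩ | ⟨h1, h2, h3, h4⟩, h⟩
      · rcases h with h | h | h | ⟨h, h'⟩ | ⟨h, h'⟩ | ⟨h, h'⟩
        · right; exact ⟨by linarith, h3, h4⟩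
        · left; right; exact ⟨by linarith, by linarith, h2⟩
        · linarith
        · left; left; left; left; left; exact ⟨by linarith, h1, h2⟩
        · have : x 0 = 0 := by linarith
          rw [this] at h'
          left; left; left; left; left; exact ⟨by linarith, h1, h2⟩
        · linarith
      · rcases h with h | h | h | ⟨h, h'⟩ | ⟨h, h'⟩ | ⟨h, h'⟩
        · linarith
        · left; right; exact ⟨by linarith, by linarith, by linarith⟩
        · linarith
        · have : x 0 = 0 := by linarith
          rw [this] at h3
          left; left; left; left; left; exact ⟨by linarith, h, by linarith⟩
        · left; left; left; left; right; exact ⟨by linarith, by linarith, h⟩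
        · have : x 0 = -w := by linarith
          rw [this] at h'
          left; left; right; exact ⟨this, by linarith, h4⟩
      · have hle : m * (x 0 + 1) ≤ m * (1 - w) := by nlinarith
        rcases h with h | h | h | ⟨h, h'⟩ | ⟨h, h'⟩ | ⟨h, h'⟩
        · linarith
        · linarith
        · have : x 0 = -1 := by linarith
          rw [this] at h3 h4
          left; left; left; left; right; exact ⟨by rw [this]; linarith, h1, by linarith⟩
        · linarith
        · left; left; left; left; right; exact ⟨by linarith, h1, h⟩
        · left; left; left; right; exact ⟨by linarith, h1, h2⟩
  exact ⟨C, hC'⟩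

theorem exists_outer (h : SlitParams δ β w s s' m) : ∃ C : SimplePolygon,
    C.boundary = slitIn δ β w s m ∩ slitOut δ β w s m ∧ C.inside = (slitOut δ β w s m)ᶜ := by
  obtain ⟨C, hC'⟩ := h.exists_boundary
  have hsm := h.s_lt_m
  have hcov := mem_slitIn_or δ β w s m
  obtain ⟨hδ, hβ, hw, hw2, hs', hs's, hs, hm⟩ := h
  have hws : w * s < 1 / 2 := by nlinarith
  have hws' : w * s' < w * s := by nlinarith
  have hws0 : 0 < w * s' := by positivity
  have c0 : Continuous fun z : Plane => z 0 := by fun_prop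
  have c1 := continuous_ht δ
  have c2 : Continuous fun z : Plane => s * z 0 := by fun_prop
  have c3 : Continuous fun z : Plane => -s + m * (z 0 + 1) := by fun_prop
  have cc : ∀ r : ℝ, Continuous fun _ : Plane => r := fun r => continuous_const
  refine ⟨C, hC', SimplePolygon.inside_eq (R := slitIn δ β w s m) (O := slitOut δ β w s m)
    ?_ ?_ ?_ hC' ?_ ?_⟩
  · exact isClosed_or ((isClosed_le (cc _) c0).and <| (isClosed_le c0 (cc _)).and <|
        (isClosed_le (cc _) c1).and (isClosed_le c1 (cc _))) <| isClosed_or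
      ((isClosed_le (cc _) c0).and <| (isClosed_le c0 (cc _)).and <|
        (isClosed_le c2 c1).and (isClosed_le c1 (cc _)))
      ((isClosed_le (cc _) c0).and <| (isClosed_le c0 (cc _)).and <|
        (isClosed_le c2 c1).and (isClosed_le c1 c3))
  · exact isClosed_or (isClosed_le (cc _) c0) <| isClosed_or (isClosed_le (cc _) c1) <|
      isClosed_or (isClosed_le c0 (cc _)) <|
      isClosed_or ((isClosed_le (cc _) c0).and (isClosed_le c1 (cc _))) <|
      isClosed_or ((isClosed_le c0 (cc _)).and (isClosed_le c1 c2))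
      ((isClosed_le c0 (cc _)).and (isClosed_le c3 c1))
  · exact hcov
  · refine isBounded_of_coord (M := 5 + β) hδ fun z hz => ?_
    simp only [slitIn, Set.mem_ofPred_eq] at hz
    rw [abs_le, abs_le]
    rcases hz with hz | hz | hz
    · refine ⟨⟨?_, ?_⟩, ?_, ?_⟩ <;> linarith
    · refine ⟨⟨?_, ?_⟩, ?_, ?_⟩ <;> nlinarith
    · have hle : m * (z 0 + 1) ≤ m * (1 - w) := by nlinarith
      refine ⟨⟨?_, ?_⟩, ?_, ?_⟩ <;> nlinarith
  · intro x hx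
    have hup : ∀ z ∈ slitIn δ β w s m, ht δ z ≤ 4 ∧ z 0 ≤ 5 + β ∧ -1 ≤ z 0 := by
      intro z hz
      simp only [slitIn, Set.mem_ofPred_eq] at hz
      rcases hz with hz | hz | hz
      · refine ⟨?_, ?_, ?_⟩ <;> linarith
      · refine ⟨?_, ?_, ?_⟩ <;> linarith
      · have hle : m * (z 0 + 1) ≤ m * (1 - w) := by nlinarith
        refine ⟨?_, ?_, ?_⟩ <;> linarith
    by_cases h1 : ht δ x ≤ 4
    swap
    · exact escapes_up hδ fun z hz hz' hz'' => h1 (by linarith [(hup z hz'').1])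
    by_cases h2 : x 0 ≤ 5 + β
    swap
    · exact escapes_right δ fun z hz hz' hz'' => h2 (by linarith [(hup z hz'').2.1])
    by_cases h3 : -1 ≤ x 0
    swap
    · exact escapes_left δ fun z hz hz' hz'' => h3 (by linarith [(hup z hz'').2.2])
    rcases le_or_gt 0 (x 0) with h4 | h4
    · refine escapes_down hδ fun z hz hz' hz'' => hx (Or.inl ⟨h4, h2, ?_, h1⟩)
      simp only [slitIn, Set.mem_ofPred_eq, hz] at hz''
      rcases hz'' with hz'' | hz'' | hz''
      · linarith
      · have : x 0 = 0 := by linarith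
        rw [this] at hz''; linarith
      · linarith
    · rcases lt_or_ge (ht δ x) (s * x 0) with h5 | h5
      · refine escapes_down hδ fun z hz hz' hz'' => ?_
        simp only [slitIn, Set.mem_ofPred_eq, hz] at hz''
        rcases hz'' with hz'' | hz'' | hz'' <;> linarith
      · rcases le_or_gt (-w) (x 0) with h6 | h6
        · exact absurd (Or.inr (Or.inl ⟨h6, h4.le, h5, h1⟩)) hx
        · refine escapes_up hδ fun z hz hz' hz'' =>
            hx (Or.inr (Or.inr ⟨h3, h6.le, h5, ?_⟩))
          simp only [slitIn, Set.mem_ofPred_eq, hz] at hz''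
          rcases hz'' with hz'' | hz'' | hz'' <;> linarith

theorem exists_scene (h : SlitParams δ β w s s' m) : ∃ P : Scene,
    P.region = slitIn δ β w s m ∩ wedgeOut δ ∧
    P.outer.boundary = slitIn δ β w s m ∩ slitOut δ β w s m ∧
    P.holeBoundary = wedgeIn δ ∩ wedgeOut δ ∧ P.start = sq δ (5 + β) 2 := by
  obtain ⟨C, hC, hCi⟩ := h.exists_outer
  obtain ⟨H, hH, hHi⟩ := exists_wedge h.δ_pos
  have hsm := h.s_lt_m
  have hcov := mem_slitIn_or δ β w s m
  obtain ⟨hδ, hβ, hw, hw2, hs', hs's, hs, hm⟩ := h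
  refine ⟨⟨C, some H, ?_, sq δ (5 + β) 2, ?_⟩, ?_, hC, ?_, rfl⟩
  · intro H' hH'
    obtain rfl : H = H' := by simpa using hH'
    rw [hH, hCi]
    rintro x ⟨hx, -⟩ hx'
    simp only [wedgeIn, slitOut, Set.mem_ofPred_eq] at hx hx'
    rcases hx' with h | h | h | h | h | h <;> linarith
  · rw [hC]
    simp only [slitIn, slitOut, Set.mem_inter_iff, Set.mem_ofPred_eq, sq_zero, ht_sq hδ]
    exact ⟨Or.inl ⟨by linarith, le_rfl, by norm_num, by norm_num⟩, Or.inl le_rfl⟩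
  · have : C.boundary ∪ C.inside = slitIn δ β w s m := by
      rw [hC, hCi]; ext x
      simp only [Set.mem_union, Set.mem_inter_iff, Set.mem_compl_iff]
      have := hcov x
      by_cases hx : x ∈ slitOut δ β w s m <;> simp_all
    simp only [Scene.region, this]
    ext x
    simp [hHi]
  · simp [Scene.holeBoundary, hH]

end SlitParams

/-! ### Lines of sight into the slit -/

/-- `P` is the scene with a triangular hole, and a slit with the given parameters. -/
structure IsSlitScene (P : Scene) (δ β w s s' m : ℝ) : Prop where
  params : SlitParams δ β w s s' m
  region_eq : P.region = slitIn δ β w s m ∩ wedgeOut δ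
  outer_eq : P.outer.boundary = slitIn δ β w s m ∩ slitOut δ β w s m
  hole_eq : P.holeBoundary = wedgeIn δ ∩ wedgeOut δ
  start_eq : P.start = sq δ (5 + β) 2

theorem SlitParams.exists_isSlitScene {δ β w s s' m : ℝ} (h : SlitParams δ β w s s' m) :
    ∃ P, IsSlitScene P δ β w s s' m := by
  obtain ⟨P, h1, h2, h3, h4⟩ := h.exists_scene
  exact ⟨P, h, h1, h2, h3, h4⟩

theorem segment_subset_of_mem {p q z : Plane} (h : z ∈ segment ℝ p q) :
    segment ℝ z q ⊆ segment ℝ p q :=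
  (convex_segment p q).segment_subset h (right_mem_segment _ _ _)

theorem segment_subset_of_mem_left {p q z : Plane} (h : z ∈ segment ℝ p q) :
    segment ℝ p z ⊆ segment ℝ p q :=
  (convex_segment p q).segment_subset (left_mem_segment _ _ _) h

/-- Positions from which one cannot see deeply into a slit whose lines of sight have slopes larger
than `σ`: next to the start; below the hole, to the right of the line of slope `σ` through the
origin, which meets the lower side of the hole where `σ * x 0 = 2`; and above the hole to the right
of `4 + w`, from where the slit is hidden by the tip of the hole at `(2, 2)`. -/
def Blind (δ w σ : ℝ) (x : Plane) : Prop :=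
  4.9 ≤ x 0 ∨ (ht δ x ≤ 2 ∧ 2 ≤ σ * x 0) ∨ (2 < ht δ x ∧ 4 + w ≤ x 0)

namespace IsSlitScene
variable {P P' : Scene} {δ β w s s' m t t' k σ : ℝ}

theorem mem_region_iff (h : IsSlitScene P δ β w s s' m) (x : Plane) :
    x ∈ P.region ↔ x ∈ slitIn δ β w s m ∧ x ∈ wedgeOut δ := by rw [h.region_eq]; rfl

/-- A line of sight into the slit passes through its mouth. -/
theorem exists_mouth (h : IsSlitScene P δ β w s s' m) {x z : Plane}
    (hxz : segment ℝ x z ⊆ P.region) (hx : -w ≤ x 0) (hz : z 0 < -w) :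
    ∃ p ∈ segment ℝ x z, p 0 = -w ∧ ht δ p ≤ -(w * s') ∧
      (ht δ p - ht δ x) * (z 0 - x 0) = (-w - x 0) * (ht δ z - ht δ x) := by
  obtain ⟨hδ, hβ, hw, hw2, hs', hs's, hs, hm⟩ := h.params
  obtain ⟨p, hp, hp0, hpe⟩ := exists_mem_segment_zero hδ (p := x) (q := z) (a := -w) hz.le hx
    (by linarith)
  refine ⟨p, hp, hp0, ?_, hpe⟩
  have slit : ∀ y ∈ segment ℝ x z, y 0 < -w → ht δ y ≤ -s + m * (y 0 + 1) := by
    intro y hy hyw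
    have := ((h.mem_region_iff y).1 (hxz hy)).1
    simp only [slitIn, Set.mem_ofPred_eq] at this
    rcases this with h | h | h
    · linarith
    · linarith
    · exact h.2.2.2
  by_contra hlt
  have d1 : 0 < ht δ p + w * s' := by linarith
  have d2 := slit z (right_mem_segment _ _ _) hz
  set D := ht δ p + w * s' - (ht δ z - (-s + m * (z 0 + 1))) with hD
  have hDpos : 0 < D := by linarith
  set r := (ht δ p + w * s') / (2 * D) with hr
  have hr0 : 0 < r := by positivity
  have hrD : r * D = (ht δ p + w * s') / 2 := by rw [hr]; field_simp
  have hr1 : r ≤ 1 := by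
    rw [hr, div_le_one (by positivity)]; linarith
  have hy : sq δ (p 0 + r * (z 0 - p 0)) (ht δ p + r * (ht δ z - ht δ p)) ∈ segment ℝ p z :=
    (mem_segment_sq hδ).2 ⟨r, hr0.le, hr1, by simp, by rw [ht_sq hδ]⟩
  have := slit _ (segment_subset_of_mem hp hy) (by rw [sq_zero, hp0]; nlinarith)
  rw [sq_zero, ht_sq hδ, hp0] at this
  have e : ht δ p + r * (ht δ z - ht δ p) - (-s + m * (-w + r * (z 0 - -w) + 1)) =
      (ht δ p + w * s') - r * D := by
    rw [hD]; linear_combination (-1 + r) * hm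
  linarith

theorem ht_mem (h : IsSlitScene P δ β w s s' m) {x : Plane} (hx : x ∈ P.region) (hx0 : 0 ≤ x 0) :
    0 ≤ ht δ x ∧ ht δ x ≤ 4 ∧ x 0 ≤ 5 + β := by
  obtain ⟨hδ, hβ, hw, hw2, hs', hs's, hs, hm⟩ := h.params
  have := ((h.mem_region_iff x).1 hx).1
  simp only [slitIn, Set.mem_ofPred_eq] at this
  rcases this with h | h | h
  · exact ⟨h.2.2.1, h.2.2.2, h.2.1⟩
  · have : x 0 = 0 := by linarith
    rw [this] at h
    exact ⟨by linarith, h.2.2.2, by linarith⟩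
  · linarith

theorem upper_of_lt (h : IsSlitScene P δ β w s s' m) {x : Plane} (hx : x ∈ P.region)
    (h2 : 2 < ht δ x) (h5 : x 0 < 5) : 2 + (x 0 - 2) / 3 ≤ ht δ x := by
  have := ((h.mem_region_iff x).1 hx).2
  simp only [wedgeOut, Set.mem_ofPred_eq] at this
  rcases this with h | h | h
  · linarith
  · exact h
  · linarith

/-- The points from which the tip of the slit is visible lie in a narrow wedge. -/
theorem sees_tip (h : IsSlitScene P δ β w s s' m) {x : Plane}
    (hx : segment ℝ x (sq δ (-1) (-s)) ⊆ P.region) (hx0 : 0 ≤ x 0) :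
    s * x 0 ≤ ht δ x ∧ ht δ x ≤ -s + m * (x 0 + 1) := by
  have hp := h.params
  obtain ⟨hδ, hβ, hw, hw2, hs', hs's, hs, hm⟩ := hp
  obtain ⟨y, hy, hy0, hye⟩ := exists_mem_segment_zero hδ (p := x) (q := sq δ (-1) (-s)) (a := 0)
    (by simp) hx0 (by simp; linarith)
  obtain ⟨p, hp, hp0, hpm, hpe⟩ := h.exists_mouth hx (by linarith) (by simp; linarith)
  have := (h.ht_mem (hx hy) hy0.ge).1
  simp only [sq_zero, ht_sq hδ] at hye hpe
  constructor
  · nlinarith [mul_nonneg this (by linarith : 0 ≤ 1 + x 0)]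
  · have h1 : ht δ p * (1 + x 0) ≤ -(w * s') * (1 + x 0) :=
      mul_le_mul_of_nonneg_right hpm (by linarith)
    have h2 : ht δ x * (1 - w) ≤ (-s + m * (x 0 + 1)) * (1 - w) := by
      have : (-s + m * (x 0 + 1)) * (1 - w) = -s * (1 - w) + (x 0 + 1) * (s - w * s') := by
        linear_combination (x 0 + 1) * hm
      rw [this]
      linarith
    exact le_of_mul_le_mul_right h2 (by linarith)

/-- If the slope is small, the tip of the slit is visible only from below the hole, and from the
left of the hole. -/
theorem sees_tip_flat (h : IsSlitScene P δ β w s s' m) (hs1 : 0.42 ≤ s) (hs2 : s ≤ 0.598)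
    (hm : m ≤ s + 0.005) {x : Plane} (hx : segment ℝ x (sq δ (-1) (-s)) ⊆ P.region) :
    x 0 ≤ 2 ∨ (ht δ x ≤ 2 ∧ s * x 0 ≤ 2) := by
  have hδ := h.params.δ_pos
  by_cases h2 : x 0 ≤ 2
  · exact Or.inl h2
  have low : ∀ y, segment ℝ y (sq δ (-1) (-s)) ⊆ P.region → 2 < y 0 → y 0 ≤ 4.9 → ht δ y ≤ 2 := by
    intro y hy hy2 hy5
    by_contra hlt
    have h1 := h.upper_of_lt (hy (left_mem_segment _ _ _)) (not_le.1 hlt) (by linarith)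
    have h3 := (h.sees_tip hy (by linarith)).2
    nlinarith
  rcases le_or_gt (x 0) 4.9 with h5 | h5
  · have h3 := low x hx (not_le.1 h2) h5
    exact Or.inr ⟨h3, (h.sees_tip hx (by linarith)).1.trans h3⟩
  · obtain ⟨y, hy, hy0, -⟩ := exists_mem_segment_zero hδ (p := x) (q := sq δ (-1) (-s))
      (a := 4.9) (by norm_num) h5.le (by simp; linarith)
    have hy' := (segment_subset_of_mem hy).trans hx
    have h3 := low y hy' (by rw [hy0]; norm_num) hy0.le
    have h4 := (h.sees_tip hy' (by rw [hy0]; norm_num)).1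
    rw [hy0] at h4
    exfalso
    linarith

/-- If the slope is `1`, the tip of the slit is visible from the right of the tip of the hole only
on or above the line of slope `1` through the origin, which is on the upper side of the hole. -/
theorem sees_tip_steep (h : IsSlitScene P δ β w 1 s' m) {x : Plane}
    (hx : segment ℝ x (sq δ (-1) (-1)) ⊆ P.region) :
    x 0 ≤ 2 ∨ (2 < ht δ x ∧ x 0 ≤ 4) := by
  by_cases h2 : x 0 ≤ 2
  · exact Or.inl h2
  have h1 := (h.sees_tip hx (by linarith)).1
  have h3 := (h.ht_mem (hx (left_mem_segment _ _ _)) (by linarith)).2.1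
  exact Or.inr ⟨by linarith, by linarith⟩

theorem tip_mem (h : IsSlitScene P δ β w s s' m) : sq δ (-1) (-s) ∈ P.region := by
  obtain ⟨hδ, hβ, hw, hw2, hs', hs's, hs, hm⟩ := h.params
  rw [h.mem_region_iff]
  simp only [slitIn, wedgeOut, Set.mem_ofPred_eq, sq_zero, ht_sq hδ]
  exact ⟨Or.inr (Or.inr ⟨le_rfl, by linarith, by linarith, by linarith⟩), Or.inl (by linarith)⟩

/-- From a blind position only the part of the slit scene above the line of slope `σ` through the
origin is visible. -/
theorem blind_segment (h : IsSlitScene P δ β w s s' m) (hσ : σ < s') (hσ2 : 2 ≤ σ * 4.9)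
    {x z : Plane} (hx : Blind δ w σ x) (hxz : segment ℝ x z ⊆ P.region) (hz : z 0 < 0) :
    -w ≤ z 0 ∧ σ * z 0 ≤ ht δ z := by
  have hsm := h.params.s_lt_m
  obtain ⟨hδ, hβ, hw, hw2, hs', hs's, hs, hm⟩ := h.params
  have hσ0 : 0 < σ := by linarith
  have slit : z 0 < -w → ht δ z ≤ -s + m * (z 0 + 1) := by
    intro hyw
    have := ((h.mem_region_iff z).1 (hxz (right_mem_segment _ _ _))).1
    simp only [slitIn, Set.mem_ofPred_eq] at this
    rcases this with h | h | h
    · linarith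
    · linarith
    · exact h.2.2.2
  have lower : ∀ y, segment ℝ y z ⊆ P.region → ht δ y ≤ 2 → 2 ≤ σ * y 0 →
      -w ≤ z 0 ∧ σ * z 0 ≤ ht δ z := by
    intro y hyz hy1 hy2
    have hy0 : 0 < y 0 := by
      by_contra hlt
      nlinarith
    obtain ⟨p, hp, hp0, hpe⟩ := exists_mem_segment_zero hδ (p := y) (q := z) (a := 0)
      hz.le hy0.le (by linarith)
    have hp1 := (h.ht_mem (hyz hp) hp0.ge).1
    have h1 : σ * z 0 ≤ ht δ z := by
      have h2 : y 0 * (σ * z 0) ≤ y 0 * ht δ z := by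
        have h3 : 0 ≤ ht δ p * (y 0 - z 0) := mul_nonneg hp1 (by linarith)
        have h4 : z 0 * (σ * y 0) ≤ z 0 * ht δ y :=
          mul_le_mul_of_nonpos_left (by linarith) hz.le
        nlinarith
      exact le_of_mul_le_mul_left h2 hy0
    refine ⟨?_, h1⟩
    by_contra hlt
    have h2 := slit (by linarith)
    have h3 : (m - σ) * (z 0 + w) < 0 := mul_neg_of_pos_of_neg (by linarith) (by linarith)
    nlinarith
  have upper : ∀ y, segment ℝ y z ⊆ P.region → 2 < ht δ y → 4 + w ≤ y 0 → y 0 < 5 →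
      -w ≤ z 0 ∧ σ * z 0 ≤ ht δ z := by
    intro y hyz hy1 hy2 hy5
    have hyr := hyz (left_mem_segment _ _ _)
    have hyu := h.upper_of_lt hyr hy1 hy5
    obtain ⟨p, hp, hp0, hpe⟩ := exists_mem_segment_zero hδ (p := y) (q := z) (a := 2)
      (by linarith) (by linarith) (by linarith)
    have hp2 : 2 ≤ ht δ p := by
      by_contra hlt
      set g := ht δ y - 2 - (y 0 - 2) / 6 with hg
      have hg0 : 0 < g := by rw [hg]; linarith
      set r := g / (g + (2 - ht δ p)) with hr
      have hD : 0 < g + (2 - ht δ p) := by linarith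
      have hr0 : 0 < r := by positivity
      have hr1 : r < 1 := by rw [hr, div_lt_one hD]; linarith
      have hrD : r * (g + (2 - ht δ p)) = g := by rw [hr]; field_simp
      have hc : sq δ (y 0 + r * (p 0 - y 0)) (ht δ y + r * (ht δ p - ht δ y)) ∈ segment ℝ y p :=
        (mem_segment_sq hδ).2 ⟨r, hr0.le, hr1.le, by simp, by rw [ht_sq hδ]⟩
      have hc' := ((h.mem_region_iff _).1 (hyz (segment_subset_of_mem_left hp hc))).2
      simp only [wedgeOut, Set.mem_ofPred_eq, sq_zero, ht_sq hδ, hp0] at hc'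
      have e : ht δ y + r * (ht δ p - ht δ y) = 2 + (y 0 + r * (2 - y 0) - 2) / 6 := by
        rw [hg] at hrD; linarith
      have e2 : 0 < (1 - r) * (y 0 - 2) := mul_pos (by linarith) (by linarith)
      have e3 : 0 < r * (y 0 - 2) := mul_pos hr0 (by linarith)
      rw [e] at hc'
      rcases hc' with h | h | h <;> linarith
    have above : ∀ q ∈ segment ℝ y z, q 0 < 0 → -w ≤ q 0 → 0 ≤ ht δ q := by
      intro q hq hq0 hqw
      obtain ⟨p', hp', hp'0, hp'e⟩ := exists_mem_segment_zero hδ (p := y) (q := q) (a := 2)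
        (by linarith) (by linarith) (by linarith)
      have : p' = p := by
        apply sq_ext hδ (by rw [hp'0, hp0])
        obtain ⟨r, -, -, r0, r1⟩ := (mem_segment_sq hδ).1 hq
        have h1 : (ht δ p' - ht δ p) * (r * (z 0 - y 0)) = 0 := by
          have e1 : q 0 - y 0 = r * (z 0 - y 0) := by linarith
          have e2 : ht δ q - ht δ y = r * (ht δ z - ht δ y) := by linarith
          rw [e1, e2] at hp'e
          linear_combination hp'e - r * hpe
        rcases mul_eq_zero.1 h1 with h1 | h1
        · linarith
        · linarith
      subst this
      have h4 := (h.ht_mem hyr (by linarith)).2.1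
      have h5 : 0 ≤ ht δ q * (y 0 - 2) := by
        have : 2 * (y 0 - q 0) ≤ ht δ p' * (y 0 - q 0) :=
          mul_le_mul_of_nonneg_right hp2 (by linarith)
        have : ht δ y * (2 - q 0) ≤ 4 * (2 - q 0) :=
          mul_le_mul_of_nonneg_right h4 (by linarith)
        nlinarith
      by_contra hlt
      nlinarith
    have hzw : -w ≤ z 0 := by
      by_contra hlt
      obtain ⟨q, hq, hq0, hqm, -⟩ := h.exists_mouth hyz (by linarith) (not_le.1 hlt)
      have := above q hq (by linarith) hq0.ge
      have : 0 < w * s' := by positivity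
      linarith
    have := above z (right_mem_segment _ _ _) hz hzw
    exact ⟨hzw, by nlinarith⟩
  have near : ∀ y, segment ℝ y z ⊆ P.region → y 0 = 4.9 → -w ≤ z 0 ∧ σ * z 0 ≤ ht δ z := by
    intro y hyz hy
    rcases le_or_gt (ht δ y) 2 with h2 | h2
    · exact lower y hyz h2 (by rw [hy]; exact hσ2)
    · exact upper y hyz h2 (by rw [hy]; linarith) (by rw [hy]; norm_num)
  rcases le_or_gt 4.9 (x 0) with hx5 | hx5
  · obtain ⟨y, hy, hy0, -⟩ := exists_mem_segment_zero hδ (p := x) (q := z)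
      (a := 4.9) (by linarith) hx5 (by linarith)
    exact near y ((segment_subset_of_mem hy).trans hxz) hy0
  · rcases hx with hx | hx | hx
    · linarith
    · exact lower x hxz hx.1 hx.2
    · exact upper x hxz hx.1 hx.2 (by linarith)

/-- What is visible from a blind position in one slit scene belongs to the other one, and boundary
points of the one are boundary points of the other. This holds if the slits of both scenes are
steeper than `σ`. -/
theorem blind_transfer (h : IsSlitScene P δ β w s s' m) (h' : IsSlitScene P' δ β w t t' k)
    (hσ : σ < s') (hσ' : σ < t') (hσ2 : 2 ≤ σ * 4.9)
    {x z : Plane} (hx : Blind δ w σ x) (hxz : segment ℝ x z ⊆ P.region) :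
    z ∈ P'.region ∧ (z ∈ P.outer.boundary → z ∈ P'.outer.boundary) := by
  have hb := h.blind_segment hσ hσ2 hx hxz
  obtain ⟨hδ, hβ, hw, hw2, hs', hs's, hs, hm⟩ := h.params
  have ht' := h'.params
  obtain ⟨-, -, -, -, ht', ht't, ht1, hk⟩ := ht'
  rw [h.outer_eq, h'.outer_eq, h'.region_eq]
  have hz := (h.mem_region_iff z).1 (hxz (right_mem_segment _ _ _))
  have hz' : z ∈ slitIn δ β w t k := by
    have h1 := hz.1
    simp only [slitIn, Set.mem_ofPred_eq] at h1 ⊢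
    rcases le_or_gt 0 (z 0) with h0 | h0
    · left
      have := h.ht_mem (hxz (right_mem_segment _ _ _)) h0
      exact ⟨h0, this.2.2, this.1, this.2.1⟩
    · obtain ⟨h3, h4⟩ := hb h0
      right; left
      refine ⟨h3, h0.le, by nlinarith, ?_⟩
      rcases h1 with h1 | h1 | h1
      · linarith
      · exact h1.2.2.2
      · have : z 0 = -w := by linarith
        rw [this] at h1
        nlinarith
  refine ⟨⟨hz', hz.2⟩, fun ho => ⟨hz', ?_⟩⟩
  have ho := ho.2
  simp only [slitOut, Set.mem_ofPred_eq] at ho ⊢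
  rcases le_or_gt 0 (z 0) with h0 | h0
  · rcases ho with ho | ho | ho | ho | ho | ho
    · exact Or.inl ho
    · exact Or.inr (Or.inl ho)
    · linarith
    · exact Or.inr (Or.inr (Or.inr (Or.inl ho)))
    · have : z 0 = 0 := by linarith
      rw [this] at ho
      exact Or.inr (Or.inr (Or.inr (Or.inl ⟨h0, by linarith⟩)))
    · linarith
  · obtain ⟨h3, h4⟩ := hb h0
    rcases ho with ho | ho | ho | ho | ho | ho
    · exact Or.inl ho
    · exact Or.inr (Or.inl ho)
    · linarith
    · linarith
    · exfalso; nlinarith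
    · have : z 0 = -w := by linarith
      right; right; right; right; right
      rw [this] at h4 ⊢
      refine ⟨le_rfl, ?_⟩
      have : w * σ < w * t' := mul_lt_mul_of_pos_left hσ' hw
      linarith

/-- From a blind position two slit scenes look the same. -/
theorem coloredView_eq (h : IsSlitScene P δ β w s s' m) (h' : IsSlitScene P' δ β w t t' k)
    (hσ : σ < s') (hσ' : σ < t') (hσ2 : 2 ≤ σ * 4.9) {x : Plane} (hx : Blind δ w σ x) :
    coloredView P x = coloredView P' x := by
  have aux : ∀ {P P' : Scene} {s s' m t t' k : ℝ}, IsSlitScene P δ β w s s' m →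
      IsSlitScene P' δ β w t t' k → σ < s' → σ < t' → ∀ y, y ∈ P.view x →
        y ∈ P'.view x ∧ (y ∈ P.outer.boundary → y ∈ P'.outer.boundary) := by
    intro P P' s s' m t t' k h h' hσ hσ' y hy
    refine ⟨fun z hz => ?_, (h.blind_transfer h' hσ hσ' hσ2 hx hy).2⟩
    exact (h.blind_transfer h' hσ hσ' hσ2 hx ((segment_subset_of_mem_left hz).trans hy)).1
  have e1 : P.view x = P'.view x := by
    ext y
    exact ⟨fun hy => (aux h h' hσ hσ' y hy).1, fun hy => (aux h' h hσ' hσ y hy).1⟩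
  have e2 : P.view x ∩ P.outer.boundary = P'.view x ∩ P'.outer.boundary := by
    ext y
    exact ⟨fun hy => ⟨e1 ▸ hy.1, (aux h h' hσ hσ' y hy.1).2 hy.2⟩,
      fun hy => ⟨e1 ▸ hy.1, (aux h' h hσ' hσ y hy.1).2 hy.2⟩⟩
  simp only [coloredView]
  rw [e2, e1, h.hole_eq, h'.hole_eq]

end IsSlitScene

/-! ### Tours and lengths in slit scenes -/

theorem ofReal_le_eVariationOn_add {γ : ℝ≥0 → Plane} {a b c : ℝ≥0} {x y : ℝ} (hab : a ≤ b)
    (hbc : b ≤ c) (hx : ENNReal.ofReal x ≤ eVariationOn γ (Set.Icc a b))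
    (hy : ENNReal.ofReal y ≤ eVariationOn γ (Set.Icc b c)) :
    ENNReal.ofReal (x + y) ≤ eVariationOn γ (Set.Icc a c) := by
  rw [← eVariationOn_Icc_add_le_length γ hab hbc]
  exact ENNReal.ofReal_add_le.trans (add_le_add hx hy)

theorem ofReal_coord_le_eVariationOn {γ : ℝ≥0 → Plane} (hγ : Continuous γ) (i : Fin 2) {s t : ℝ≥0}
    (hst : s ≤ t) {x : ℝ} (hx : x ≤ |γ t i - γ s i|) :
    ENNReal.ofReal x ≤ eVariationOn γ (Set.Icc s t) :=
  (ENNReal.ofReal_le_ofReal hx).trans <|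
    abs_sub_le_eVariationOn (f := fun z => z i) (K := Set.univ) one_pos
      (fun p _ q _ _ => abs_coord_sub_le p q i) hγ hst (fun _ _ => trivial)

theorem ofReal_le_length {γ : ℝ≥0 → Plane} {a b : ℝ≥0} {x : ℝ}
    (hx : ENNReal.ofReal x ≤ eVariationOn γ (Set.Icc a b)) : ENNReal.ofReal x ≤ length γ :=
  hx.trans (eVariationOn.mono _ (Set.subset_univ _))

/-- The signed depth to which a point lies beside the hole: negative below, positive above it. -/
noncomputable def reach (δ : ℝ) (z : Plane) : ℝ :=
  if 5 ≤ z 0 then 0 else if ht δ z ≤ 2 then z 0 - 5 else 5 - z 0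

namespace IsSlitScene
variable {P P' : Scene} {δ β w s s' m t t' k σ : ℝ}

theorem reach_lipschitz (h : IsSlitScene P δ β w s s' m) {p q : Plane}
    (hp : p ∈ P.region) (hp' : 9 / 4 ≤ p 0) (hq : q ∈ P.region) (hq' : 9 / 4 ≤ q 0)
    (hpq : dist p q < δ / 12) : |reach δ p - reach δ q| ≤ dist p q := by
  have hδ := h.params.δ_pos
  have h0 := abs_coord_sub_le p q 0
  have h1 := (abs_coord_sub_le p q 1).trans_lt hpq
  have h2 : |ht δ p - ht δ q| < 1 / 12 := by
    rw [ht, ht, ← sub_div, abs_div, abs_of_pos hδ, div_lt_iff₀ hδ]; linarith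
  rw [abs_le] at h0 ⊢
  rw [abs_lt] at h2
  have up : ∀ z ∈ P.region, 9 / 4 ≤ z 0 → ¬ 5 ≤ z 0 → ¬ ht δ z ≤ 2 → 2 + 1 / 12 ≤ ht δ z := by
    intro z hz h1 h2 h3
    have := h.upper_of_lt hz (not_le.1 h3) (not_le.1 h2)
    linarith
  have up1 := up p hp hp'
  have up2 := up q hq hq'
  unfold reach
  split_ifs with a b c d e <;>
    first
    | (constructor <;> linarith)
    | (have := up1 ‹_› ‹_›; constructor <;> linarith)
    | (have := up2 ‹_› ‹_›; constructor <;> linarith)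

theorem reach_le_eVariationOn (h : IsSlitScene P δ β w s s' m) {γ : ℝ≥0 → Plane}
    (hγ : Continuous γ) {a b : ℝ≥0} (hab : a ≤ b) (hr : ∀ u, γ u ∈ P.region)
    (hK : ∀ u ∈ Set.Icc a b, 9 / 4 ≤ γ u 0) {x : ℝ} (hx : x ≤ |reach δ (γ b) - reach δ (γ a)|) :
    ENNReal.ofReal x ≤ eVariationOn γ (Set.Icc a b) :=
  (ENNReal.ofReal_le_ofReal hx).trans <|
    abs_sub_le_eVariationOn (K := {z | z ∈ P.region ∧ 9 / 4 ≤ z 0}) (r := δ / 12)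
      (by have := h.params.δ_pos; positivity)
      (fun _ hp _ hq hpq => h.reach_lipschitz hp.1 hp.2 hq.1 hq.2 hpq) hγ hab
      (fun u hu => ⟨hr u, hK u hu⟩)

theorem lower_segment (h : IsSlitScene P δ β w s s' m) {p q : Plane}
    (hp : 0 ≤ p 0 ∧ p 0 ≤ 5 + β ∧ 0 ≤ ht δ p ∧ ht δ p ≤ 2)
    (hq : 0 ≤ q 0 ∧ q 0 ≤ 5 + β ∧ 0 ≤ ht δ q ∧ ht δ q ≤ 2) : segment ℝ p q ⊆ P.region := by
  intro z hz
  have H := halfplane_segment h.params.δ_pos hz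
  rw [h.mem_region_iff]
  have h1 := H (-1) 0 0 (by linarith) (by linarith)
  have h2 := H 1 0 (5 + β) (by linarith) (by linarith)
  have h3 := H 0 (-1) 0 (by linarith) (by linarith)
  have h4 := H 0 1 2 (by linarith) (by linarith)
  exact ⟨Or.inl ⟨by linarith, by linarith, by linarith, by linarith⟩, Or.inl (by linarith)⟩

theorem room_segment (h : IsSlitScene P δ β w s s' m) {p q : Plane}
    (hp : 5 ≤ p 0 ∧ p 0 ≤ 5 + β ∧ 0 ≤ ht δ p ∧ ht δ p ≤ 4)
    (hq : 5 ≤ q 0 ∧ q 0 ≤ 5 + β ∧ 0 ≤ ht δ q ∧ ht δ q ≤ 4) : segment ℝ p q ⊆ P.region := by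
  intro z hz
  have H := halfplane_segment h.params.δ_pos hz
  rw [h.mem_region_iff]
  have h1 := H (-1) 0 (-5) (by linarith) (by linarith)
  have h2 := H 1 0 (5 + β) (by linarith) (by linarith)
  have h3 := H 0 (-1) 0 (by linarith) (by linarith)
  have h4 := H 0 1 4 (by linarith) (by linarith)
  exact ⟨Or.inl ⟨by linarith, by linarith, by linarith, by linarith⟩,
    Or.inr (Or.inr (by linarith))⟩

theorem wide_segment (h : IsSlitScene P δ β w s s' m) {p q : Plane}
    (hp : -w ≤ p 0 ∧ p 0 ≤ 5 ∧ s * p 0 ≤ ht δ p ∧ ht δ p ≤ 4)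
    (hq : -w ≤ q 0 ∧ q 0 ≤ 5 ∧ s * q 0 ≤ ht δ q ∧ ht δ q ≤ 4) :
    segment ℝ p q ⊆ slitIn δ β w s m := by
  obtain ⟨hδ, hβ, hw, hw2, hs', hs's, hs, hm⟩ := h.params
  intro z hz
  have H := halfplane_segment hδ hz
  have h1 := H (-1) 0 w (by linarith) (by linarith)
  have h2 := H 1 0 5 (by linarith) (by linarith)
  have h3 := H s (-1) 0 (by linarith) (by linarith)
  have h4 := H 0 1 4 (by linarith) (by linarith)
  rcases le_total 0 (z 0) with h0 | h0
  · exact Or.inl ⟨h0, by linarith, by nlinarith, by linarith⟩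
  · exact Or.inr (Or.inl ⟨by linarith, h0, by linarith, by linarith⟩)

theorem narrow_segment (h : IsSlitScene P δ β w s s' m) {p q : Plane}
    (hp : -1 ≤ p 0 ∧ p 0 ≤ 5 ∧ s * p 0 ≤ ht δ p ∧ ht δ p ≤ 4 ∧ ht δ p ≤ -s + m * (p 0 + 1))
    (hq : -1 ≤ q 0 ∧ q 0 ≤ 5 ∧ s * q 0 ≤ ht δ q ∧ ht δ q ≤ 4 ∧ ht δ q ≤ -s + m * (q 0 + 1)) :
    segment ℝ p q ⊆ slitIn δ β w s m := by
  obtain ⟨hδ, hβ, hw, hw2, hs', hs's, hs, hm⟩ := h.params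
  intro z hz
  have H := halfplane_segment hδ hz
  have h1 := H (-1) 0 1 (by linarith) (by linarith)
  have h2 := H 1 0 5 (by linarith) (by linarith)
  have h3 := H s (-1) 0 (by linarith) (by linarith)
  have h4 := H 0 1 4 (by linarith) (by linarith)
  have h5 := H (-m) 1 (m - s) (by linarith) (by linarith)
  rcases le_total 0 (z 0) with h0 | h0
  · exact Or.inl ⟨h0, by linarith, by nlinarith, by linarith⟩
  · rcases le_total (-w) (z 0) with h0' | h0'
    · exact Or.inr (Or.inl ⟨by linarith, h0, by linarith, by linarith⟩)
    · exact Or.inr (Or.inr ⟨by linarith, h0', by linarith, by linarith⟩)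

theorem upper_segment (h : IsSlitScene P δ β w s s' m) {p q : Plane}
    (hp : -w ≤ p 0 ∧ p 0 ≤ 5 ∧ 2 + (p 0 - 2) / 3 ≤ ht δ p ∧ ht δ p ≤ 4)
    (hq : -w ≤ q 0 ∧ q 0 ≤ 5 ∧ 2 + (q 0 - 2) / 3 ≤ ht δ q ∧ ht δ q ≤ 4) :
    segment ℝ p q ⊆ P.region := by
  obtain ⟨hδ, hβ, hw, hw2, hs', hs's, hs, hm⟩ := h.params
  intro z hz
  have H := halfplane_segment hδ hz
  rw [h.mem_region_iff]
  have h1 := H (-1) 0 w (by linarith) (by linarith)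
  have h2 := H 1 0 5 (by linarith) (by linarith)
  have h3 := H (1 / 3) (-1) (2 / 3 - 2) (by linarith) (by linarith)
  have h4 := H 0 1 4 (by linarith) (by linarith)
  refine ⟨?_, Or.inr (Or.inl (by linarith))⟩
  rcases le_total 0 (z 0) with h0 | h0
  · exact Or.inl ⟨h0, by linarith, by linarith, by linarith⟩
  · exact Or.inr (Or.inl ⟨by linarith, h0, by nlinarith, by linarith⟩)

/-- A vantage point `c` in the wedge of the slit, together with the two corners of the hole next to
the start, sees everything. -/
theorem exists_sees (h : IsSlitScene P δ β w s s' m) {c : Plane}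
    (hc : 0 ≤ c 0 ∧ c 0 ≤ 5 ∧ s * c 0 ≤ ht δ c ∧ ht δ c ≤ 4 ∧ ht δ c ≤ -s + m * (c 0 + 1))
    (hside : ht δ c ≤ 2 ∨ s = 1) {y : Plane} (hy : y ∈ P.region) :
    ∃ x ∈ ({sq δ 5 3, sq δ 5 2, c} : Set Plane), segment ℝ x y ⊆ P.region := by
  have hpar := h.params
  obtain ⟨hδ, hβ, hw, hw2, hs', hs's, hs, hm⟩ := hpar
  have hm1 : m * (1 - w) ≤ 1 := by rw [hm]; nlinarith
  obtain ⟨hy1, hy2⟩ := (h.mem_region_iff y).1 hy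
  have both : segment ℝ c y ⊆ slitIn δ β w s m → (ht δ y ≤ 2 ∨ s = 1) → s * y 0 ≤ ht δ y →
      segment ℝ c y ⊆ P.region := by
    intro h1 h2 h3 z hz
    rw [h.mem_region_iff]
    refine ⟨h1 hz, ?_⟩
    have H := halfplane_segment hδ hz
    by_cases hs1 : s = 1
    · subst hs1
      have := H 1 (-1) 0 (by linarith) (by linarith)
      rcases le_total (ht δ z) 2 with h4 | h4
      · exact Or.inl h4
      · refine Or.inr (Or.inl ?_)
        rcases le_total (z 0) 2 with h5 | h5 <;> linarith
    · have := H 0 1 2 (by linarith [hside.resolve_right hs1]) (by linarith [h2.resolve_right hs1])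
      exact Or.inl (by linarith)
  rcases le_or_gt 0 (y 0) with h0 | h0
  · have hb := h.ht_mem hy h0
    rcases le_or_gt 5 (y 0) with h5 | h5
    · refine ⟨sq δ 5 2, by simp, h.room_segment ?_ ⟨h5, hb.2.2, hb.1, hb.2.1⟩⟩
      simp only [sq_zero, ht_sq hδ]
      refine ⟨?_, ?_, ?_, ?_⟩ <;> linarith
    · rcases le_or_gt (ht δ y) 2 with h2 | h2
      · refine ⟨sq δ 5 2, by simp, h.lower_segment ?_ ⟨h0, hb.2.2, hb.1, h2⟩⟩
        simp only [sq_zero, ht_sq hδ]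
        refine ⟨?_, ?_, ?_, ?_⟩ <;> linarith
      · refine ⟨sq δ 5 3, by simp, h.upper_segment ?_
          ⟨by linarith, h5.le, h.upper_of_lt hy h2 h5, hb.2.1⟩⟩
        simp only [sq_zero, ht_sq hδ]
        refine ⟨?_, ?_, ?_, ?_⟩ <;> linarith
  · rcases le_or_gt (-w) (y 0) with hyw | hyw
    · have hyb : s * y 0 ≤ ht δ y ∧ ht δ y ≤ 4 := by
        rcases hy1 with h1 | h1 | h1
        · linarith
        · exact ⟨h1.2.2.1, h1.2.2.2⟩
        · have : y 0 = -w := by linarith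
          refine ⟨h1.2.2.1, ?_⟩
          rw [this] at h1; linarith
      rcases le_or_gt (ht δ y) 2 with h2 | h2
      · exact ⟨c, by simp, both (h.wide_segment ⟨by linarith, hc.2.1, hc.2.2.1, hc.2.2.2.1⟩
          ⟨hyw, by linarith, hyb.1, hyb.2⟩) (Or.inl h2) hyb.1⟩
      · refine ⟨sq δ 5 3, by simp, h.upper_segment ?_ ⟨hyw, by linarith, by linarith, hyb.2⟩⟩
        simp only [sq_zero, ht_sq hδ]
        refine ⟨?_, ?_, ?_, ?_⟩ <;> linarith
    · rcases hy1 with h1 | h1 | h1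
      · linarith
      · linarith
      · have : m * (y 0 + 1) ≤ m * (1 - w) := by
          have := h.params.s_lt_m
          exact mul_le_mul_of_nonneg_left (by linarith) (by linarith)
        exact ⟨c, by simp, both (h.narrow_segment
          ⟨by linarith, hc.2.1, hc.2.2.1, hc.2.2.2.1, hc.2.2.2.2⟩
          ⟨h1.1, by linarith, h1.2.2.1, by linarith, h1.2.2.2⟩) (Or.inl (by linarith)) h1.2.2.1⟩

theorem opt_le_flat (h : IsSlitScene P δ β w s s' m) {x : ℝ} (hx0 : 0 ≤ x) (hx : x ≤ 3)
    (hsx : s * (5 - x) = 2) : P.opt ≤ ENNReal.ofReal (2 * x + 2 * β + 4 * δ) := by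
  have hsm := h.params.s_lt_m
  obtain ⟨hδ, hβ, hw, hw2, hs', hs's, hs, hm⟩ := h.params
  have hv := fun u v => ht_sq hδ u v
  have d1 := dist_sq_le hδ (5 + β) 2 5 3
  have d2 := dist_sq_le hδ 5 3 5 2
  have d3 := dist_sq_le hδ 5 2 (5 - x) 2
  have d4 := dist_sq_le hδ (5 - x) 2 5 2
  have d5 := dist_sq_le hδ 5 2 (5 + β) 2
  rw [show 5 + β - 5 = β by ring, abs_of_pos hβ] at d1
  rw [show 5 - (5 + β) = -β by ring, abs_neg, abs_of_pos hβ] at d5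
  rw [show 5 - (5 - x) = x by ring, abs_of_nonneg hx0] at d3
  rw [show 5 - x - 5 = -x by ring, abs_neg, abs_of_nonneg hx0] at d4
  norm_num at d1 d2 d3 d4 d5
  have w1 : Walk P.region _ _ _ _ := Walk.step (h.room_segment (p := sq δ (5 + β) 2)
    (q := sq δ 5 3) (by simp only [sq_zero, hv]; refine ⟨?_, ?_, ?_, ?_⟩ <;> linarith)
    (by simp only [sq_zero, hv]; refine ⟨?_, ?_, ?_, ?_⟩ <;> linarith))
  have w2 : Walk P.region _ _ _ _ := Walk.step (h.room_segment (p := sq δ 5 3)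
    (q := sq δ 5 2) (by simp only [sq_zero, hv]; refine ⟨?_, ?_, ?_, ?_⟩ <;> linarith)
    (by simp only [sq_zero, hv]; refine ⟨?_, ?_, ?_, ?_⟩ <;> linarith))
  have w3 : Walk P.region _ _ _ _ := Walk.step (h.lower_segment (p := sq δ 5 2)
    (q := sq δ (5 - x) 2) (by simp only [sq_zero, hv]; refine ⟨?_, ?_, ?_, ?_⟩ <;> linarith)
    (by simp only [sq_zero, hv]; refine ⟨?_, ?_, ?_, ?_⟩ <;> linarith))
  have w4 : Walk P.region _ _ _ _ := Walk.step (h.lower_segment (p := sq δ (5 - x) 2)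
    (q := sq δ 5 2) (by simp only [sq_zero, hv]; refine ⟨?_, ?_, ?_, ?_⟩ <;> linarith)
    (by simp only [sq_zero, hv]; refine ⟨?_, ?_, ?_, ?_⟩ <;> linarith))
  have w5 : Walk P.region _ _ _ _ := Walk.step (h.lower_segment (p := sq δ 5 2)
    (q := sq δ (5 + β) 2) (by simp only [sq_zero, hv]; refine ⟨?_, ?_, ?_, ?_⟩ <;> linarith)
    (by simp only [sq_zero, hv]; refine ⟨?_, ?_, ?_, ?_⟩ <;> linarith))
  have W := (((w1.append w2 dist_nonneg dist_nonneg).append w3 (by positivity)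
    dist_nonneg).append w4 (by positivity) dist_nonneg).append w5 (by positivity) dist_nonneg
  rw [← h.start_eq] at W
  refine P.opt_le (W.mono ?_ le_rfl) fun y hy => ?_
  · rw [h.start_eq]; linarith
  · obtain ⟨z, hz, hzy⟩ := h.exists_sees (c := sq δ (5 - x) 2) (by
      simp only [sq_zero, hv]
      refine ⟨by linarith, by linarith, hsx.le, by norm_num, ?_⟩
      nlinarith) (by simp [hv]) hy
    refine ⟨z, ?_, hzy⟩
    rcases hz with rfl | rfl | rfl
    · exact Or.inl (Or.inl (Or.inl (Or.inl (right_mem_segment _ _ _))))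
    · exact Or.inl (Or.inl (Or.inl (Or.inr (right_mem_segment _ _ _))))
    · exact Or.inl (Or.inl (Or.inr (right_mem_segment _ _ _)))

theorem opt_le_steep (h : IsSlitScene P δ β w 1 s' m) :
    P.opt ≤ ENNReal.ofReal (2 + 2 * β + 4 * δ) := by
  have hsm := h.params.s_lt_m
  obtain ⟨hδ, hβ, hw, hw2, hs', hs's, hs, hm⟩ := h.params
  have hv := fun u v => ht_sq hδ u v
  have d1 := dist_sq_le hδ (5 + β) 2 5 2
  have d2 := dist_sq_le hδ 5 2 5 3
  have d3 := dist_sq_le hδ 5 3 4 4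
  have d4 := dist_sq_le hδ 4 4 5 3
  have d5 := dist_sq_le hδ 5 3 (5 + β) 2
  rw [show 5 + β - 5 = β by ring, abs_of_pos hβ] at d1
  rw [show 5 - (5 + β) = -β by ring, abs_neg, abs_of_pos hβ] at d5
  norm_num at d1 d2 d3 d4 d5
  have w1 : Walk P.region _ _ _ _ := Walk.step (h.room_segment (p := sq δ (5 + β) 2)
    (q := sq δ 5 2) (by simp only [sq_zero, hv]; refine ⟨?_, ?_, ?_, ?_⟩ <;> linarith)
    (by simp only [sq_zero, hv]; refine ⟨?_, ?_, ?_, ?_⟩ <;> linarith))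
  have w2 : Walk P.region _ _ _ _ := Walk.step (h.room_segment (p := sq δ 5 2)
    (q := sq δ 5 3) (by simp only [sq_zero, hv]; refine ⟨?_, ?_, ?_, ?_⟩ <;> linarith)
    (by simp only [sq_zero, hv]; refine ⟨?_, ?_, ?_, ?_⟩ <;> linarith))
  have w3 : Walk P.region _ _ _ _ := Walk.step (h.upper_segment (p := sq δ 5 3)
    (q := sq δ 4 4) (by simp only [sq_zero, hv]; refine ⟨?_, ?_, ?_, ?_⟩ <;> linarith)
    (by simp only [sq_zero, hv]; refine ⟨?_, ?_, ?_, ?_⟩ <;> linarith))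
  have w4 : Walk P.region _ _ _ _ := Walk.step (h.upper_segment (p := sq δ 4 4)
    (q := sq δ 5 3) (by simp only [sq_zero, hv]; refine ⟨?_, ?_, ?_, ?_⟩ <;> linarith)
    (by simp only [sq_zero, hv]; refine ⟨?_, ?_, ?_, ?_⟩ <;> linarith))
  have w5 : Walk P.region _ _ _ _ := Walk.step (h.room_segment (p := sq δ 5 3)
    (q := sq δ (5 + β) 2) (by simp only [sq_zero, hv]; refine ⟨?_, ?_, ?_, ?_⟩ <;> linarith)
    (by simp only [sq_zero, hv]; refine ⟨?_, ?_, ?_, ?_⟩ <;> linarith))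
  have W := (((w1.append w2 dist_nonneg dist_nonneg).append w3 (by positivity)
    dist_nonneg).append w4 (by positivity) dist_nonneg).append w5 (by positivity) dist_nonneg
  rw [← h.start_eq] at W
  refine P.opt_le (W.mono ?_ le_rfl) fun y hy => ?_
  · rw [h.start_eq]; linarith
  · obtain ⟨z, hz, hzy⟩ := h.exists_sees (c := sq δ 4 4) (by
      simp only [sq_zero, hv]
      refine ⟨by linarith, by linarith, by norm_num, by norm_num, ?_⟩
      linarith) (Or.inr rfl) hy
    refine ⟨z, ?_, hzy⟩
    rcases hz with rfl | rfl | rfl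
    · exact Or.inl (Or.inl (Or.inl (Or.inr (right_mem_segment _ _ _))))
    · exact Or.inl (Or.inl (Or.inl (Or.inl (right_mem_segment _ _ _))))
    · exact Or.inl (Or.inl (Or.inr (right_mem_segment _ _ _)))

theorem opt_pos (h : IsSlitScene P δ β w s s' m)
    (hsees : ∀ x : Plane, segment ℝ x (sq δ (-1) (-s)) ⊆ P.region → x 0 ≤ 4.9) : 0 < P.opt := by
  refine lt_of_lt_of_le (b := ENNReal.ofReal 0.1) (by simp; norm_num) ?_
  refine le_iInf₂ fun γ hγ => ?_
  obtain ⟨t, ht⟩ := hγ.sees _ h.tip_mem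
  have h1 := hsees _ ht
  refine ofReal_le_length (b := t) (ofReal_coord_le_eVariationOn hγ.continuous 0 zero_le ?_)
  rw [hγ.start, h.start_eq, sq_zero, abs_sub_comm]
  have := h.params.β_pos
  exact le_trans (by linarith) (le_abs_self _)

end IsSlitScene

/-! ### The lower bound with the golden ratio -/

/-- Lower bounds for the competitive ratio from bounds `a` for computed and `b` for shortest tours
whose quotients come arbitrarily close to `c`. -/
theorem OnlineStrategy.ofReal_le_competitiveRatio {O : Type} {observe : Scene → Plane → O}
    {K : Set Scene} (S : OnlineStrategy observe K) {c : ℝ}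
    (h : ∀ η > 0, ∃ P ∈ K, 0 < P.opt ∧ ∃ a b : ℝ, 0 < b ∧ ENNReal.ofReal a ≤ length (S.path P) ∧
      P.opt ≤ ENNReal.ofReal b ∧ (c - η) * b ≤ a) :
    ENNReal.ofReal c ≤ S.competitiveRatio := by
  by_cases htop : S.competitiveRatio = ⊤
  · rw [htop]; exact le_top
  rw [ENNReal.ofReal_le_iff_le_toReal htop]
  refine le_of_forall_pos_le_add fun η hη => ?_
  obtain ⟨P, hP, hpos, a, b, hb, ha, hopt, hab⟩ := h η hη
  rw [← sub_le_iff_le_add, ← ENNReal.ofReal_le_iff_le_toReal htop]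
  refine le_trans ?_ (le_iSup₂_of_le P hP (le_iSup_of_le hpos le_rfl))
  rw [ENNReal.le_div_iff_mul_le (Or.inl hpos.ne')
    (Or.inl (ne_top_of_le_ne_top ENNReal.ofReal_ne_top hopt))]
  calc ENNReal.ofReal (c - η) * P.opt ≤ ENNReal.ofReal (c - η) * ENNReal.ofReal b := by gcongr
    _ = ENNReal.ofReal ((c - η) * b) := (ENNReal.ofReal_mul' hb.le).symm
    _ ≤ ENNReal.ofReal a := ENNReal.ofReal_le_ofReal hab
    _ ≤ _ := ha

theorem slitParams_of {ε s s' : ℝ} (h0 : 0 < ε) (h1 : ε < 1 / 2) (hs' : 0 < s') (hss : s' < s)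
    (hs : s ≤ 1) : SlitParams ε ε ε s s' ((s - ε * s') / (1 - ε)) :=
  ⟨h0, h0, h0, h1, hs', hss, hs, by
    have : 1 - ε ≠ 0 := by linarith
    field_simp⟩

/-- The first time at which the trajectory in the steep scene is above the hole at an abscissa of at
most `4 + ε`, or has the abscissa `9 / 4` on either side of the hole. Before the abscissa `9 / 4` is
reached, the trajectory cannot change from one side of the hole to the other at its left end, the
abscissa `2`. -/
theorem exists_first_up {P : Scene} {ε s' m : ℝ} (hε1 : ε < 1 / 4)
    (h : IsSlitScene P ε ε ε 1 s' m) {γ : ℝ≥0 → Plane} (hγ : P.IsWatchmanTour γ) :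
    ∃ T, 9 / 4 ≤ γ T 0 ∧ (γ T 0 = 9 / 4 ∨ (2 < ht ε (γ T) ∧ γ T 0 ≤ 4 + ε)) ∧
      ∀ t < T, 9 / 4 < γ t 0 ∧ (ht ε (γ t) ≤ 2 ∨ 4 + ε < γ t 0) := by
  obtain ⟨hδ, -⟩ := h.params
  set U : Set Plane := {z | z 0 ≤ 9 / 4 ∨ (2 + (z 0 - 2) / 3 ≤ ht ε z ∧ z 0 ≤ 4 + ε)} with hU
  have hUc : IsClosed U := by
    have c0 : Continuous fun z : Plane => z 0 := by fun_prop
    have c1 := continuous_ht ε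
    have c2 : Continuous fun z : Plane => 2 + (z 0 - 2) / 3 := by fun_prop
    exact isClosed_or (isClosed_le c0 continuous_const)
      ((isClosed_le c2 c1).and (isClosed_le c0 continuous_const))
  have hne : (γ ⁻¹' U).Nonempty := by
    obtain ⟨t, ht'⟩ := hγ.sees _ h.tip_mem
    refine ⟨t, ?_⟩
    have := h.sees_tip_steep ht'
    by_cases h2 : γ t 0 ≤ 9 / 4
    · exact Or.inl h2
    · rcases this with h3 | ⟨h3, h4⟩
      · exact absurd (h3.trans (by norm_num)) h2
      · exact Or.inr ⟨h.upper_of_lt (hγ.mem_region t) h3 (by linarith), by linarith⟩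
  have hcl : IsClosed (γ ⁻¹' U) := hUc.preimage hγ.continuous
  have hmem := hcl.csInf_mem hne (OrderBot.bddBelow _)
  set T := sInf (γ ⁻¹' U) with hT
  have hbefore : ∀ t < T, γ t ∉ U := fun t ht hm =>
    (csInf_le (OrderBot.bddBelow _) (show t ∈ γ ⁻¹' U from hm)).not_gt ht
  have hb' : ∀ t < T, 9 / 4 < γ t 0 ∧ (ht ε (γ t) ≤ 2 ∨ 4 + ε < γ t 0) := by
    intro t htT
    have := hbefore t htT
    simp only [hU, Set.mem_ofPred_eq, not_or, not_and_or, not_le] at this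
    refine ⟨this.1, ?_⟩
    by_contra hcon
    push Not at hcon
    rcases this.2 with h1 | h1
    · have := h.upper_of_lt (hγ.mem_region t) hcon.1 (by linarith)
      linarith
    · linarith
  have h94 : 9 / 4 ≤ γ T 0 := by
    by_contra hlt
    have hc : ContinuousOn (fun t => γ t 0) (Set.Icc 0 T) :=
      (Continuous.continuousOn (by have := hγ.continuous; fun_prop))
    have := intermediate_value_Icc' (zero_le : 0 ≤ T) hc
    have hstart : γ 0 0 = 5 + ε := by rw [hγ.start, h.start_eq, sq_zero]
    obtain ⟨u, hu, hue⟩ := this (show (9 / 4 : ℝ) ∈ _ from ⟨by linarith, by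
      simp only [hstart]; linarith⟩)
    simp only [] at hue
    rcases hu.2.lt_or_eq with h1 | h1
    · have := (hb' u h1).1
      linarith
    · rw [h1] at hue; linarith
  refine ⟨T, h94, ?_, hb'⟩
  have hm : γ T ∈ U := hmem
  simp only [hU, Set.mem_ofPred_eq] at hm
  rcases hm with hm | hm
  · exact Or.inl (by linarith)
  · exact Or.inr ⟨by linarith, hm.2⟩

set_option maxHeartbeats 1000000 in
/-- The adversary runs the strategy in the steep scene up to the first time at which it is deep on
the upper side. It keeps the steep scene if the strategy has been at depth `φ` on the lower side by
then, and otherwise takes a flat scene whose slit becomes visible just beyond the part of the lower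
side that the strategy has visited. -/
theorem colored_game (S : OnlineStrategy coloredView Set.univ) {φ ε : ℝ} (hφ : φ ^ 2 = φ + 1)
    (hφ1 : 1.618 < φ) (hφ2 : φ < 1.6181) (hε : 0 < ε) (hε1 : ε < 1 / 1000) :
    ∃ P : Scene, 0 < P.opt ∧ ∃ a b : ℝ, 0 < b ∧ ENNReal.ofReal a ≤ length (S.path P) ∧
      P.opt ≤ ENNReal.ofReal b ∧ (φ + 1 - 40 * ε) * b ≤ a := by
  obtain ⟨P, hP⟩ := (slitParams_of (s := 1) (s' := 2 / 2.1) hε (by linarith) (by norm_num)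
    (by norm_num) le_rfl).exists_isSlitScene
  have hγ := S.tour P trivial
  set γ := S.path P with hγdef
  obtain ⟨T, hT, hT', hbefore⟩ := exists_first_up (by linarith) hP hγ
  have hcont := hγ.continuous
  have hreg := hγ.mem_region
  have hstart : γ 0 0 = 5 + ε := by rw [hγ.start, hP.start_eq, sq_zero]
  have hstart' : reach ε (γ 0) = 0 := by
    unfold reach; rw [if_pos (by rw [hstart]; linarith)]
  have hle : ∀ t ≤ T, 9 / 4 ≤ γ t 0 := by
    intro t ht
    rcases ht.lt_or_eq with h | rfl
    · exact (hbefore t h).1.le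
    · exact hT
  have reach_low : ∀ z : Plane, z 0 ≤ 5 → ht ε z ≤ 2 → reach ε z = z 0 - 5 := by
    intro z h1 h2
    unfold reach
    split_ifs <;> linarith
  have reach_up : ∀ z : Plane, z 0 < 5 → 2 < ht ε z → reach ε z = 5 - z 0 := by
    intro z h1 h2
    unfold reach
    split_ifs <;> linarith
  by_cases hA : ∃ t ≤ T, ht ε (γ t) ≤ 2 ∧ γ t 0 ≤ 5 - φ + ε
  · -- the strategy looks far into the lower side: it stays in the steep scene
    obtain ⟨t1, ht1, hl1, hl2⟩ := hA
    refine ⟨P, hP.opt_pos fun x hx => ?_, 2 * φ + 2 - 4 * ε, 2 + 2 * ε + 4 * ε, by linarith, ?_,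
      hP.opt_le_steep, ?_⟩
    · rcases hP.sees_tip_steep hx with h | h <;> linarith
    · obtain ⟨E, hE⟩ := hγ.returns
      have hTE : T ≤ max T E := le_max_left _ _
      have hEe : γ (max T E) 0 = 5 + ε := by
        rw [hE _ (le_max_right _ _), hP.start_eq, sq_zero]
      have last := fun {x : ℝ} => ofReal_coord_le_eVariationOn (x := x) hcont 0 hTE
      have r1 := reach_low _ (by linarith) hl1
      have first : ENNReal.ofReal (φ - ε) ≤ eVariationOn γ (Set.Icc 0 t1) := by
        refine hP.reach_le_eVariationOn hcont zero_le hreg (fun u hu => hle u (hu.2.trans ht1)) ?_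
        rw [hstart', r1, sub_zero]
        exact le_trans (by linarith) (neg_le_abs _)
      by_cases hup : 2 < ht ε (γ T)
      · have hT4 : γ T 0 ≤ 4 + ε := by
          rcases hT' with h | h
          · rw [h]; linarith
          · exact h.2
        have r2 := reach_up _ (by linarith) hup
        have second : ENNReal.ofReal (φ - ε + (1 - ε)) ≤ eVariationOn γ (Set.Icc t1 T) := by
          refine hP.reach_le_eVariationOn hcont ht1 hreg (fun u hu => hle u hu.2) ?_
          rw [r1, r2]
          exact le_trans (by linarith) (le_abs_self _)
        have third := last (x := 1 - ε) (by
          rw [hEe]; exact le_trans (by linarith) (le_abs_self _))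
        have all := ofReal_le_eVariationOn_add zero_le hTE
          (ofReal_le_eVariationOn_add zero_le ht1 first second) third
        exact (ENNReal.ofReal_le_ofReal (by linarith)).trans (ofReal_le_length all)
      · have hT4 : γ T 0 = 9 / 4 := by
          rcases hT' with h | h
          · exact h
          · exact absurd h.1 hup
        have second := ofReal_coord_le_eVariationOn (x := 11 / 4) hcont 0
            (zero_le : 0 ≤ T) (by
          rw [hstart, hT4, abs_sub_comm]; exact le_trans (by linarith) (le_abs_self _))
        have third := last (x := 11 / 4) (by
          rw [hEe, hT4]; exact le_trans (by linarith) (le_abs_self _))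
        have all := ofReal_le_eVariationOn_add zero_le hTE second third
        exact (ENNReal.ofReal_le_ofReal (by linarith)).trans (ofReal_le_length all)
    · nlinarith
  · push Not at hA
    -- the supremum `ξ` of the depths to which the lower side has been entered
    set A : Set ℝ := {x | x = 0 ∨ ∃ t ≤ T, ht ε (γ t) ≤ 2 ∧ x = 5 - γ t 0} with hAdef
    have hAbdd : ∀ x ∈ A, x ≤ φ - ε := by
      rintro x (rfl | ⟨t, ht1, ht2, rfl⟩)
      · linarith
      · have := hA t ht1 ht2; linarith
    have hAne : A.Nonempty := ⟨0, Or.inl rfl⟩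
    set ξ := sSup A with hξ
    have hξle : ξ ≤ φ - ε := csSup_le hAne hAbdd
    have hξ0 : 0 ≤ ξ := le_csSup ⟨_, hAbdd⟩ (Or.inl rfl)
    have hξt : ∀ t ≤ T, ht ε (γ t) ≤ 2 → 5 - ξ ≤ γ t 0 := by
      intro t h1 h2
      have : 5 - γ t 0 ≤ ξ := le_csSup ⟨_, hAbdd⟩ (Or.inr ⟨t, h1, h2, rfl⟩)
      linarith
    obtain ⟨t1, ht1, hr1⟩ : ∃ t1 ≤ T, reach ε (γ t1) ≤ -(ξ - ε) := by
      obtain ⟨x, hx, hxl⟩ := exists_lt_of_lt_csSup hAne (show ξ - ε < ξ by linarith)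
      rcases hx with rfl | ⟨t, h1, h2, rfl⟩
      · exact ⟨0, zero_le, by rw [hstart']; linarith⟩
      · refine ⟨t, h1, ?_⟩
        rcases le_or_gt (γ t 0) 5 with h5 | h5
        · rw [reach_low _ h5 h2]; linarith
        · unfold reach; rw [if_pos h5.le]; linarith
    -- the flat slit becomes visible at depth `M + ε`; its slope is bounded below by the choice of
    -- at least `φ - 1`, for which the bound `1 + ξ` is at least `φ * M` even if `ξ = 0`
    set M := max ξ (φ - 1) with hM
    have hM1 : ξ ≤ M := le_max_left _ _
    have hM2 : φ - 1 ≤ M := le_max_right _ _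
    have hM3 : M ≤ φ := max_le (by linarith) (by linarith)
    have hM4 : φ * M ≤ 1 + ξ := by
      rcases max_choice ξ (φ - 1) with h | h
      · rw [hM, h]; nlinarith
      · rw [hM, h]; nlinarith
    have hq : 0 < 5 - M := by linarith
    have hq1 : 0 < 5 - M - ε / 2 := by linarith
    have hq2 : 0 < 5 - M - ε := by linarith
    set σ := 2 / (5 - M) with hσ
    set s' := 2 / (5 - M - ε / 2) with hs'
    set s := 2 / (5 - M - ε) with hs
    have eσ : σ * (5 - M) = 2 := by rw [hσ]; field_simp
    have es : s * (5 - M - ε) = 2 := by rw [hs]; field_simp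
    have hσs' : σ < s' := by exact div_lt_div_of_pos_left two_pos hq1 (by linarith)
    have hs's : s' < s := by exact div_lt_div_of_pos_left two_pos hq2 (by linarith)
    have hσ0 : 0 < σ := by positivity
    have hs1 : 0.42 ≤ s := by rw [hs, le_div_iff₀ hq2]; linarith
    have hs2 : s ≤ 0.598 := by rw [hs, div_le_iff₀ hq2]; linarith
    have hσ2 : σ < 2 / 2.1 := by linarith
    have hσ3 : 2 ≤ σ * 4.9 := by nlinarith
    obtain ⟨P', hP'⟩ := (slitParams_of (s := s) (s' := s') hε (by linarith) (by linarith)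
      hs's (by linarith)).exists_isSlitScene
    have hm : (s - ε * s') / (1 - ε) ≤ s + 0.005 := by
      rw [div_le_iff₀ (by linarith)]
      nlinarith
    set m := (s - ε * s') / (1 - ε)
    have hagree : ∀ τ ≤ T, S.path P' τ = γ τ := by
      refine S.online P trivial P' trivial (by rw [hP.start_eq, hP'.start_eq]) T fun τ hτ => ?_
      refine hP.coloredView_eq hP' hσ2 hσs' hσ3 ?_
      rcases (hbefore τ hτ).2 with h | h
      · right; left
        refine ⟨h, ?_⟩
        have := hξt τ hτ.le h
        rw [← eσ]
        exact mul_le_mul_of_nonneg_left (by linarith) hσ0.le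
      · by_cases h2 : ht ε (γ τ) ≤ 2
        · right; left
          refine ⟨h2, ?_⟩
          have := hξt τ hτ.le h2
          rw [← eσ]
          exact mul_le_mul_of_nonneg_left (by linarith) hσ0.le
        · exact Or.inr (Or.inr ⟨not_le.1 h2, h.le⟩)
    have hγ' := S.tour P' trivial
    set γ' := S.path P' with hγ'def
    have hcont' := hγ'.continuous
    have hreg' := hγ'.mem_region
    have hlow : ∀ z : Plane, segment ℝ z (sq ε (-1) (-s)) ⊆ P'.region →
        z 0 ≤ 2 ∨ (ht ε z ≤ 2 ∧ z 0 ≤ 5 - M - ε) := by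
      intro z hz
      rcases hP'.sees_tip_flat hs1 hs2 hm hz with h | ⟨h, h'⟩
      · exact Or.inl h
      · refine Or.inr ⟨h, ?_⟩
        rw [← es] at h'
        exact le_of_mul_le_mul_left h' (by linarith)
    refine ⟨P', hP'.opt_pos fun x hx => ?_, 2 * ξ + 2 + 2 * (M + ε) - 4 * ε,
      2 * (M + ε) + 2 * ε + 4 * ε, by linarith, ?_,
      hP'.opt_le_flat (by linarith) (by linarith) (by linarith), ?_⟩
    · rcases hlow x hx with h | h <;> linarith
    · -- the position at time `T` is on the upper side
      have hup : 2 < ht ε (γ T) := by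
        by_contra hlt
        have h1 := hξt T le_rfl (not_lt.1 hlt)
        rcases hT' with h | h
        · linarith
        · exact hlt h.1
      have hT4 : γ T 0 ≤ 4 + ε := by
        rcases hT' with h | h
        · rw [h]; linarith
        · exact h.2
      have rT := reach_up _ (by linarith) hup
      have eT := hagree T le_rfl
      have et1 := hagree t1 ht1
      have e0 := hagree 0 zero_le
      have hle' : ∀ t ≤ T, 9 / 4 ≤ γ' t 0 := fun t ht => by rw [hagree t ht]; exact hle t ht
      obtain ⟨T2, hT2⟩ := hγ'.sees _ hP'.tip_mem
      have hT2' := hlow _ hT2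
      have hTT2 : T ≤ T2 := by
        by_contra hlt
        have hlt := (not_le.1 hlt).le
        have h1 := hle' T2 hlt
        rcases hT2' with h2 | ⟨h2, h3⟩
        · linarith
        · rw [hagree T2 hlt] at h2 h3
          have := hξt T2 hlt h2
          linarith
      obtain ⟨E, hE⟩ := hγ'.returns
      have hEe : ∀ t, γ' (max t E) 0 = 5 + ε := by
        intro t
        rw [hE _ (le_max_right _ _), hP'.start_eq, sq_zero]
      have first : ENNReal.ofReal (ξ - ε) ≤ eVariationOn γ' (Set.Icc 0 t1) := by
        refine hP'.reach_le_eVariationOn hcont' zero_le hreg'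
          (fun u hu => hle' u (hu.2.trans ht1)) ?_
        rw [et1, e0, hstart', sub_zero]
        exact le_trans (by linarith) (neg_le_abs _)
      have second : ENNReal.ofReal (ξ - ε + (5 - γ T 0)) ≤ eVariationOn γ' (Set.Icc t1 T) := by
        refine hP'.reach_le_eVariationOn hcont' ht1 hreg' (fun u hu => hle' u hu.2) ?_
        rw [et1, eT, rT]
        exact le_trans (by linarith) (le_abs_self _)
      have two := ofReal_le_eVariationOn_add zero_le ht1 first second
      by_cases hK : ∀ u ∈ Set.Icc T T2, 9 / 4 ≤ γ' u 0
      · have h2 : ht ε (γ' T2) ≤ 2 ∧ γ' T2 0 ≤ 5 - M - ε := by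
          rcases hT2' with h | h
          · have := hK T2 ⟨hTT2, le_rfl⟩; linarith
          · exact h
        have r2 := reach_low _ (by linarith) h2.1
        have third : ENNReal.ofReal (5 - γ T 0 + (M + ε)) ≤ eVariationOn γ' (Set.Icc T T2) := by
          refine hP'.reach_le_eVariationOn hcont' hTT2 hreg' hK ?_
          rw [eT, rT, r2]
          exact le_trans (by linarith) (neg_le_abs _)
        have fourth := ofReal_coord_le_eVariationOn (x := M + ε) hcont' 0
            (le_max_left T2 E) (by
          rw [hEe]; exact le_trans (by linarith) (le_abs_self _))
        have all := ofReal_le_eVariationOn_add zero_le (le_max_left T2 E)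
          (ofReal_le_eVariationOn_add zero_le hTT2 two third) fourth
        exact (ENNReal.ofReal_le_ofReal (by linarith)).trans (ofReal_le_length all)
      · push Not at hK
        obtain ⟨u, hu, hu'⟩ := hK
        have third := ofReal_coord_le_eVariationOn (x := γ T 0 - 9 / 4) hcont' 0
            hu.1 (by
          rw [eT]; exact le_trans (by linarith) (neg_le_abs _))
        have fourth := ofReal_coord_le_eVariationOn (x := 11 / 4) hcont' 0
            (le_max_left u E) (by
          rw [hEe]; exact le_trans (by linarith) (le_abs_self _))
        have all := ofReal_le_eVariationOn_add zero_le (le_max_left u E)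
          (ofReal_le_eVariationOn_add zero_le hu.1 two third) fourth
        exact (ENNReal.ofReal_le_ofReal (by linarith)).trans (ofReal_le_length all)
    · nlinarith

theorem colored_ratio (S : OnlineStrategy coloredView Set.univ) :
    ENNReal.ofReal ((3 + Real.sqrt 5) / 2) ≤ S.competitiveRatio := by
  have h5 : Real.sqrt 5 ^ 2 = 5 := Real.sq_sqrt (by norm_num)
  have h50 := Real.sqrt_nonneg 5
  have b1 : 2.236 < Real.sqrt 5 := Real.lt_sqrt_of_sq_lt (by norm_num)
  have b2 : Real.sqrt 5 < 2.2361 := (Real.sqrt_lt' (by norm_num)).2 (by norm_num)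
  refine S.ofReal_le_competitiveRatio fun η hη => ?_
  set ε := min (η / 40) (1 / 2000) with hε
  have hε0 : 0 < ε := lt_min (by positivity) (by norm_num)
  have hε1 : ε ≤ 1 / 2000 := min_le_right _ _
  have hε2 : ε ≤ η / 40 := min_le_left _ _
  obtain ⟨P, h1, a, b, h2, h3, h4, h6⟩ := colored_game S (φ := (1 + Real.sqrt 5) / 2) (ε := ε)
    (by linarith) (by linarith) (by linarith) hε0 (by linarith)
  refine ⟨P, trivial, h1, a, b, h2, h3, h4, le_trans ?_ h6⟩
  exact mul_le_mul_of_nonneg_right (by linarith) h2.le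

/-- A strategy for the standard model is a strategy for the colored model. -/
def OnlineStrategy.toColored (S : OnlineStrategy plainView Set.univ) :
    OnlineStrategy coloredView Set.univ where
  path := S.path
  tour := S.tour
  online := by
    intro P hP P' hP' hs t h
    refine S.online P hP P' hP' hs t fun τ hτ => ?_
    have := h τ hτ
    simp only [coloredView, plainView, Prod.mk.injEq] at this ⊢
    refine ⟨this.1, ?_⟩
    rw [Set.inter_union_distrib_left, Set.inter_union_distrib_left, this.2.1, this.2.2]

theorem plain_ratio (S : OnlineStrategy plainView Set.univ) :
    ENNReal.ofReal ((3 + Real.sqrt 5) / 2) ≤ S.competitiveRatio := by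
  simpa [OnlineStrategy.competitiveRatio, OnlineStrategy.toColored] using colored_ratio S.toColored

section

/-! ### Staircase-shaped walls -/

/-- The height `y` belongs to the `k`-th of `N` levels. The level `k` is the interval `[k, k + 1]`,
but the lowest and the highest level are unbounded. -/
def Lev (N k : ℕ) (y : ℝ) : Prop := k < N ∧ (k = 0 ∨ (k : ℝ) ≤ y) ∧ (k + 1 = N ∨ y ≤ k + 1)

/-- The height `y` belongs to the level `k` only. -/
def OnlyLev (N k : ℕ) (y : ℝ) : Prop := Lev N k y ∧ ∀ i, Lev N i y → i = k

/-- The point lies on the wall, or to the left of the wall, that has abscissa `A k` on level `k`. -/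
def Lf (N : ℕ) (A : ℕ → ℝ) (z : Plane) : Prop := ∃ k, Lev N k (z 1) ∧ z 0 ≤ A k

/-- The point lies on the wall, or to the right of the wall, that has abscissa `A k` on level
`k`. -/
def Rt (N : ℕ) (A : ℕ → ℝ) (z : Plane) : Prop := ∃ k, Lev N k (z 1) ∧ A k ≤ z 0

/-- The wall `A` is to the left of the wall `B`, also where consecutive levels meet. -/
def Sep (N : ℕ) (A B : ℕ → ℝ) : Prop :=
  ∀ k k', k < N → k' < N → k ≤ k' + 1 → k' ≤ k + 1 → A k < B k'

variable {N : ℕ} {A B : ℕ → ℝ}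

theorem exists_lev (hN : 0 < N) (y : ℝ) : ∃ k, Lev N k y := by
  by_cases hy : y ≤ 0
  · refine ⟨0, hN, Or.inl rfl, Or.inr ?_⟩
    push_cast; linarith
  · by_cases hy' : (N : ℝ) ≤ y
    · refine ⟨N - 1, by omega, Or.inr ?_, Or.inl (by omega)⟩
      rw [Nat.cast_sub (by omega)]; push_cast; linarith
    · have h0 : 0 ≤ y := (not_le.1 hy).le
      refine ⟨⌊y⌋₊, ?_, Or.inr (Nat.floor_le h0), Or.inr (Nat.lt_floor_add_one y).le⟩
      rw [Nat.floor_lt h0]; exact not_le.1 hy'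

theorem Lev.le_succ {k k' : ℕ} {y : ℝ} (h : Lev N k y) (h' : Lev N k' y) : k ≤ k' + 1 := by
  obtain ⟨h1, h2, h3⟩ := h
  obtain ⟨h1', h2', h3'⟩ := h'
  by_contra hlt
  rcases h2 with h2 | h2
  · omega
  rcases h3' with h3' | h3'
  · omega
  have : (k : ℝ) ≤ ((k' + 1 : ℕ) : ℝ) := by push_cast; linarith
  exact hlt (by exact_mod_cast this)

theorem lf_or_rt (hN : 0 < N) (A : ℕ → ℝ) (z : Plane) : Lf N A z ∨ Rt N A z := by
  obtain ⟨k, hk⟩ := exists_lev hN (z 1)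
  rcases le_total (z 0) (A k) with h | h
  · exact Or.inl ⟨k, hk, h⟩
  · exact Or.inr ⟨k, hk, h⟩

theorem Sep.not_rt (h : Sep N A B) {z : Plane} (hA : Lf N A z) (hB : Rt N B z) : False := by
  obtain ⟨k, hk, h1⟩ := hA
  obtain ⟨k', hk', h2⟩ := hB
  have := h k k' hk.1 hk'.1 (hk.le_succ hk') (hk'.le_succ hk)
  linarith

theorem not_lf_iff {z : Plane} : ¬ Lf N A z ↔ ∀ k, Lev N k (z 1) → A k < z 0 := by
  simp [Lf]

theorem not_rt_iff {z : Plane} : ¬ Rt N A z ↔ ∀ k, Lev N k (z 1) → z 0 < A k := by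
  simp [Rt]

theorem isClosed_lev (k : ℕ) : IsClosed {y : ℝ | Lev N k y} := by
  refine IsClosed.and (p₁ := fun _ : ℝ => k < N) isClosed_const ?_
  refine IsClosed.and ?_ ?_
  · by_cases h : k = 0
    · simp [h]
    · simpa [h] using isClosed_le continuous_const continuous_id
  · by_cases h : k + 1 = N
    · simp [h]
    · simpa [h] using isClosed_le continuous_id continuous_const

theorem isClosed_lf (A : ℕ → ℝ) : IsClosed {z | Lf N A z} := by
  have : {z | Lf N A z} = ⋃ k : Fin N, {z : Plane | Lev N k (z 1) ∧ z 0 ≤ A k} := by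
    ext z
    simp only [Lf, Set.mem_ofPred_eq, Set.mem_iUnion]
    exact ⟨fun ⟨k, hk, h⟩ => ⟨⟨k, hk.1⟩, hk, h⟩, fun ⟨k, hk, h⟩ => ⟨k, hk, h⟩⟩
  rw [this]
  exact isClosed_iUnion_of_finite fun k => ((isClosed_lev (k : ℕ)).preimage
    (show Continuous fun z : Plane => z 1 by fun_prop)).and
    (isClosed_le (by fun_prop) continuous_const)

theorem isClosed_rt (A : ℕ → ℝ) : IsClosed {z | Rt N A z} := by
  have : {z | Rt N A z} = ⋃ k : Fin N, {z : Plane | Lev N k (z 1) ∧ A k ≤ z 0} := by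
    ext z
    simp only [Rt, Set.mem_ofPred_eq, Set.mem_iUnion]
    exact ⟨fun ⟨k, hk, h⟩ => ⟨⟨k, hk.1⟩, hk, h⟩, fun ⟨k, hk, h⟩ => ⟨k, hk, h⟩⟩
  rw [this]
  exact isClosed_iUnion_of_finite fun k => ((isClosed_lev (k : ℕ)).preimage
    (show Continuous fun z : Plane => z 1 by fun_prop)).and
    (isClosed_le continuous_const (by fun_prop))

theorem OnlyLev.lf_iff {k : ℕ} {z : Plane} (h : OnlyLev N k (z 1)) : Lf N A z ↔ z 0 ≤ A k := by
  constructor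
  · rintro ⟨i, hi, h'⟩; rwa [h.2 i hi] at h'
  · exact fun h' => ⟨k, h.1, h'⟩

theorem OnlyLev.rt_iff {k : ℕ} {z : Plane} (h : OnlyLev N k (z 1)) : Rt N A z ↔ A k ≤ z 0 := by
  constructor
  · rintro ⟨i, hi, h'⟩; rwa [h.2 i hi] at h'
  · exact fun h' => ⟨k, h.1, h'⟩

theorem onlyLev_of {k : ℕ} {y : ℝ} (hk : k < N) (h1 : k = 0 ∨ (k : ℝ) < y)
    (h2 : k + 1 = N ∨ y < k + 1) : OnlyLev N k y := by
  refine ⟨⟨hk, h1.imp_right le_of_lt, h2.imp_right le_of_lt⟩, ?_⟩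
  rintro i ⟨hi, h1', h2'⟩
  rcases lt_trichotomy i k with h | h | h
  · exfalso
    rcases h2' with h2' | h2'
    · omega
    rcases h1 with h1 | h1
    · omega
    have : (k : ℝ) < ((i + 1 : ℕ) : ℝ) := by push_cast; linarith
    have : k < i + 1 := by exact_mod_cast this
    omega
  · exact h
  · exfalso
    rcases h1' with h1' | h1'
    · omega
    rcases h2 with h2 | h2
    · omega
    have : (i : ℝ) < ((k + 1 : ℕ) : ℝ) := by push_cast; linarith
    have : i < k + 1 := by exact_mod_cast this
    omega

theorem OnlyLev.bounds {k : ℕ} {y : ℝ} (h : OnlyLev N k y) :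
    (k = 0 ∨ (k : ℝ) < y) ∧ (k + 1 = N ∨ y < k + 1) := by
  obtain ⟨⟨hk, h1, h2⟩, hu⟩ := h
  constructor
  · rcases h1 with h1 | h1
    · exact Or.inl h1
    rcases h1.lt_or_eq with h1 | h1
    · exact Or.inr h1
    by_cases h0 : k = 0
    · exact Or.inl h0
    have := hu (k - 1) ⟨by omega, Or.inr ?_, Or.inr ?_⟩
    · omega
    · rw [Nat.cast_sub (by omega)]; push_cast; linarith
    · rw [Nat.cast_sub (by omega)]; push_cast; linarith
  · rcases h2 with h2 | h2
    · exact Or.inl h2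
    rcases h2.lt_or_eq with h2 | h2
    · exact Or.inr h2
    by_cases h0 : k + 1 = N
    · exact Or.inl h0
    have := hu (k + 1) ⟨by omega, Or.inr ?_, Or.inr ?_⟩
    · omega
    · push_cast; linarith
    · push_cast; linarith

theorem OnlyLev.between {k : ℕ} {s t y : ℝ} (hs : OnlyLev N k s) (ht : OnlyLev N k t)
    (h1 : s ≤ y) (h2 : y ≤ t) : OnlyLev N k y :=
  onlyLev_of hs.1.1 (hs.bounds.1.imp_right fun h => h.trans_le h1)
    (ht.bounds.2.imp_right fun h => h2.trans_lt h)

theorem OnlyLev.eq_pt {k : ℕ} {h : ℝ} (hk : OnlyLev N k h) {z : Plane} (hz : z 1 = h)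
    (h1 : Lf N A z) (h2 : Rt N A z) : z = pt (A k) h := by
  rw [← hz] at hk
  refine plane_ext ?_ (by simpa using hz)
  rw [pt_zero]
  exact le_antisymm (hk.lf_iff.1 h1) (hk.rt_iff.1 h2)

/-- The edge from `p` to `q` is vertical or horizontal. -/
def Ortho (p q : Plane) : Prop := p 0 = q 0 ∨ p 1 = q 1

theorem Ortho.symm {p q : Plane} (h : Ortho p q) : Ortho q p := h.imp Eq.symm Eq.symm

theorem mem_horizontal {x x' y : ℝ} (h : x ≤ x') {z : Plane} :
    z ∈ segment ℝ (pt x y) (pt x' y) ↔ z 1 = y ∧ x ≤ z 0 ∧ z 0 ≤ x' := by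
  rw [mem_segment_plane]
  simp only [pt_zero, pt_one]
  constructor
  · rintro ⟨t, t0, t1, e0, e1⟩
    refine ⟨by linarith, ?_, ?_⟩ <;> nlinarith
  · rintro ⟨e, h1, h2⟩
    rcases h.lt_or_eq with h | h
    · have : 0 < x' - x := by linarith
      refine ⟨(z 0 - x) / (x' - x), div_nonneg (by linarith) this.le, ?_, ?_, by linarith⟩
      · rw [div_le_one this]; linarith
      · field_simp; ring
    · exact ⟨0, le_rfl, zero_le_one, by linarith, by linarith⟩

theorem mem_vertical {x y y' : ℝ} (h : y ≤ y') {z : Plane} :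
    z ∈ segment ℝ (pt x y) (pt x y') ↔ z 0 = x ∧ y ≤ z 1 ∧ z 1 ≤ y' := by
  rw [mem_segment_plane]
  simp only [pt_zero, pt_one]
  constructor
  · rintro ⟨t, t0, t1, e0, e1⟩
    refine ⟨by linarith, ?_, ?_⟩ <;> nlinarith
  · rintro ⟨e, h1, h2⟩
    rcases h.lt_or_eq with h | h
    · have : 0 < y' - y := by linarith
      refine ⟨(z 1 - y) / (y' - y), div_nonneg (by linarith) this.le, ?_, by linarith, ?_⟩
      · rw [div_le_one this]; linarith
      · field_simp; ring
    · exact ⟨0, le_rfl, zero_le_one, by linarith, by linarith⟩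

theorem IsArc.vertical (x : ℝ) {y y' : ℝ} (h : y < y') :
    IsArc Ortho (pt x y) (pt x y') {z | z 0 = x ∧ y ≤ z 1 ∧ z 1 ≤ y'} := by
  have := IsArc.single (Q := Ortho) (p := pt x y) (q := pt x y')
    (fun e => by have := congrArg (fun p : Plane => p 1) e; simp at this; linarith)
    (Or.inl (by simp))
  convert this using 1
  ext z
  rw [mem_vertical h.le]; rfl

theorem IsArc.horizontal (y : ℝ) {x x' : ℝ} (h : x < x') :
    IsArc Ortho (pt x y) (pt x' y) {z | z 1 = y ∧ x ≤ z 0 ∧ z 0 ≤ x'} := by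
  have := IsArc.single (Q := Ortho) (p := pt x y) (q := pt x' y)
    (fun e => by have := congrArg (fun p : Plane => p 0) e; simp at this; linarith)
    (Or.inr (by simp))
  convert this using 1
  ext z
  rw [mem_horizontal h.le]; rfl

/-- The part of the wall `A` between the heights `s` and `t`. -/
def wall (N : ℕ) (A : ℕ → ℝ) (s t : ℝ) : Set Plane :=
  {z | (Lf N A z ∧ Rt N A z) ∧ s ≤ z 1 ∧ z 1 ≤ t}

theorem isArc_wall_same {k : ℕ} {s t : ℝ} (hs : OnlyLev N k s) (ht : OnlyLev N k t) (hst : s < t) :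
    IsArc Ortho (pt (A k) s) (pt (A k) t) (wall N A s t) := by
  convert IsArc.vertical (A k) hst using 1
  ext z
  simp only [wall, Set.mem_ofPred_eq]
  constructor
  · rintro ⟨⟨h1, h2⟩, h3, h4⟩
    have hk := hs.between ht h3 h4
    exact ⟨le_antisymm (hk.lf_iff.1 h1) (hk.rt_iff.1 h2), h3, h4⟩
  · rintro ⟨h1, h3, h4⟩
    have hk := hs.between ht h3 h4
    exact ⟨⟨hk.lf_iff.2 h1.le, hk.rt_iff.2 h1.ge⟩, h3, h4⟩

theorem isArc_wall_trans {i k j : ℕ} {s m t : ℝ} (hm : OnlyLev N k m)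
    (h1 : IsArc Ortho (pt (A i) s) (pt (A k) m) (wall N A s m))
    (h2 : IsArc Ortho (pt (A k) m) (pt (A j) t) (wall N A m t)) (hsm : s ≤ m) (hmt : m ≤ t) :
    IsArc Ortho (pt (A i) s) (pt (A j) t) (wall N A s t) := by
  convert h1.concat h2 ?_ using 1
  · ext z
    simp only [wall, Set.mem_ofPred_eq, Set.mem_union]
    constructor
    · rintro ⟨h, h3, h4⟩
      rcases le_total (z 1) m with h5 | h5
      · exact Or.inl ⟨h, h3, h5⟩
      · exact Or.inr ⟨h, h5, h4⟩
    · rintro (⟨h, h3, h4⟩ | ⟨h, h3, h4⟩)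
      · exact ⟨h, h3, by linarith⟩
      · exact ⟨h, by linarith, h4⟩
  · rintro x ⟨⟨h3, h4⟩, h5, h6⟩ ⟨-, h7, h8⟩
    exact hm.eq_pt (le_antisymm h6 h7) h3 h4

theorem onlyLev_half {k : ℕ} (hk : k < N) : OnlyLev N k (k + 1 / 2) :=
  onlyLev_of hk (Or.inr (by linarith)) (Or.inr (by linarith))

theorem onlyLev_low {y : ℝ} (hN : 0 < N) (hy : y < 1) : OnlyLev N 0 y :=
  onlyLev_of hN (Or.inl rfl) (Or.inr (by simpa using hy))

theorem onlyLev_high {y : ℝ} (hN : 0 < N) (hy : (N : ℝ) - 1 < y) : OnlyLev N (N - 1) y :=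
  onlyLev_of (by omega) (Or.inr (by rw [Nat.cast_sub (by omega)]; push_cast; linarith))
    (Or.inl (by omega))

theorem isArc_wall_succ (hA : StrictMono A) {k : ℕ} (hk : k + 1 < N) :
    IsArc Ortho (pt (A k) (k + 1 / 2)) (pt (A (k + 1)) (k + 1 + 1 / 2))
      (wall N A (k + 1 / 2) (k + 1 + 1 / 2)) := by
  have hlt : A k < A (k + 1) := hA (Nat.lt_succ_self k)
  have a1 := IsArc.vertical (A k) (show (k : ℝ) + 1 / 2 < k + 1 by linarith)
  have a2 := IsArc.horizontal ((k : ℝ) + 1) hlt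
  have a3 := IsArc.vertical (A (k + 1)) (show (k : ℝ) + 1 < k + 1 + 1 / 2 by linarith)
  convert (a1.concat a2 ?_).concat a3 ?_ using 1
  · ext z
    simp only [wall, Set.mem_ofPred_eq, Set.mem_union]
    constructor
    · rintro ⟨⟨⟨i, hi, h1⟩, ⟨i', hi', h2⟩⟩, h3, h4⟩
      rcases lt_trichotomy (z 1) (k + 1) with h | h | h
      · have hu : OnlyLev N k (z 1) := onlyLev_of (by omega) (Or.inr (by linarith)) (Or.inr h)
        rw [hu.2 i hi] at h1
        rw [hu.2 i' hi'] at h2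
        exact Or.inl (Or.inl ⟨le_antisymm h1 h2, h3, h.le⟩)
      · refine Or.inl (Or.inr ⟨h, ?_, ?_⟩)
        · have : k ≤ i' := by
            by_contra hlt'
            rcases hi'.2.2 with h5 | h5
            · omega
            have : ((k + 1 : ℕ) : ℝ) ≤ ((i' + 1 : ℕ) : ℝ) := by push_cast; linarith
            have : k + 1 ≤ i' + 1 := by exact_mod_cast this
            omega
          exact (hA.monotone this).trans h2
        · have : i ≤ k + 1 := by
            by_contra hlt'
            rcases hi.2.1 with h5 | h5
            · omega
            have : (i : ℝ) ≤ ((k + 1 : ℕ) : ℝ) := by push_cast; linarith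
            have : i ≤ k + 1 := by exact_mod_cast this
            omega
          exact h1.trans (hA.monotone this)
      · have hu : OnlyLev N (k + 1) (z 1) :=
          onlyLev_of hk (Or.inr (by push_cast; linarith)) (Or.inr (by push_cast; linarith))
        rw [hu.2 i hi] at h1
        rw [hu.2 i' hi'] at h2
        exact Or.inr ⟨le_antisymm h1 h2, h.le, h4⟩
    · rintro ((⟨h1, h2, h3⟩ | ⟨h1, h2, h3⟩) | ⟨h1, h2, h3⟩)
      · have : Lev N k (z 1) := ⟨by omega, Or.inr (by linarith), Or.inr h3⟩
        exact ⟨⟨⟨k, this, h1.le⟩, ⟨k, this, h1.ge⟩⟩, h2, by linarith⟩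
      · have l1 : Lev N k (z 1) := ⟨by omega, Or.inr (by linarith), Or.inr h1.le⟩
        have l2 : Lev N (k + 1) (z 1) :=
          ⟨hk, Or.inr (by push_cast; linarith), Or.inr (by push_cast; linarith)⟩
        exact ⟨⟨⟨k + 1, l2, h3⟩, ⟨k, l1, h2⟩⟩, by linarith, by linarith⟩
      · have : Lev N (k + 1) (z 1) :=
          ⟨hk, Or.inr (by push_cast; linarith), Or.inr (by push_cast; linarith)⟩
        exact ⟨⟨⟨k + 1, this, h1.le⟩, ⟨k + 1, this, h1.ge⟩⟩, by linarith, h3⟩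
  · rintro x ⟨h1, h2, h3⟩ ⟨h4, h5, h6⟩
    exact plane_ext (by simpa using h1) (by simpa using h4)
  · rintro x (⟨h1, h2, h3⟩ | ⟨h1, h2, h3⟩) ⟨h4, h5, h6⟩
    · linarith
    · exact plane_ext (by simpa using h4) (by simpa using h1)

theorem isArc_wall_half (hA : StrictMono A) (k n : ℕ) (hk : k + n + 1 < N) :
    IsArc Ortho (pt (A k) (k + 1 / 2)) (pt (A (k + n + 1)) (k + n + 1 + 1 / 2))
      (wall N A (k + 1 / 2) (k + n + 1 + 1 / 2)) := by
  induction n with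
  | zero => simpa using isArc_wall_succ hA (by omega : k + 1 < N)
  | succ n ih =>
    have h := isArc_wall_succ hA (by omega : (k + n + 1) + 1 < N)
    have hm := onlyLev_half (by omega : k + n + 1 < N)
    push_cast at h hm ⊢
    rw [show (k : ℝ) + (n + 1) + 1 + 1 / 2 = k + n + 1 + 1 + 1 / 2 by ring]
    exact isArc_wall_trans hm (ih (by omega)) h (by linarith [Nat.cast_nonneg (α := ℝ) n])
      (by linarith)

theorem isArc_wall_low (hA : StrictMono A) {s : ℝ} (hs : s ≤ 0) (k : ℕ) (hk : k < N) :
    IsArc Ortho (pt (A 0) s) (pt (A k) (k + 1 / 2)) (wall N A s (k + 1 / 2)) := by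
  have hN : 0 < N := by omega
  have h1 : IsArc Ortho (pt (A 0) s) (pt (A 0) (1 / 2)) (wall N A s (1 / 2)) :=
    isArc_wall_same (onlyLev_low hN (by linarith)) (onlyLev_low hN (by norm_num)) (by linarith)
  rcases k with _ | k
  · simpa using h1
  · have h2 := isArc_wall_half hA 0 k (by omega : 0 + k + 1 < N)
    push_cast at h2 ⊢
    simp only [zero_add] at h2
    exact isArc_wall_trans (onlyLev_low hN (by norm_num)) h1 h2 (by linarith)
      (by linarith [Nat.cast_nonneg (α := ℝ) k])

theorem isArc_wall_high (hA : StrictMono A) {t : ℝ} (ht : N ≤ t) (k : ℕ) (hk : k < N) :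
    IsArc Ortho (pt (A k) (k + 1 / 2)) (pt (A (N - 1)) t) (wall N A (k + 1 / 2) t) := by
  have hN : 0 < N := by omega
  have h0 : ((N - 1 : ℕ) : ℝ) = N - 1 := by rw [Nat.cast_sub (by omega)]; simp
  have h1 : IsArc Ortho (pt (A (N - 1)) ((N - 1 : ℕ) + 1 / 2)) (pt (A (N - 1)) t)
      (wall N A ((N - 1 : ℕ) + 1 / 2) t) :=
    isArc_wall_same (onlyLev_half (by omega)) (onlyLev_high hN (by linarith)) (by linarith)
  rcases Nat.lt_or_ge (k + 1) N with h | h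
  · have h2 := isArc_wall_half (N := N) hA k (N - 1 - k - 1) (by omega)
    have e : k + (N - 1 - k - 1) + 1 = N - 1 := by omega
    have e' : (k : ℝ) + ((N - 1 - k - 1 : ℕ) : ℝ) + 1 = ((N - 1 : ℕ) : ℝ) := by exact_mod_cast e
    rw [e, e'] at h2
    refine isArc_wall_trans (onlyLev_half (by omega : N - 1 < N)) h2 h1 ?_ (by linarith)
    have : (k : ℝ) + 1 < N := by exact_mod_cast h
    linarith
  · obtain rfl : k = N - 1 := by omega
    exact h1

theorem isArc_wall_full (hN : 0 < N) (hA : StrictMono A) {s t : ℝ} (hs : s ≤ 0) (ht : N ≤ t) :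
    IsArc Ortho (pt (A 0) s) (pt (A (N - 1)) t) (wall N A s t) := by
  have h1 := isArc_wall_low hA hs 0 hN
  have h2 := isArc_wall_high hA ht 0 hN
  have : (1 : ℝ) ≤ N := by exact_mod_cast hN
  simp only [Nat.cast_zero] at h1 h2
  exact isArc_wall_trans (by simpa using onlyLev_half hN) h1 h2 (by linarith) (by linarith)

/-- The horizontal piece at height `h` between two walls, in either order. -/
def rung (N : ℕ) (A B : ℕ → ℝ) (h : ℝ) : Set Plane :=
  {z | z 1 = h ∧ ((Rt N A z ∧ Lf N B z) ∨ (Rt N B z ∧ Lf N A z))}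

theorem rung_comm (A B : ℕ → ℝ) (h : ℝ) : rung N A B h = rung N B A h := by
  ext z; simp only [rung, Set.mem_ofPred_eq, or_comm]

theorem rung_eq {k : ℕ} {h : ℝ} (hk : OnlyLev N k h) (hAB : A k < B k) :
    rung N A B h = {z | z 1 = h ∧ A k ≤ z 0 ∧ z 0 ≤ B k} := by
  ext z
  simp only [rung, Set.mem_ofPred_eq, and_congr_right_iff]
  intro hz
  have hk' : OnlyLev N k (z 1) := hz ▸ hk
  rw [hk'.rt_iff, hk'.lf_iff, hk'.rt_iff, hk'.lf_iff]
  refine ⟨?_, Or.inl⟩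
  rintro (h | h)
  · exact h
  · linarith

theorem rung_eq_segment {k : ℕ} {h : ℝ} (hk : OnlyLev N k h) (hAB : Sep N A B ∨ Sep N B A) :
    rung N A B h = segment ℝ (pt (A k) h) (pt (B k) h) := by
  rcases hAB with hAB | hAB
  · have := hAB k k hk.1.1 hk.1.1 (by omega) (by omega)
    rw [rung_eq hk this]
    ext z; rw [mem_horizontal this.le]; rfl
  · have := hAB k k hk.1.1 hk.1.1 (by omega) (by omega)
    rw [rung_comm, rung_eq hk this, segment_symm]
    ext z; rw [mem_horizontal this.le]; rfl

theorem isArc_rung {k : ℕ} {h : ℝ} (hk : OnlyLev N k h) (hAB : Sep N A B ∨ Sep N B A) :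
    IsArc Ortho (pt (A k) h) (pt (B k) h) (rung N A B h) := by
  rw [rung_eq_segment hk hAB]
  refine IsArc.single (fun e => ?_) (Or.inr (by simp))
  have e := congrArg (fun p : Plane => p 0) e
  simp only [pt_zero] at e
  rcases hAB with hAB | hAB
  · have := hAB k k hk.1.1 hk.1.1 (by omega) (by omega); linarith
  · have := hAB k k hk.1.1 hk.1.1 (by omega) (by omega); linarith

end

section

/-! ### Polygons composed of walls and horizontal edges -/

/-- The point lies on the wall `A`. -/
def OnWall (N : ℕ) (A : ℕ → ℝ) (z : Plane) : Prop := Lf N A z ∧ Rt N A z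

/-- The point lies between the walls `A` and `B`, which may be given in either order. -/
def Btw (N : ℕ) (A B : ℕ → ℝ) (z : Plane) : Prop := (Rt N A z ∧ Lf N B z) ∨ (Rt N B z ∧ Lf N A z)

variable {N : ℕ} {A B : ℕ → ℝ}

theorem mem_wall {s t : ℝ} {z : Plane} : z ∈ wall N A s t ↔ OnWall N A z ∧ s ≤ z 1 ∧ z 1 ≤ t :=
  Iff.rfl

theorem mem_rung {h : ℝ} {z : Plane} : z ∈ rung N A B h ↔ z 1 = h ∧ Btw N A B z := Iff.rfl

theorem OnlyLev.eq_pt' {k : ℕ} {h : ℝ} (hk : OnlyLev N k h) {z : Plane} (hz : z 1 = h)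
    (h1 : OnWall N A z) : z = pt (A k) h := hk.eq_pt hz h1.1 h1.2

/-- A block between two walls. -/
theorem exists_block (hN : 0 < N) (hA : StrictMono A) (hB : StrictMono B) (hAB : Sep N A B)
    {s t : ℝ} (hs : s ≤ 0) (ht : N ≤ t) : ∃ C : SimplePolygon, C.IsOrthogonal ∧
      ∀ z, z ∈ C.boundary ↔ ((OnWall N A z ∨ OnWall N B z) ∧ s ≤ z 1 ∧ z 1 ≤ t) ∨
        ((z 1 = s ∨ z 1 = t) ∧ Btw N A B z) := by
  have hN1 : (1 : ℝ) ≤ N := by exact_mod_cast hN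
  have hs' : OnlyLev N 0 s := onlyLev_low hN (by linarith)
  have ht' : OnlyLev N (N - 1) t := onlyLev_high hN (by linarith)
  have d : ∀ z, OnWall N A z → OnWall N B z → False := fun z h h' => hAB.not_rt h.1 h'.2
  have a1 := isArc_wall_full hN hB hs ht
  have a2 := isArc_rung ht' (Or.inr hAB)
  have a3 := (isArc_wall_full hN hA hs ht).reverse (fun _ _ => Ortho.symm)
  have b2 := a1.concat a2 (by
    simp only [mem_wall, mem_rung]
    rintro x ⟨h1, h2, h3⟩ ⟨h4, h5⟩
    exact ht'.eq_pt' h4 h1)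
  have b3 := b2.concat a3 (by
    simp only [mem_wall, mem_rung, Set.mem_union]
    rintro x (⟨h1, h2, h3⟩ | ⟨h1, h2⟩) ⟨h4, h5, h6⟩
    · exact (d x h4 h1).elim
    · exact ht'.eq_pt' h1 h4)
  have e : rung N B A s = segment ℝ (pt (A 0) s) (pt (B 0) s) := by
    rw [rung_comm]; exact rung_eq_segment hs' (Or.inl hAB)
  obtain ⟨C, hC, hQ⟩ := b3.close (Or.inr (by simp)) (fun e => by
      have e := congrArg (fun p : Plane => p 0) e
      simp only [pt_zero] at e
      have := hAB 0 0 hN hN (by omega) (by omega); linarith) (by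
    rw [← e]
    simp only [mem_wall, mem_rung, Set.mem_union]
    rintro x ((⟨h1, h2, h3⟩ | ⟨h1, h2⟩) | ⟨h1, h2, h3⟩) ⟨h4, h5⟩
    · left; exact hs'.eq_pt' h4 h1
    · linarith
    · right; exact hs'.eq_pt' h4 h1)
  refine ⟨C, hQ, fun z => ?_⟩
  rw [hC, ← e]
  have e2 : Btw N B A z ↔ Btw N A B z := or_comm
  simp only [mem_wall, mem_rung, Set.mem_union, e2]
  tauto

set_option maxHeartbeats 400000 in
/-- The polygon with four walls `A`, `B`, `C`, `D`, in this cyclic order: between the heights `a`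
and `b` the walls `A` and `B` are interrupted, and connected by horizontal edges at `a` and at `b`.
The other horizontal edges connect `B` with `C` at the heights `0` and `N`, and `A` with `D` at the
heights `s` and `t`. -/
theorem exists_ring (hN : 0 < N) {C D : ℕ → ℝ} (hA : StrictMono A) (hB : StrictMono B)
    (hC : StrictMono C) (hD : StrictMono D)
    (sAB : Sep N A B ∨ Sep N B A) (sBC : Sep N B C ∨ Sep N C B) (sAD : Sep N A D ∨ Sep N D A)
    (dAB : ∀ z, OnWall N A z → ¬ OnWall N B z) (dAC : ∀ z, OnWall N A z → ¬ OnWall N C z)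
    (dAD : ∀ z, OnWall N A z → ¬ OnWall N D z) (dBC : ∀ z, OnWall N B z → ¬ OnWall N C z)
    (dBD : ∀ z, OnWall N B z → ¬ OnWall N D z) (dCD : ∀ z, OnWall N C z → ¬ OnWall N D z)
    (hAB : ∀ z, Btw N A B z → ¬ OnWall N C z ∧ ¬ OnWall N D z)
    (hBC : ∀ z, Btw N B C z → ¬ OnWall N A z ∧ ¬ OnWall N D z)
    {s t : ℝ} (hs : s ≤ 0) (ht : N ≤ t)
    (hAD : (s < 0 ∧ N < t) ∨ ∀ z, Btw N A D z → ¬ OnWall N B z ∧ ¬ OnWall N C z ∧ ¬ Btw N B C z)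
    {i j : ℕ} (hij : i < j) (hj : j < N) {a b : ℝ} (ha : a = i + 1 / 2) (hb : b = j + 1 / 2) :
    ∃ P : SimplePolygon, P.IsOrthogonal ∧
      ∀ z, z ∈ P.boundary ↔
        (OnWall N A z ∧ ((s ≤ z 1 ∧ z 1 ≤ a) ∨ (b ≤ z 1 ∧ z 1 ≤ t))) ∨
        (OnWall N B z ∧ ((0 ≤ z 1 ∧ z 1 ≤ a) ∨ (b ≤ z 1 ∧ z 1 ≤ N))) ∨
        (OnWall N C z ∧ 0 ≤ z 1 ∧ z 1 ≤ N) ∨ (OnWall N D z ∧ s ≤ z 1 ∧ z 1 ≤ t) ∨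
        (Btw N A B z ∧ (z 1 = a ∨ z 1 = b)) ∨ (Btw N B C z ∧ (z 1 = 0 ∨ z 1 = N)) ∨
        (Btw N A D z ∧ (z 1 = s ∨ z 1 = t)) := by
  have hN1 : (1 : ℝ) ≤ N := by exact_mod_cast hN
  have hij' : (i : ℝ) + 1 ≤ j := by exact_mod_cast hij
  have hj' : (j : ℝ) + 1 ≤ N := by exact_mod_cast hj
  have hi0 : (0 : ℝ) ≤ i := Nat.cast_nonneg i
  have ha0 : 0 < a := by linarith
  have hab : a < b := by linarith
  have hbN : b < N := by linarith
  have ls : OnlyLev N 0 s := onlyLev_low hN (by linarith)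
  have l0 : OnlyLev N 0 0 := onlyLev_low hN (by linarith)
  have lt : OnlyLev N (N - 1) t := onlyLev_high hN (by linarith)
  have lN : OnlyLev N (N - 1) N := onlyLev_high hN (by linarith)
  have la : OnlyLev N i a := ha ▸ onlyLev_half (by omega)
  have lb : OnlyLev N j b := hb ▸ onlyLev_half (by omega)
  have sBA := sAB.symm
  have sCB := sBC.symm
  have rev : ∀ p q : Plane, Ortho p q → Ortho q p := fun _ _ => Ortho.symm
  have eBA : ∀ z, Btw N B A z ↔ Btw N A B z := fun z => or_comm
  have eCB : ∀ z, Btw N C B z ↔ Btw N B C z := fun z => or_comm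
  have eDA : ∀ z, Btw N D A z ↔ Btw N A D z := fun z => or_comm
  -- the twelve pieces
  have p1 := isArc_wall_low (N := N) hA hs i (by omega)
  have p2 := isArc_rung la sAB
  have p3 := (isArc_wall_low (N := N) hB le_rfl i (by omega)).reverse rev
  have p4 := isArc_rung l0 sBC
  have p5 := isArc_wall_full hN hC le_rfl le_rfl
  have p6 := isArc_rung lN sCB
  have p7 := (isArc_wall_high hB le_rfl j hj).reverse rev
  have p8 := isArc_rung lb sBA
  have p9 := isArc_wall_high hA ht j hj
  have p10 := isArc_rung lt sAD
  have p11 := (isArc_wall_full hN hD hs ht).reverse rev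
  have p12 : rung N D A s = segment ℝ (pt (D 0) s) (pt (A 0) s) := rung_eq_segment ls sAD.symm
  rw [← ha] at p1 p3
  rw [← hb] at p7 p9
  have q2 := p1.concat p2 (by
    simp only [mem_wall, mem_rung]
    rintro x ⟨h1, h2, h3⟩ ⟨h4, h5⟩
    exact la.eq_pt' h4 h1)
  have q3 := q2.concat p3 (by
    simp only [mem_wall, mem_rung, Set.mem_union]
    rintro x (⟨h1, h2, h3⟩ | ⟨h1, h2⟩) ⟨h4, h5, h6⟩
    · exact (dAB x h1 h4).elim
    · exact la.eq_pt' h1 h4)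
  have q4 := q3.concat p4 (by
    simp only [mem_wall, mem_rung, Set.mem_union]
    rintro x ((⟨h1, h2, h3⟩ | ⟨h1, h2⟩) | ⟨h1, h2, h3⟩) ⟨h4, h5⟩
    · exact absurd h1 (hBC x h5).1
    · linarith
    · exact l0.eq_pt' h4 h1)
  have q5 := q4.concat p5 (by
    simp only [mem_wall, mem_rung, Set.mem_union]
    rintro x (((⟨h1, h2, h3⟩ | ⟨h1, h2⟩) | ⟨h1, h2, h3⟩) | ⟨h1, h2⟩) ⟨h4, h5, h6⟩
    · exact (dAC x h1 h4).elim
    · exact absurd h4 (hAB x h2).1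
    · exact (dBC x h1 h4).elim
    · exact l0.eq_pt' h1 h4)
  have q6 := q5.concat p6 (by
    simp only [mem_wall, mem_rung, Set.mem_union]
    rintro x ((((⟨h1, h2, h3⟩ | ⟨h1, h2⟩) | ⟨h1, h2, h3⟩) | ⟨h1, h2⟩) | ⟨h1, h2, h3⟩) ⟨h4, h5⟩
    · linarith
    · linarith
    · linarith
    · linarith
    · exact lN.eq_pt' h4 h1)
  have q7 := q6.concat p7 (by
    simp only [mem_wall, mem_rung, Set.mem_union]
    rintro x (((((⟨h1, h2, h3⟩ | ⟨h1, h2⟩) | ⟨h1, h2, h3⟩) | ⟨h1, h2⟩) | ⟨h1, h2, h3⟩) |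
      ⟨h1, h2⟩) ⟨h4, h5, h6⟩
    · linarith
    · linarith
    · linarith
    · linarith
    · exact (dBC x h4 h1).elim
    · exact lN.eq_pt' h1 h4)
  have q8 := q7.concat p8 (by
    simp only [mem_wall, mem_rung, Set.mem_union]
    rintro x ((((((⟨h1, h2, h3⟩ | ⟨h1, h2⟩) | ⟨h1, h2, h3⟩) | ⟨h1, h2⟩) | ⟨h1, h2, h3⟩) |
      ⟨h1, h2⟩) | ⟨h1, h2, h3⟩) ⟨h4, h5⟩
    · linarith
    · linarith
    · linarith
    · linarith
    · exact absurd h1 (hAB x ((eBA x).1 h5)).1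
    · linarith
    · exact lb.eq_pt' h4 h1)
  have q9 := q8.concat p9 (by
    simp only [mem_wall, mem_rung, Set.mem_union]
    rintro x (((((((⟨h1, h2, h3⟩ | ⟨h1, h2⟩) | ⟨h1, h2, h3⟩) | ⟨h1, h2⟩) | ⟨h1, h2, h3⟩) |
      ⟨h1, h2⟩) | ⟨h1, h2, h3⟩) | ⟨h1, h2⟩) ⟨h4, h5, h6⟩
    · linarith
    · linarith
    · linarith
    · linarith
    · exact (dAC x h4 h1).elim
    · exact absurd h4 (hBC x ((eCB x).1 h2)).1
    · exact (dAB x h4 h1).elim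
    · exact lb.eq_pt' h1 h4)
  have q10 := q9.concat p10 (by
    simp only [mem_wall, mem_rung, Set.mem_union]
    rintro x ((((((((⟨h1, h2, h3⟩ | ⟨h1, h2⟩) | ⟨h1, h2, h3⟩) | ⟨h1, h2⟩) | ⟨h1, h2, h3⟩) |
      ⟨h1, h2⟩) | ⟨h1, h2, h3⟩) | ⟨h1, h2⟩) | ⟨h1, h2, h3⟩) ⟨h4, h5⟩
    · linarith
    · linarith
    · linarith
    · linarith
    · rcases hAD with h | h
      · linarith
      · exact absurd h1 (h x h5).2.1
    · rcases hAD with h | h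
      · linarith
      · exact absurd ((eCB x).1 h2) (h x h5).2.2
    · rcases hAD with h | h
      · linarith
      · exact absurd h1 (h x h5).1
    · linarith
    · exact lt.eq_pt' h4 h1)
  have q11 := q10.concat p11 (by
    simp only [mem_wall, mem_rung, Set.mem_union]
    rintro x (((((((((⟨h1, h2, h3⟩ | ⟨h1, h2⟩) | ⟨h1, h2, h3⟩) | ⟨h1, h2⟩) | ⟨h1, h2, h3⟩) |
      ⟨h1, h2⟩) | ⟨h1, h2, h3⟩) | ⟨h1, h2⟩) | ⟨h1, h2, h3⟩) | ⟨h1, h2⟩) ⟨h4, h5, h6⟩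
    · exact (dAD x h1 h4).elim
    · exact absurd h4 (hAB x h2).2
    · exact (dBD x h1 h4).elim
    · exact absurd h4 (hBC x h2).2
    · exact (dCD x h1 h4).elim
    · exact absurd h4 (hBC x ((eCB x).1 h2)).2
    · exact (dBD x h1 h4).elim
    · exact absurd h4 (hAB x ((eBA x).1 h2)).2
    · exact (dAD x h1 h4).elim
    · exact lt.eq_pt' h1 h4)
  obtain ⟨P, hP, hQ⟩ := q11.close (Or.inr (by simp)) (fun e => by
      have e := congrArg (fun p : Plane => p 0) e
      simp only [pt_zero] at e
      rcases sAD with h | h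
      · have := h 0 0 hN hN (by omega) (by omega); linarith
      · have := h 0 0 hN hN (by omega) (by omega); linarith) (by
    rw [← p12]
    simp only [mem_wall, mem_rung, Set.mem_union]
    rintro x ((((((((((⟨h1, h2, h3⟩ | ⟨h1, h2⟩) | ⟨h1, h2, h3⟩) | ⟨h1, h2⟩) | ⟨h1, h2, h3⟩) |
      ⟨h1, h2⟩) | ⟨h1, h2, h3⟩) | ⟨h1, h2⟩) | ⟨h1, h2, h3⟩) | ⟨h1, h2⟩) | ⟨h1, h2, h3⟩) ⟨h4, h5⟩
    · left; exact ls.eq_pt' h4 h1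
    · linarith
    · rcases hAD with h | h
      · linarith
      · exact absurd h1 (h x ((eDA x).1 h5)).1
    · rcases hAD with h | h
      · linarith
      · exact absurd h2 (h x ((eDA x).1 h5)).2.2
    · rcases hAD with h | h
      · linarith
      · exact absurd h1 (h x ((eDA x).1 h5)).2.1
    · linarith
    · linarith
    · linarith
    · linarith
    · linarith
    · right; exact ls.eq_pt' h4 h1)
  refine ⟨P, hQ, fun z => ?_⟩
  rw [hP, ← p12]
  simp only [mem_wall, mem_rung, Set.mem_union, eBA, eCB, eDA]
  constructor
  · rintro (((((((((((⟨h1, h2, h3⟩ | ⟨h1, h2⟩) | ⟨h1, h2, h3⟩) | ⟨h1, h2⟩) | ⟨h1, h2, h3⟩) |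
      ⟨h1, h2⟩) | ⟨h1, h2, h3⟩) | ⟨h1, h2⟩) | ⟨h1, h2, h3⟩) | ⟨h1, h2⟩) | ⟨h1, h2, h3⟩) |
      ⟨h1, h2⟩)
    · exact Or.inl (⟨h1, Or.inl ⟨h2, h3⟩⟩)
    · exact Or.inr (Or.inr (Or.inr (Or.inr (Or.inl (⟨h2, Or.inl h1⟩)))))
    · exact Or.inr (Or.inl (⟨h1, Or.inl ⟨h2, h3⟩⟩))
    · exact Or.inr (Or.inr (Or.inr (Or.inr (Or.inr (Or.inl (⟨h2, Or.inl h1⟩))))))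
    · exact Or.inr (Or.inr (Or.inl (⟨h1, h2, h3⟩)))
    · exact Or.inr (Or.inr (Or.inr (Or.inr (Or.inr (Or.inl (⟨h2, Or.inr h1⟩))))))
    · exact Or.inr (Or.inl (⟨h1, Or.inr ⟨h2, h3⟩⟩))
    · exact Or.inr (Or.inr (Or.inr (Or.inr (Or.inl (⟨h2, Or.inr h1⟩)))))
    · exact Or.inl (⟨h1, Or.inr ⟨h2, h3⟩⟩)
    · exact Or.inr (Or.inr (Or.inr (Or.inr (Or.inr (Or.inr (⟨h2, Or.inr h1⟩))))))
    · exact Or.inr (Or.inr (Or.inr (Or.inl (⟨h1, h2, h3⟩))))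
    · exact Or.inr (Or.inr (Or.inr (Or.inr (Or.inr (Or.inr (⟨h2, Or.inl h1⟩))))))
  · rintro (⟨h1, h2 | h2⟩ | ⟨h1, h2 | h2⟩ | ⟨h1, h2⟩ | ⟨h1, h2⟩ | ⟨h1, h2 | h2⟩ | ⟨h1, h2 | h2⟩ |
      ⟨h1, h2 | h2⟩)
    · exact Or.inl (Or.inl (Or.inl (Or.inl (Or.inl (Or.inl (Or.inl (Or.inl (Or.inl (Or.inl
        (Or.inl (⟨h1, h2⟩)))))))))))
    · exact Or.inl (Or.inl (Or.inl (Or.inr (⟨h1, h2⟩))))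
    · exact Or.inl (Or.inl (Or.inl (Or.inl (Or.inl (Or.inl (Or.inl (Or.inl (Or.inl
        (Or.inr (⟨h1, h2⟩))))))))))
    · exact Or.inl (Or.inl (Or.inl (Or.inl (Or.inl (Or.inr (⟨h1, h2⟩))))))
    · exact Or.inl (Or.inl (Or.inl (Or.inl (Or.inl (Or.inl (Or.inl (Or.inr (⟨h1, h2⟩))))))))
    · exact Or.inl (Or.inr (⟨h1, h2⟩))
    · exact Or.inl (Or.inl (Or.inl (Or.inl (Or.inl (Or.inl (Or.inl (Or.inl (Or.inl (Or.inl
        (Or.inr (⟨h2, h1⟩)))))))))))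
    · exact Or.inl (Or.inl (Or.inl (Or.inl (Or.inr (⟨h2, h1⟩)))))
    · exact Or.inl (Or.inl (Or.inl (Or.inl (Or.inl (Or.inl (Or.inl (Or.inl
        (Or.inr (⟨h2, h1⟩)))))))))
    · exact Or.inl (Or.inl (Or.inl (Or.inl (Or.inl (Or.inl (Or.inr (⟨h2, h1⟩)))))))
    · exact Or.inr (⟨h2, h1⟩)
    · exact Or.inl (Or.inl (Or.inr (⟨h2, h1⟩)))

end

section

/-! ### Escaping from walls to infinity -/

variable {N : ℕ} {A B : ℕ → ℝ} {X : Set Plane} {z : Plane}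

theorem Escapes.left (h : ∀ z' : Plane, z' 1 = z 1 → z' 0 ≤ z 0 → z' ∈ X) : Escapes X z :=
  escapes_left 1 fun z' h1 h2 => h z' (by simpa [ht] using h1) h2

theorem Escapes.right (h : ∀ z' : Plane, z' 1 = z 1 → z 0 ≤ z' 0 → z' ∈ X) : Escapes X z :=
  escapes_right 1 fun z' h1 h2 => h z' (by simpa [ht] using h1) h2

theorem Escapes.up (h : ∀ z' : Plane, z' 0 = z 0 → z 1 ≤ z' 1 → z' ∈ X) : Escapes X z :=
  escapes_up one_pos fun z' h1 h2 => h z' h1 (by simpa [ht] using h2)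

theorem Escapes.down (h : ∀ z' : Plane, z' 0 = z 0 → z' 1 ≤ z 1 → z' ∈ X) : Escapes X z :=
  escapes_down one_pos fun z' h1 h2 => h z' h1 (by simpa [ht] using h2)

theorem Escapes.vertical {y : ℝ} (hy : Escapes X (pt (z 0) y))
    (h : ∀ z' : Plane, z' 0 = z 0 → z' 1 ∈ Set.uIcc (z 1) y → z' ∈ X) : Escapes X z := by
  refine Escapes.of_segment (fun z' hz' => ?_) hy
  obtain ⟨t, t0, t1, e0, e1⟩ := mem_segment_plane.1 hz'
  simp only [pt_zero, pt_one] at e0 e1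
  refine h z' (by rw [e0]; ring) ?_
  rw [Set.mem_uIcc, e1]
  rcases le_total (z 1) y with h | h
  · left; constructor <;> nlinarith
  · right; constructor <;> nlinarith

theorem Escapes.horizontal {x : ℝ} (hx : Escapes X (pt x (z 1)))
    (h : ∀ z' : Plane, z' 1 = z 1 → z' 0 ∈ Set.uIcc (z 0) x → z' ∈ X) : Escapes X z := by
  refine Escapes.of_segment (fun z' hz' => ?_) hx
  obtain ⟨t, t0, t1, e0, e1⟩ := mem_segment_plane.1 hz'
  simp only [pt_zero, pt_one] at e0 e1
  refine h z' (by rw [e1]; ring) ?_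
  rw [Set.mem_uIcc, e0]
  rcases le_total (z 0) x with h | h
  · left; constructor <;> nlinarith
  · right; constructor <;> nlinarith

theorem not_rt_left {z' : Plane} (h : ¬ Rt N A z) (h1 : z' 1 = z 1) (h0 : z' 0 ≤ z 0) :
    ¬ Rt N A z' := by
  rw [not_rt_iff] at h ⊢
  exact fun k hk => h0.trans_lt (h k (h1 ▸ hk))

theorem not_lf_right {z' : Plane} (h : ¬ Lf N A z) (h1 : z' 1 = z 1) (h0 : z 0 ≤ z' 0) :
    ¬ Lf N A z' := by
  rw [not_lf_iff] at h ⊢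
  exact fun k hk => (h k (h1 ▸ hk)).trans_le h0

/-- A channel between two walls can be left downwards. -/
theorem channel_escape_down (hA : StrictMono A) (hB : StrictMono B) (hAB : Sep N A B) {h : ℝ}
    (hX : ∀ z, ¬ Lf N A z → ¬ Rt N B z → z 1 < h → z ∈ X)
    (hX0 : ∀ z : Plane, z 1 < 0 → Escapes X z) (k : ℕ) : ∀ z : Plane, Lev N k (z 1) →
    ¬ Lf N A z → ¬ Rt N B z → z 1 < h → Escapes X z := by
  induction k with
  | zero =>
    intro z hk h1 h2 h3
    rw [not_lf_iff] at h1
    rw [not_rt_iff] at h2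
    rcases lt_or_ge (z 1) 0 with h0 | h0
    · exact hX0 z h0
    refine Escapes.vertical (y := -1) (hX0 _ (by simp)) fun z' e0 e1 => ?_
    rw [Set.uIcc_of_ge (by linarith)] at e1
    have hk' : ∀ i, Lev N i (z' 1) → Lev N i (z 1) ∨ i = 0 := by
      intro i hi
      rcases e1.2.lt_or_eq with h | h
      · right
        refine (onlyLev_of hk.1 (Or.inl rfl) ?_).2 i hi
        exact hk.2.2.imp_right h.trans_le
      · left; rwa [← h]
    refine hX z' (not_lf_iff.2 fun i hi => ?_) (not_rt_iff.2 fun i hi => ?_)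
      (e1.2.trans_lt h3)
    · rw [e0]
      rcases hk' i hi with h | rfl
      · exact h1 i h
      · exact h1 0 hk
    · rw [e0]
      rcases hk' i hi with h | rfl
      · exact h2 i h
      · exact h2 0 hk
  | succ k ih =>
    intro z hk h1 h2 h3
    have hk1 : (k : ℝ) + 1 ≤ z 1 := by
      rcases hk.2.1 with h | h
      · omega
      · exact_mod_cast h
    rcases hk1.lt_or_eq with hlt | heq
    swap
    · refine ih z ⟨by have := hk.1; omega, Or.inr (by linarith), Or.inr heq.ge⟩ h1 h2 h3
    have h1' := not_lf_iff.1 h1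
    have h2' := not_rt_iff.1 h2
    have hkN := hk.1
    set y := ((k : ℝ) + 1 + z 1) / 2 with hy
    have hy1 : (k : ℝ) + 1 < y := by linarith
    have hy2 : y < z 1 := by linarith
    have only : ∀ y', (k : ℝ) + 1 < y' → y' < z 1 → OnlyLev N (k + 1) y' := by
      intro y' h4 h5
      exact onlyLev_of hkN (Or.inr (by push_cast; linarith)) (hk.2.2.imp_right h5.trans_le)
    obtain ⟨g, hg1, hg2⟩ := exists_between (hAB (k + 1) k hkN (by omega) (by omega) (by omega))
    have bk := hB (Nat.lt_succ_self k)
    have ak := hA (Nat.lt_succ_self k)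
    have e4 : Escapes X (pt g (k + 1)) := by
      refine ih _ ⟨by omega, Or.inr (by simp), Or.inr (by simp)⟩ ?_ ?_ (by simp; linarith)
      · refine not_lf_iff.2 fun i hi => ?_
        rw [pt_zero]
        have : i ≤ k + 1 := by
          by_contra hc
          rcases hi.2.1 with h | h
          · omega
          have : i ≤ k + 1 := by exact_mod_cast (by simpa using h : (i : ℝ) ≤ k + 1)
          omega
        exact (hA.monotone this).trans_lt hg1
      · refine not_rt_iff.2 fun i hi => ?_
        rw [pt_zero]
        have : k ≤ i := by
          by_contra hc
          rcases hi.2.2 with h | h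
          · omega
          have : k ≤ i := by exact_mod_cast (by simpa using h : (k : ℝ) ≤ i)
          omega
        exact hg2.trans_le (hB.monotone this)
    have e3 : Escapes X (pt g y) := by
      refine Escapes.vertical (y := k + 1) (by simpa using e4) fun z' f0 f1 => ?_
      simp only [pt_zero, pt_one] at f0 f1
      rw [Set.uIcc_of_ge hy1.le] at f1
      have lev : ∀ i, Lev N i (z' 1) → i ≤ k + 1 ∧ k ≤ i := by
        intro i hi
        have l2 : Lev N (k + 1) (z' 1) := ⟨hkN, Or.inr (by push_cast; exact f1.1), by
          refine hk.2.2.imp_right fun h => ?_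
          linarith [f1.2]⟩
        have l3 := l2.le_succ hi
        refine ⟨?_, by omega⟩
        by_contra hc
        rcases hi.2.1 with h | h
        · omega
        have hi2 : i = k + 2 := by have := hi.le_succ l2; omega
        rw [hi2] at h
        rcases hk.2.2 with h5 | h5
        · have := hi.1; omega
        · push_cast at h h5; linarith [f1.2]
      refine hX z' (not_lf_iff.2 fun i hi => ?_) (not_rt_iff.2 fun i hi => ?_) (by linarith [f1.2])
      · rw [f0]; exact (hA.monotone (lev i hi).1).trans_lt hg1
      · rw [f0]; exact hg2.trans_le (hB.monotone (lev i hi).2)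
    have e2 : Escapes X (pt (z 0) y) := by
      refine Escapes.horizontal (x := g) (by simpa using e3) fun z' f0 f1 => ?_
      simp only [pt_zero, pt_one] at f0 f1
      have hu := only y hy1 hy2
      rw [← f0] at hu
      have c1 := h1' (k + 1) hk
      have c2 := h2' (k + 1) hk
      rw [Set.mem_uIcc] at f1
      refine hX z' (fun hf => ?_) (fun hf => ?_) (by linarith)
      · have := hu.lf_iff.1 hf
        rcases f1 with f1 | f1 <;> linarith [f1.1]
      · have := hu.rt_iff.1 hf
        rcases f1 with f1 | f1 <;> linarith [f1.2]
    refine Escapes.vertical (y := y) e2 fun z' f0 f1 => ?_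
    rw [Set.uIcc_of_ge hy2.le] at f1
    rcases f1.2.lt_or_eq with h | h
    · have hu := only (z' 1) (by linarith [f1.1]) h
      refine hX z' (fun hf => ?_) (fun hf => ?_) (by linarith)
      · have := hu.lf_iff.1 hf
        have := h1' (k + 1) hk; linarith
      · have := hu.rt_iff.1 hf
        have := h2' (k + 1) hk; linarith
    · have : z' = z := plane_ext f0 h
      rw [this]; exact hX z h1 h2 h3

/-- A channel between two walls can be left upwards. -/
theorem channel_escape_up (hA : StrictMono A) (hB : StrictMono B) (hAB : Sep N A B) {h : ℝ}
    (hX : ∀ z, ¬ Lf N A z → ¬ Rt N B z → h < z 1 → z ∈ X)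
    (hX0 : ∀ z : Plane, N < z 1 → Escapes X z) (n : ℕ) : ∀ (k : ℕ) (z : Plane), k + n + 1 = N →
    Lev N k (z 1) → ¬ Lf N A z → ¬ Rt N B z → h < z 1 → Escapes X z := by
  induction n with
  | zero =>
    intro k z hkn hk h1 h2 h3
    rw [not_lf_iff] at h1
    rw [not_rt_iff] at h2
    rcases lt_or_ge (N : ℝ) (z 1) with h0 | h0
    · exact hX0 z h0
    refine Escapes.vertical (y := N + 1) (hX0 _ (by simp)) fun z' e0 e1 => ?_
    rw [Set.uIcc_of_le (by linarith)] at e1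
    have hk' : ∀ i, Lev N i (z' 1) → Lev N i (z 1) ∨ i = k := by
      intro i hi
      rcases e1.1.lt_or_eq with h | h
      · right
        refine (onlyLev_of hk.1 ?_ (Or.inl (by omega))).2 i hi
        exact hk.2.1.imp_right fun h' => h'.trans_lt h
      · left; rwa [h]
    refine hX z' (not_lf_iff.2 fun i hi => ?_) (not_rt_iff.2 fun i hi => ?_)
      (h3.trans_le e1.1)
    · rw [e0]
      rcases hk' i hi with h | rfl
      · exact h1 i h
      · exact h1 _ hk
    · rw [e0]
      rcases hk' i hi with h | rfl
      · exact h2 i h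
      · exact h2 _ hk
  | succ n ih =>
    intro k z hkn hk h1 h2 h3
    have hk1 : z 1 ≤ (k : ℝ) + 1 := by
      rcases hk.2.2 with h | h
      · omega
      · exact h
    have hkN : k + 1 < N := by omega
    rcases hk1.lt_or_eq with hlt | heq
    swap
    · exact ih (k + 1) z (by omega) ⟨hkN, Or.inr (by push_cast; linarith),
        Or.inr (by push_cast; linarith)⟩ h1 h2 h3
    have h1' := not_lf_iff.1 h1
    have h2' := not_rt_iff.1 h2
    set y := ((k : ℝ) + 1 + z 1) / 2 with hy
    have hy1 : y < (k : ℝ) + 1 := by linarith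
    have hy2 : z 1 < y := by linarith
    have only : ∀ y', y' < (k : ℝ) + 1 → z 1 < y' → OnlyLev N k y' := by
      intro y' h4 h5
      exact onlyLev_of hk.1 (hk.2.1.imp_right fun h' => h'.trans_lt h5) (Or.inr h4)
    obtain ⟨g, hg1, hg2⟩ := exists_between (hAB (k + 1) k hkN (by omega) (by omega) (by omega))
    have bk := hB (Nat.lt_succ_self k)
    have ak := hA (Nat.lt_succ_self k)
    have lev : ∀ i y', y ≤ y' → y' ≤ k + 1 → Lev N i y' → i ≤ k + 1 ∧ k ≤ i := by
      intro i y' hy3 hy4 hi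
      have l2 : Lev N k y' := ⟨hk.1, hk.2.1.imp_right fun h => by linarith, Or.inr hy4⟩
      refine ⟨hi.le_succ l2, ?_⟩
      by_contra hc
      have hi2 : i + 1 = k := by have := l2.le_succ hi; omega
      rcases hi.2.2 with h | h
      · omega
      have : ((i + 1 : ℕ) : ℝ) = k := by rw [hi2]
      push_cast at this
      rcases hk.2.1 with h5 | h5
      · omega
      · linarith
    have e4 : Escapes X (pt g (k + 1)) := by
      refine ih (k + 1) _ (by omega) ⟨hkN, Or.inr (by simp), Or.inr (by simp)⟩
        ?_ ?_ (by simp; linarith)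
      · refine not_lf_iff.2 fun i hi => ?_
        rw [pt_zero]
        exact (hA.monotone (lev i _ hy1.le le_rfl (by simpa using hi)).1).trans_lt hg1
      · refine not_rt_iff.2 fun i hi => ?_
        rw [pt_zero]
        exact hg2.trans_le (hB.monotone (lev i _ hy1.le le_rfl (by simpa using hi)).2)
    have e3 : Escapes X (pt g y) := by
      refine Escapes.vertical (y := k + 1) (by simpa using e4) fun z' f0 f1 => ?_
      simp only [pt_zero, pt_one] at f0 f1
      rw [Set.uIcc_of_le hy1.le] at f1
      refine hX z' (not_lf_iff.2 fun i hi => ?_) (not_rt_iff.2 fun i hi => ?_) (by linarith [f1.1])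
      · rw [f0]; exact (hA.monotone (lev i _ f1.1 f1.2 hi).1).trans_lt hg1
      · rw [f0]; exact hg2.trans_le (hB.monotone (lev i _ f1.1 f1.2 hi).2)
    have e2 : Escapes X (pt (z 0) y) := by
      refine Escapes.horizontal (x := g) (by simpa using e3) fun z' f0 f1 => ?_
      simp only [pt_zero, pt_one] at f0 f1
      have hu := only y hy1 hy2
      rw [← f0] at hu
      have c1 := h1' k hk
      have c2 := h2' k hk
      rw [Set.mem_uIcc] at f1
      refine hX z' (fun hf => ?_) (fun hf => ?_) (by linarith)
      · have := hu.lf_iff.1 hf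
        rcases f1 with f1 | f1 <;> linarith [f1.1]
      · have := hu.rt_iff.1 hf
        rcases f1 with f1 | f1 <;> linarith [f1.2]
    refine Escapes.vertical (y := y) e2 fun z' f0 f1 => ?_
    rw [Set.uIcc_of_le hy2.le] at f1
    rcases f1.1.lt_or_eq with h | h
    · have hu := only (z' 1) (by linarith [f1.2]) h
      refine hX z' (fun hf => ?_) (fun hf => ?_) (by linarith)
      · have := hu.lf_iff.1 hf
        have := h1' k hk; linarith
      · have := hu.rt_iff.1 hf
        have := h2' k hk; linarith
    · have : z' = z := plane_ext f0 h.symm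
      rw [this]; exact hX z h1 h2 h3

theorem isBounded_between (hA : StrictMono A) (hB : StrictMono B) {s t : ℝ} {S : Set Plane}
    (h : ∀ z ∈ S, Rt N A z ∧ Lf N B z ∧ s ≤ z 1 ∧ z 1 ≤ t) : Bornology.IsBounded S := by
  refine isBounded_of_coord (δ := 1) (M := |A 0| + |B N| + |s| + |t|) one_pos fun z hz => ?_
  obtain ⟨⟨k, hk, h1⟩, ⟨k', hk', h2⟩, h3, h4⟩ := h z hz
  have h5 := (hA.monotone (Nat.zero_le k)).trans h1
  have h6 := h2.trans (hB.monotone hk'.1.le)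
  have b1 := abs_nonneg (A 0)
  have b2 := abs_nonneg (B N)
  have b3 := abs_nonneg s
  have b4 := abs_nonneg t
  simp only [ht, div_one]
  rw [abs_le, abs_le]
  refine ⟨⟨?_, ?_⟩, ?_, ?_⟩
  · linarith [neg_abs_le (A 0)]
  · linarith [le_abs_self (B N)]
  · linarith [neg_abs_le s]
  · linarith [le_abs_self t]

end

section

/-! ### The regions enclosed by walls -/

set_option linter.unusedVariables false in
/-- The closed sets inside and outside of the polygon in `exists_ring_right` meet in the polygon of
`exists_ring`, pointwise. The propositions `dP` and `dQ` stand for being on the left and on the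
right of the wall `D` or on it, and so on. -/
theorem ring_side_logic {dP dQ cP cQ bP bQ aP aQ : Prop} {y s t a b N : ℝ}
   (hd : dP ∨ dQ) (hc : cP ∨ cQ) (hb : bP ∨ bQ) (ha : aP ∨ aQ)
   (hdc : dP → cQ → False) (hcb : cP → bQ → False) (hba : bP → aQ → False)
   (hs : s < 0) (h0a : 0 < a) (hab : a < b) (hbN : b < N) (ht : N < t) :
   ((s ≤ y ∧ y ≤ t ∧ dQ ∧ aP ∧ (y ≤ 0 ∨ N ≤ y ∨ cP ∨ (bQ ∧ (y ≤ a ∨ b ≤ y)))) ∧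
    (y ≤ s ∨ t ≤ y ∨ dP ∨ aQ ∨ ((0 ≤ y ∧ y ≤ N) ∧ cQ ∧ (bP ∨ (a ≤ y ∧ y ≤ b))))) ↔
   ((aP ∧ aQ) ∧ ((s ≤ y ∧ y ≤ a) ∨ (b ≤ y ∧ y ≤ t))) ∨
        ((bP ∧ bQ) ∧ ((0 ≤ y ∧ y ≤ a) ∨ (b ≤ y ∧ y ≤ N))) ∨
        ((cP ∧ cQ) ∧ 0 ≤ y ∧ y ≤ N) ∨ ((dP ∧ dQ) ∧ s ≤ y ∧ y ≤ t) ∨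
        (((aQ ∧ bP) ∨ (bQ ∧ aP)) ∧ (y = a ∨ y = b)) ∨ (((bQ ∧ cP) ∨ (cQ ∧ bP)) ∧ (y = 0 ∨ y = N)) ∨
        (((aQ ∧ dP) ∨ (dQ ∧ aP)) ∧ (y = s ∨ y = t)) := by
  grind (splits := 40)

set_option linter.unusedVariables false in
/-- The analogue of `ring_side_logic` for `exists_ring_mid`. -/
theorem ring_mid_logic {dP dQ cP cQ bP bQ aP aQ : Prop} {y a b N : ℝ}
   (hd : dP ∨ dQ) (hc : cP ∨ cQ) (hb : bP ∨ bQ) (ha : aP ∨ aQ)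
   (hdc : dP → aQ → False) (hcb : aP → bQ → False) (hba : bP → cQ → False)
   (h0a : 0 < a) (hab : a < b) (hbN : b < N)  :
   ((0 ≤ y ∧ y ≤ N ∧ dQ ∧ cP ∧ (aP ∨ bQ ∨ (a ≤ y ∧ y ≤ b))) ∧
    (y ≤ 0 ∨ N ≤ y ∨ dP ∨ cQ ∨ (aQ ∧ bP ∧ (y ≤ a ∨ b ≤ y)))) ↔
   ((aP ∧ aQ) ∧ ((0 ≤ y ∧ y ≤ a) ∨ (b ≤ y ∧ y ≤ N))) ∨
        ((bP ∧ bQ) ∧ ((0 ≤ y ∧ y ≤ a) ∨ (b ≤ y ∧ y ≤ N))) ∨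
        ((cP ∧ cQ) ∧ 0 ≤ y ∧ y ≤ N) ∨ ((dP ∧ dQ) ∧ 0 ≤ y ∧ y ≤ N) ∨
        (((aQ ∧ bP) ∨ (bQ ∧ aP)) ∧ (y = a ∨ y = b)) ∨ (((bQ ∧ cP) ∨ (cQ ∧ bP)) ∧ (y = 0 ∨ y = N)) ∨
        (((aQ ∧ dP) ∨ (dQ ∧ aP)) ∧ (y = 0 ∨ y = N)) := by
  grind (splits := 40)

/-- The polygon `C` together with its inside is the set described by `R`, and the complement of its
inside is the set described by `O`. -/
structure Encloses (C : SimplePolygon) (R O : Plane → Prop) : Prop where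
  or_or : ∀ z, R z ∨ O z
  boundary : ∀ z, z ∈ C.boundary ↔ R z ∧ O z
  inside : ∀ z, z ∈ C.inside ↔ ¬ O z

theorem encloses_of {C : SimplePolygon} {R O : Plane → Prop} (hR : IsClosed {z | R z})
    (hO : IsClosed {z | O z}) (hRO : ∀ z, R z ∨ O z) (hC : ∀ z, z ∈ C.boundary ↔ R z ∧ O z)
    (hb : Bornology.IsBounded {z | R z}) (hesc : ∀ z, ¬ R z → Escapes {z | R z}ᶜ z) :
    Encloses C R O := by
  refine ⟨hRO, hC, fun z => ?_⟩
  rw [SimplePolygon.inside_eq hR hO hRO (by ext z; simpa using hC z) hb (by simpa using hesc)]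
  simp

variable {N : ℕ} {A B C D : ℕ → ℝ} {s t a b : ℝ}

theorem isClosed_height_le (c : ℝ) : IsClosed {z : Plane | z 1 ≤ c} :=
  isClosed_le (by fun_prop) continuous_const

theorem isClosed_le_height (c : ℝ) : IsClosed {z : Plane | c ≤ z 1} :=
  isClosed_le continuous_const (by fun_prop)

theorem exists_block_encloses (hN : 0 < N) (hA : StrictMono A) (hB : StrictMono B)
    (hAB : Sep N A B) (hs : s ≤ 0) (ht : N ≤ t) : ∃ P : SimplePolygon, P.IsOrthogonal ∧
      Encloses P (fun z => s ≤ z 1 ∧ z 1 ≤ t ∧ Rt N A z ∧ Lf N B z)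
        (fun z => z 1 ≤ s ∨ t ≤ z 1 ∨ Lf N A z ∨ Rt N B z) := by
  obtain ⟨P, hP, hb⟩ := exists_block hN hA hB hAB hs ht
  have hst : s < t := by
    have : (0 : ℝ) < N := by exact_mod_cast hN
    linarith
  refine ⟨P, hP, encloses_of ?_ ?_ ?_ ?_ ?_ ?_⟩
  · exact (isClosed_le_height s).and <| (isClosed_height_le t).and <|
      (isClosed_rt A).and (isClosed_lf B)
  · exact isClosed_or (isClosed_height_le s) <| isClosed_or (isClosed_le_height t) <|
      isClosed_or (isClosed_lf A) (isClosed_rt B)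
  · intro z
    have h1 := lf_or_rt hN A z
    have h2 := lf_or_rt hN B z
    grind
  · intro z
    rw [hb]
    have h1 := lf_or_rt hN A z
    have h2 := lf_or_rt hN B z
    have h3 : Lf N A z → Rt N B z → False := hAB.not_rt
    simp only [OnWall, Btw]
    grind
  · exact isBounded_between hA hB (s := s) (t := t) fun z h => ⟨h.2.2.1, h.2.2.2, h.1, h.2.1⟩
  · intro z hz
    by_cases c1 : s ≤ z 1
    swap
    · exact Escapes.down fun z' _ e1 h => c1 (h.1.trans e1)
    by_cases c2 : z 1 ≤ t
    swap
    · exact Escapes.up fun z' _ e1 h => c2 (e1.trans h.2.1)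
    by_cases c3 : Rt N A z
    swap
    · exact Escapes.left fun z' e1 e0 h => not_rt_left c3 e1 e0 h.2.2.1
    · exact Escapes.right fun z' e1 e0 h => not_lf_right (fun h => hz ⟨c1, c2, c3, h⟩) e1 e0 h.2.2.2

theorem lf_of_forall {x : ℝ} {z : Plane} (h : ∀ k < N, A k < x) (hz : x ≤ z 0) : ¬ Lf N A z :=
  not_lf_iff.2 fun k hk => (h k hk.1).trans_le hz

theorem rt_of_forall {x : ℝ} {z : Plane} (h : ∀ k < N, x < A k) (hz : z 0 ≤ x) : ¬ Rt N A z :=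
  not_rt_iff.2 fun k hk => hz.trans_lt (h k hk.1)

/-- A polygon with walls `D`, `C`, `B`, `A` from left to right: the column between `C` and `B` is
connected to the right outside between the heights `a` and `b`. -/
theorem exists_ring_right (hN : 0 < N) (hA : StrictMono A) (hB : StrictMono B) (hC : StrictMono C)
    (hD : StrictMono D) (hDC : Sep N D C) (hCB : Sep N C B) (hBA : Sep N B A) (hDB : Sep N D B)
    (hDA : Sep N D A) (hCA : Sep N C A) {x : ℝ} (hCx : ∀ k < N, C k < x) (hxB : ∀ k < N, x < B k)
    (hs : s < 0) (ht : N < t) {i j : ℕ} (hij : i < j) (hj : j < N) (ha : a = i + 1 / 2)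
    (hb : b = j + 1 / 2) : ∃ P : SimplePolygon, P.IsOrthogonal ∧
      Encloses P (fun z => s ≤ z 1 ∧ z 1 ≤ t ∧ Rt N D z ∧ Lf N A z ∧
          (z 1 ≤ 0 ∨ N ≤ z 1 ∨ Lf N C z ∨ (Rt N B z ∧ (z 1 ≤ a ∨ b ≤ z 1))))
        (fun z => z 1 ≤ s ∨ t ≤ z 1 ∨ Lf N D z ∨ Rt N A z ∨
          ((0 ≤ z 1 ∧ z 1 ≤ N) ∧ Rt N C z ∧ (Lf N B z ∨ (a ≤ z 1 ∧ z 1 ≤ b)))) := by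
  have hij' : (i : ℝ) + 1 ≤ j := by exact_mod_cast hij
  have hj' : (j : ℝ) + 1 ≤ N := by exact_mod_cast hj
  have hi0 : (0 : ℝ) ≤ i := Nat.cast_nonneg i
  have ha0 : 0 < a := by linarith
  have hab : a < b := by linarith
  have hbN : b < N := by linarith
  have hst : s < t := by linarith
  have nDC : ∀ {z}, Lf N D z → Rt N C z → False := hDC.not_rt
  have nCB : ∀ {z}, Lf N C z → Rt N B z → False := hCB.not_rt
  have nBA : ∀ {z}, Lf N B z → Rt N A z → False := hBA.not_rt
  have nDB : ∀ {z}, Lf N D z → Rt N B z → False := hDB.not_rt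
  have nDA : ∀ {z}, Lf N D z → Rt N A z → False := hDA.not_rt
  have nCA : ∀ {z}, Lf N C z → Rt N A z → False := hCA.not_rt
  obtain ⟨P, hP, hbd⟩ := exists_ring hN hA hB hC hD (Or.inr hBA) (Or.inr hCB) (Or.inr hDA)
    (fun z h h' => nBA h'.1 h.2) (fun z h h' => nCA h'.1 h.2) (fun z h h' => nDA h'.1 h.2)
    (fun z h h' => nCB h'.1 h.2) (fun z h h' => nDB h'.1 h.2) (fun z h h' => nDC h'.1 h.2)
    (by
      rintro z (h | h)
      · exact (nBA h.2 h.1).elim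
      · exact ⟨fun h' => nCB h'.1 h.1, fun h' => nDB h'.1 h.1⟩)
    (by
      rintro z (h | h)
      · exact (nCB h.2 h.1).elim
      · exact ⟨fun h' => nBA h.2 h'.2, fun h' => nDC h'.1 h.1⟩)
    hs.le ht.le (Or.inl ⟨hs, ht⟩) hij hj ha hb
  refine ⟨P, hP, encloses_of ?_ ?_ ?_ ?_ ?_ ?_⟩
  · exact (isClosed_le_height s).and <| (isClosed_height_le t).and <|
      (isClosed_rt D).and <| (isClosed_lf A).and <| isClosed_or (isClosed_height_le 0) <|
      isClosed_or (isClosed_le_height N) <| isClosed_or (isClosed_lf C) <| (isClosed_rt B).and <|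
      isClosed_or (isClosed_height_le a) (isClosed_le_height b)
  · exact isClosed_or (isClosed_height_le s) <| isClosed_or (isClosed_le_height t) <|
      isClosed_or (isClosed_lf D) <| isClosed_or (isClosed_rt A) <|
      ((isClosed_le_height 0).and (isClosed_height_le N)).and <| (isClosed_rt C).and <|
      isClosed_or (isClosed_lf B) ((isClosed_le_height a).and (isClosed_height_le b))
  · intro z
    have h1 := lf_or_rt hN A z
    have h2 := lf_or_rt hN B z
    have h3 := lf_or_rt hN C z
    have h4 := lf_or_rt hN D z
    grind
  · intro z
    rw [hbd]
    exact (ring_side_logic (lf_or_rt hN D z) (lf_or_rt hN C z) (lf_or_rt hN B z) (lf_or_rt hN A z)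
      nDC nCB nBA hs ha0 hab hbN ht).symm
  · exact isBounded_between hD hA (s := s) (t := t) fun z h => ⟨h.2.2.1, h.2.2.2.1, h.1, h.2.1⟩
  · intro z hz
    by_cases c1 : s ≤ z 1
    swap
    · exact Escapes.down fun z' _ e1 h => c1 (h.1.trans e1)
    by_cases c2 : z 1 ≤ t
    swap
    · exact Escapes.up fun z' _ e1 h => c2 (e1.trans h.2.1)
    by_cases c3 : Rt N D z
    swap
    · exact Escapes.left fun z' e1 e0 h => not_rt_left c3 e1 e0 h.2.2.1
    by_cases c4 : Lf N A z
    swap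
    · exact Escapes.right fun z' e1 e0 h => not_lf_right c4 e1 e0 h.2.2.2.1
    have c5 : ¬ (z 1 ≤ 0 ∨ N ≤ z 1 ∨ Lf N C z ∨ (Rt N B z ∧ (z 1 ≤ a ∨ b ≤ z 1))) :=
      fun h => hz ⟨c1, c2, c3, c4, h⟩
    simp only [not_or, not_and, not_le] at c5
    obtain ⟨c5, c6, c7, c8⟩ := c5
    -- a point between the heights `a` and `b` escapes to the right
    have key : ∀ z : Plane, ¬ Lf N C z → a < z 1 → z 1 < b →
        Escapes {z | s ≤ z 1 ∧ z 1 ≤ t ∧ Rt N D z ∧ Lf N A z ∧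
          (z 1 ≤ 0 ∨ N ≤ z 1 ∨ Lf N C z ∨ (Rt N B z ∧ (z 1 ≤ a ∨ b ≤ z 1)))}ᶜ z := by
      intro z d1 d2 d3
      refine Escapes.right fun z' e1 e0 h => ?_
      have := not_lf_right d1 e1 e0
      rcases h.2.2.2.2 with h | h | h | ⟨-, h | h⟩
      · linarith
      · linarith
      · exact this h
      · linarith
      · linarith
    by_cases c9 : Rt N B z
    · exact key z c7 (c8 c9).1 (c8 c9).2
    refine Escapes.horizontal (x := x) ?_ ?_
    · refine Escapes.vertical (y := (a + b) / 2) ?_ ?_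
      · refine key _ (lf_of_forall hCx (by simp)) ?_ ?_ <;> rw [pt_one] <;> linarith
      · intro z' e0 e1 h
        simp only [pt_zero, pt_one] at e0 e1
        rw [Set.mem_uIcc] at e1
        have d1 : ¬ Lf N C z' := lf_of_forall hCx e0.ge
        have d2 : ¬ Rt N B z' := rt_of_forall hxB e0.le
        rcases h.2.2.2.2 with h | h | h | h
        · rcases e1 with e1 | e1 <;> linarith
        · rcases e1 with e1 | e1 <;> linarith
        · exact d1 h
        · exact d2 h.1
    · intro z' e1 e0 h
      rw [Set.mem_uIcc] at e0
      rcases h.2.2.2.2 with h | h | h | h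
      · linarith
      · linarith
      · rcases e0 with e0 | e0
        · exact not_lf_right c7 e1 e0.1 h
        · exact lf_of_forall hCx e0.1 h
      · rcases e0 with e0 | e0
        · exact rt_of_forall hxB e0.2 h.1
        · exact not_rt_left c9 e1 e0.2 h.1

/-- The mirror image of `exists_ring_right`: walls `A`, `B`, `C`, `D` from left to right. -/
theorem exists_ring_left (hN : 0 < N) (hA : StrictMono A) (hB : StrictMono B) (hC : StrictMono C)
    (hD : StrictMono D) (hCD : Sep N C D) (hBC : Sep N B C) (hAB : Sep N A B) (hBD : Sep N B D)
    (hAD : Sep N A D) (hAC : Sep N A C) {x : ℝ} (hCx : ∀ k < N, x < C k) (hxB : ∀ k < N, B k < x)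
    (hs : s < 0) (ht : N < t) {i j : ℕ} (hij : i < j) (hj : j < N) (ha : a = i + 1 / 2)
    (hb : b = j + 1 / 2) : ∃ P : SimplePolygon, P.IsOrthogonal ∧
      Encloses P (fun z => s ≤ z 1 ∧ z 1 ≤ t ∧ Lf N D z ∧ Rt N A z ∧
          (z 1 ≤ 0 ∨ N ≤ z 1 ∨ Rt N C z ∨ (Lf N B z ∧ (z 1 ≤ a ∨ b ≤ z 1))))
        (fun z => z 1 ≤ s ∨ t ≤ z 1 ∨ Rt N D z ∨ Lf N A z ∨
          ((0 ≤ z 1 ∧ z 1 ≤ N) ∧ Lf N C z ∧ (Rt N B z ∨ (a ≤ z 1 ∧ z 1 ≤ b)))) := by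
  have hij' : (i : ℝ) + 1 ≤ j := by exact_mod_cast hij
  have hj' : (j : ℝ) + 1 ≤ N := by exact_mod_cast hj
  have hi0 : (0 : ℝ) ≤ i := Nat.cast_nonneg i
  have ha0 : 0 < a := by linarith
  have hab : a < b := by linarith
  have hbN : b < N := by linarith
  have hst : s < t := by linarith
  have nDC : ∀ {z}, Lf N C z → Rt N D z → False := hCD.not_rt
  have nCB : ∀ {z}, Lf N B z → Rt N C z → False := hBC.not_rt
  have nBA : ∀ {z}, Lf N A z → Rt N B z → False := hAB.not_rt
  have nDB : ∀ {z}, Lf N B z → Rt N D z → False := hBD.not_rt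
  have nDA : ∀ {z}, Lf N A z → Rt N D z → False := hAD.not_rt
  have nCA : ∀ {z}, Lf N A z → Rt N C z → False := hAC.not_rt
  obtain ⟨P, hP, hbd⟩ := exists_ring hN hA hB hC hD (Or.inl hAB) (Or.inl hBC) (Or.inl hAD)
    (fun z h h' => nBA h.1 h'.2) (fun z h h' => nCA h.1 h'.2) (fun z h h' => nDA h.1 h'.2)
    (fun z h h' => nCB h.1 h'.2) (fun z h h' => nDB h.1 h'.2) (fun z h h' => nDC h.1 h'.2)
    (by
      rintro z (h | h)
      · exact ⟨fun h' => nCB h.2 h'.2, fun h' => nDB h.2 h'.2⟩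
      · exact (nBA h.2 h.1).elim)
    (by
      rintro z (h | h)
      · exact ⟨fun h' => nBA h'.1 h.1, fun h' => nDC h.2 h'.2⟩
      · exact (nCB h.2 h.1).elim)
    hs.le ht.le (Or.inl ⟨hs, ht⟩) hij hj ha hb
  refine ⟨P, hP, encloses_of ?_ ?_ ?_ ?_ ?_ ?_⟩
  · exact (isClosed_le_height s).and <| (isClosed_height_le t).and <|
      (isClosed_lf D).and <| (isClosed_rt A).and <| isClosed_or (isClosed_height_le 0) <|
      isClosed_or (isClosed_le_height N) <| isClosed_or (isClosed_rt C) <| (isClosed_lf B).and <|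
      isClosed_or (isClosed_height_le a) (isClosed_le_height b)
  · exact isClosed_or (isClosed_height_le s) <| isClosed_or (isClosed_le_height t) <|
      isClosed_or (isClosed_rt D) <| isClosed_or (isClosed_lf A) <|
      ((isClosed_le_height 0).and (isClosed_height_le N)).and <| (isClosed_lf C).and <|
      isClosed_or (isClosed_rt B) ((isClosed_le_height a).and (isClosed_height_le b))
  · intro z
    have h1 := lf_or_rt hN A z
    have h2 := lf_or_rt hN B z
    have h3 := lf_or_rt hN C z
    have h4 := lf_or_rt hN D z
    grind
  · intro z
    rw [hbd]
    have := (ring_side_logic (y := z 1) (lf_or_rt hN D z).symm (lf_or_rt hN C z).symm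
      (lf_or_rt hN B z).symm
      (lf_or_rt hN A z).symm (fun h h' => nDC h' h) (fun h h' => nCB h' h) (fun h h' => nBA h' h)
      hs ha0 hab hbN ht).symm
    have w : ∀ E, OnWall N E z ↔ Rt N E z ∧ Lf N E z := fun E => and_comm
    have v : ∀ E G, Btw N E G z ↔ (Lf N E z ∧ Rt N G z) ∨ (Lf N G z ∧ Rt N E z) := fun E G => by
      constructor <;> rintro (⟨h, h'⟩ | ⟨h, h'⟩)
      exacts [Or.inr ⟨h', h⟩, Or.inl ⟨h', h⟩, Or.inr ⟨h', h⟩, Or.inl ⟨h', h⟩]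
    simpa only [w, v] using this
  · exact isBounded_between hA hD (s := s) (t := t) fun z h => ⟨h.2.2.2.1, h.2.2.1, h.1, h.2.1⟩
  · intro z hz
    by_cases c1 : s ≤ z 1
    swap
    · exact Escapes.down fun z' _ e1 h => c1 (h.1.trans e1)
    by_cases c2 : z 1 ≤ t
    swap
    · exact Escapes.up fun z' _ e1 h => c2 (e1.trans h.2.1)
    by_cases c3 : Lf N D z
    swap
    · exact Escapes.right fun z' e1 e0 h => not_lf_right c3 e1 e0 h.2.2.1
    by_cases c4 : Rt N A z
    swap
    · exact Escapes.left fun z' e1 e0 h => not_rt_left c4 e1 e0 h.2.2.2.1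
    have c5 : ¬ (z 1 ≤ 0 ∨ N ≤ z 1 ∨ Rt N C z ∨ (Lf N B z ∧ (z 1 ≤ a ∨ b ≤ z 1))) :=
      fun h => hz ⟨c1, c2, c3, c4, h⟩
    simp only [not_or, not_and, not_le] at c5
    obtain ⟨c5, c6, c7, c8⟩ := c5
    -- a point between the heights `a` and `b` escapes to the left
    have key : ∀ z : Plane, ¬ Rt N C z → a < z 1 → z 1 < b →
        Escapes {z | s ≤ z 1 ∧ z 1 ≤ t ∧ Lf N D z ∧ Rt N A z ∧
          (z 1 ≤ 0 ∨ N ≤ z 1 ∨ Rt N C z ∨ (Lf N B z ∧ (z 1 ≤ a ∨ b ≤ z 1)))}ᶜ z := by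
      intro z d1 d2 d3
      refine Escapes.left fun z' e1 e0 h => ?_
      have := not_rt_left d1 e1 e0
      rcases h.2.2.2.2 with h | h | h | ⟨-, h | h⟩
      · linarith
      · linarith
      · exact this h
      · linarith
      · linarith
    by_cases c9 : Lf N B z
    · exact key z c7 (c8 c9).1 (c8 c9).2
    refine Escapes.horizontal (x := x) ?_ ?_
    · refine Escapes.vertical (y := (a + b) / 2) ?_ ?_
      · refine key _ (rt_of_forall hCx (by simp)) ?_ ?_ <;> rw [pt_one] <;> linarith
      · intro z' e0 e1 h
        simp only [pt_zero, pt_one] at e0 e1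
        rw [Set.mem_uIcc] at e1
        have d1 : ¬ Rt N C z' := rt_of_forall hCx e0.le
        have d2 : ¬ Lf N B z' := lf_of_forall hxB e0.ge
        rcases h.2.2.2.2 with h | h | h | h
        · rcases e1 with e1 | e1 <;> linarith
        · rcases e1 with e1 | e1 <;> linarith
        · exact d1 h
        · exact d2 h.1
    · intro z' e1 e0 h
      rw [Set.mem_uIcc] at e0
      rcases h.2.2.2.2 with h | h | h | h
      · linarith
      · linarith
      · rcases e0 with e0 | e0
        · exact rt_of_forall hCx e0.2 h
        · exact not_rt_left c7 e1 e0.2 h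
      · rcases e0 with e0 | e0
        · exact not_lf_right c9 e1 e0.1 h.1
        · exact lf_of_forall hxB e0.1 h.1

/-- A polygon with walls `D`, `A`, `B`, `C` from left to right: of the channel between `A` and `B`
only the part between the heights `a` and `b` belongs to the polygon. -/
theorem exists_ring_mid (hN : 0 < N) (hA : StrictMono A) (hB : StrictMono B) (hC : StrictMono C)
    (hD : StrictMono D) (hDA : Sep N D A) (hAB : Sep N A B) (hBC : Sep N B C) (hDB : Sep N D B)
    (hDC : Sep N D C) (hAC : Sep N A C) {i j : ℕ} (hij : i < j) (hj : j < N)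
    (ha : a = i + 1 / 2) (hb : b = j + 1 / 2) : ∃ P : SimplePolygon, P.IsOrthogonal ∧
      Encloses P (fun z => 0 ≤ z 1 ∧ z 1 ≤ N ∧ Rt N D z ∧ Lf N C z ∧
          (Lf N A z ∨ Rt N B z ∨ (a ≤ z 1 ∧ z 1 ≤ b)))
        (fun z => z 1 ≤ 0 ∨ N ≤ z 1 ∨ Lf N D z ∨ Rt N C z ∨
          (Rt N A z ∧ Lf N B z ∧ (z 1 ≤ a ∨ b ≤ z 1))) := by
  have hij' : (i : ℝ) + 1 ≤ j := by exact_mod_cast hij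
  have hj' : (j : ℝ) + 1 ≤ N := by exact_mod_cast hj
  have hi0 : (0 : ℝ) ≤ i := Nat.cast_nonneg i
  have ha0 : 0 < a := by linarith
  have hab : a < b := by linarith
  have hbN : b < N := by linarith
  have nDA : ∀ {z}, Lf N D z → Rt N A z → False := hDA.not_rt
  have nAB : ∀ {z}, Lf N A z → Rt N B z → False := hAB.not_rt
  have nBC : ∀ {z}, Lf N B z → Rt N C z → False := hBC.not_rt
  have nDB : ∀ {z}, Lf N D z → Rt N B z → False := hDB.not_rt
  have nDC : ∀ {z}, Lf N D z → Rt N C z → False := hDC.not_rt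
  have nAC : ∀ {z}, Lf N A z → Rt N C z → False := hAC.not_rt
  obtain ⟨P, hP, hbd⟩ := exists_ring hN hA hB hC hD (Or.inl hAB) (Or.inl hBC) (Or.inr hDA)
    (fun z h h' => nAB h.1 h'.2) (fun z h h' => nAC h.1 h'.2) (fun z h h' => nDA h'.1 h.2)
    (fun z h h' => nBC h.1 h'.2) (fun z h h' => nDB h'.1 h.2) (fun z h h' => nDC h'.1 h.2)
    (by
      rintro z (h | h)
      · exact ⟨fun h' => nBC h.2 h'.2, fun h' => nDA h'.1 h.1⟩
      · exact (nAB h.2 h.1).elim)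
    (by
      rintro z (h | h)
      · exact ⟨fun h' => nAB h'.1 h.1, fun h' => nDB h'.1 h.1⟩
      · exact (nBC h.2 h.1).elim)
    le_rfl le_rfl (Or.inr (by
      rintro z (h | h)
      · exact (nDA h.2 h.1).elim
      · refine ⟨fun h' => nAB h.2 h'.2, fun h' => nAC h.2 h'.2, ?_⟩
        rintro (h' | h')
        · exact nAB h.2 h'.1
        · exact nAC h.2 h'.1)) hij hj ha hb
  refine ⟨P, hP, encloses_of ?_ ?_ ?_ ?_ ?_ ?_⟩
  · exact (isClosed_le_height 0).and <| (isClosed_height_le N).and <| (isClosed_rt D).and <|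
      (isClosed_lf C).and <| isClosed_or (isClosed_lf A) <| isClosed_or (isClosed_rt B) <|
      (isClosed_le_height a).and (isClosed_height_le b)
  · exact isClosed_or (isClosed_height_le 0) <| isClosed_or (isClosed_le_height N) <|
      isClosed_or (isClosed_lf D) <| isClosed_or (isClosed_rt C) <|
      (isClosed_rt A).and <| (isClosed_lf B).and <|
      isClosed_or (isClosed_height_le a) (isClosed_le_height b)
  · intro z
    have h1 := lf_or_rt hN A z
    have h2 := lf_or_rt hN B z
    have h3 := lf_or_rt hN C z
    have h4 := lf_or_rt hN D z
    grind
  · intro z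
    rw [hbd]
    exact (ring_mid_logic (lf_or_rt hN D z) (lf_or_rt hN C z) (lf_or_rt hN B z) (lf_or_rt hN A z)
      nDA nAB nBC ha0 hab hbN).symm
  · exact isBounded_between hD hC (s := 0) (t := N) fun z h => ⟨h.2.2.1, h.2.2.2.1, h.1, h.2.1⟩
  · have low : ∀ z : Plane, z 1 < 0 → Escapes {z | 0 ≤ z 1 ∧ z 1 ≤ N ∧ Rt N D z ∧ Lf N C z ∧
          (Lf N A z ∨ Rt N B z ∨ (a ≤ z 1 ∧ z 1 ≤ b))}ᶜ z := fun z hz =>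
      Escapes.down fun z' _ e1 h => absurd h.1 (by linarith)
    have high : ∀ z : Plane, N < z 1 → Escapes {z | 0 ≤ z 1 ∧ z 1 ≤ N ∧ Rt N D z ∧ Lf N C z ∧
          (Lf N A z ∨ Rt N B z ∨ (a ≤ z 1 ∧ z 1 ≤ b))}ᶜ z := fun z hz =>
      Escapes.up fun z' _ e1 h => absurd h.2.1 (by linarith)
    intro z hz
    by_cases c1 : 0 ≤ z 1
    swap
    · exact low z (not_le.1 c1)
    by_cases c2 : z 1 ≤ N
    swap
    · exact high z (not_le.1 c2)
    by_cases c3 : Rt N D z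
    swap
    · exact Escapes.left fun z' e1 e0 h => not_rt_left c3 e1 e0 h.2.2.1
    by_cases c4 : Lf N C z
    swap
    · exact Escapes.right fun z' e1 e0 h => not_lf_right c4 e1 e0 h.2.2.2.1
    have c5 : ¬ (Lf N A z ∨ Rt N B z ∨ (a ≤ z 1 ∧ z 1 ≤ b)) := fun h => hz ⟨c1, c2, c3, c4, h⟩
    simp only [not_or, not_and, not_le] at c5
    obtain ⟨c5, c6, c7⟩ := c5
    obtain ⟨k, hk⟩ := exists_lev hN (z 1)
    rcases lt_or_ge (z 1) a with h | h
    · refine channel_escape_down hA hB hAB (h := a) ?_ low k z hk c5 c6 h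
      rintro z' d1 d2 d3 ⟨-, -, -, -, h | h | h⟩
      · exact d1 h
      · exact d2 h
      · linarith
    · have hk' := hk.1
      refine channel_escape_up hA hB hAB (h := b) ?_ high (N - 1 - k) k z (by omega) hk c5 c6 (c7 h)
      rintro z' d1 d2 d3 ⟨-, -, -, -, h | h | h⟩
      · exact d1 h
      · exact d2 h
      · linarith

end

section

/-! ### The zigzag scenes -/

/-- The unit of the horizontal displacements of the walls, so small that the corridors stay in
disjoint vertical strips of width `1 / 2`. -/
noncomputable def disp (N : ℕ) : ℝ := 1 / (8 * (N + 1) ^ 2)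

/-- The left wall of corridor `j`. -/
noncomputable def lwall (N j k : ℕ) : ℝ := j + 2 * disp N * k ^ 2

/-- The right wall of corridor `j`. At the height `k`, the points of the corridor have abscissas
between `lwall N j k` and `rwall N j (k - 1) = lwall N j k + disp N`. -/
noncomputable def rwall (N j k : ℕ) : ℝ := j + 2 * disp N * (k + 1) ^ 2 + disp N

theorem disp_pos (N : ℕ) : 0 < disp N := by unfold disp; positivity

theorem disp_mul (N : ℕ) : disp N * (N + 1) ^ 2 = 1 / 8 := by
  unfold disp
  have : (0 : ℝ) < (N + 1) ^ 2 := by positivity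
  field_simp

variable {N : ℕ}

theorem strictMono_lwall (j : ℕ) : StrictMono (lwall N j) := by
  intro k k' h
  have h1 : (k : ℝ) < k' := by exact_mod_cast h
  have h2 : (k : ℝ) ^ 2 < k' ^ 2 := by gcongr
  have := disp_pos N
  unfold lwall; nlinarith

theorem strictMono_rwall (j : ℕ) : StrictMono (rwall N j) := by
  intro k k' h
  have h1 : (k : ℝ) < k' := by exact_mod_cast h
  have h2 : ((k : ℝ) + 1) ^ 2 < (k' + 1) ^ 2 := by gcongr
  have := disp_pos N
  unfold rwall; nlinarith

theorem le_lwall (j k : ℕ) : (j : ℝ) ≤ lwall N j k := by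
  have := disp_pos N
  unfold lwall
  have : 0 ≤ 2 * disp N * (k : ℝ) ^ 2 := by positivity
  linarith

theorem lwall_le_rwall (j k : ℕ) : lwall N j k ≤ rwall N j k := by
  have := disp_pos N
  unfold lwall rwall
  have : (k : ℝ) ^ 2 ≤ (k + 1) ^ 2 := by gcongr; linarith
  nlinarith

theorem rwall_le (j : ℕ) {k : ℕ} (hk : k < N) : rwall N j k ≤ j + 3 / 8 := by
  have h0 := disp_pos N
  have h1 : (k : ℝ) + 1 ≤ N + 1 := by
    have : (k : ℝ) < N := by exact_mod_cast hk
    linarith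
  have h2 : ((k : ℝ) + 1) ^ 2 ≤ (N + 1) ^ 2 := by gcongr
  have h3 := disp_mul N
  have h4 : (1 : ℝ) ≤ (N + 1) ^ 2 := by
    have : (0 : ℝ) ≤ N := Nat.cast_nonneg N
    nlinarith
  unfold rwall; nlinarith

theorem sep_of_le {A B : ℕ → ℝ} (x : ℝ) (hA : ∀ k < N, A k ≤ x) (hB : ∀ k < N, x < B k) :
    Sep N A B := fun k k' hk hk' _ _ => (hA k hk).trans_lt (hB k' hk')

theorem sep_lwall_rwall (j : ℕ) : Sep N (lwall N j) (rwall N j) := by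
  intro k k' _ _ h _
  have h1 : (k : ℝ) ≤ k' + 1 := by exact_mod_cast h
  have h2 : (k : ℝ) ^ 2 ≤ (k' + 1) ^ 2 := by gcongr
  have := disp_pos N
  unfold lwall rwall; nlinarith

theorem lt_walls {j j' : ℕ} (h : j < j') (k : ℕ) : (j : ℝ) + 1 / 2 < lwall N j' k ∧
    (j : ℝ) + 1 / 2 < rwall N j' k := by
  have h1 : (j : ℝ) + 1 ≤ j' := by exact_mod_cast h
  have h2 := le_lwall (N := N) j' k
  have h3 := lwall_le_rwall (N := N) j' k
  constructor <;> linarith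

theorem walls_lt (j : ℕ) {k : ℕ} (h : k < N) : lwall N j k < (j : ℝ) + 1 / 2 ∧
    rwall N j k < (j : ℝ) + 1 / 2 := by
  have h2 := rwall_le j h
  have h3 := lwall_le_rwall (N := N) j k
  constructor <;> linarith

theorem sep_walls {j j' : ℕ} (h : j < j') : Sep N (lwall N j) (lwall N j') ∧
    Sep N (lwall N j) (rwall N j') ∧ Sep N (rwall N j) (lwall N j') ∧
    Sep N (rwall N j) (rwall N j') :=
  ⟨sep_of_le (j + 1 / 2) (fun _ h => (walls_lt j h).1.le) (fun _ _ => (lt_walls h _).1),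
    sep_of_le (j + 1 / 2) (fun _ h => (walls_lt j h).1.le) (fun _ _ => (lt_walls h _).2),
    sep_of_le (j + 1 / 2) (fun _ h => (walls_lt j h).2.le) (fun _ _ => (lt_walls h _).1),
    sep_of_le (j + 1 / 2) (fun _ h => (walls_lt j h).2.le) (fun _ _ => (lt_walls h _).2)⟩

/-- The point lies between the walls of corridor `j`. -/
def Corr (N j : ℕ) (z : Plane) : Prop := Rt N (lwall N j) z ∧ Lf N (rwall N j) z

/-- The free space of the scene in which corridor `j` is blocked between the heights `a` and `b`:
a bottom room, a top room, and three zigzag corridors which connect them. -/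
def Free (N j : ℕ) (a b : ℝ) (z : Plane) : Prop :=
  (-1 ≤ z 1 ∧ z 1 ≤ N + 1) ∧ Rt N (lwall N 0) z ∧ Lf N (rwall N 2) z ∧
    (z 1 ≤ 0 ∨ N ≤ z 1 ∨ ∃ i < 3, Corr N i z ∧ (i = j → z 1 ≤ a ∨ b ≤ z 1))

/-- The points of the free space that lie here are the boundary points. -/
def Solid (N j : ℕ) (a b : ℝ) (z : Plane) : Prop :=
  z 1 ≤ -1 ∨ N + 1 ≤ z 1 ∨ Lf N (lwall N 0) z ∨ Rt N (rwall N 2) z ∨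
    ((0 ≤ z 1 ∧ z 1 ≤ N) ∧ ((Rt N (rwall N 0) z ∧ Lf N (lwall N 1) z) ∨
      (Rt N (rwall N 1) z ∧ Lf N (lwall N 2) z) ∨ (Corr N j z ∧ a ≤ z 1 ∧ z 1 ≤ b)))

theorem exists_lt_three {p : ℕ → Prop} : (∃ i < 3, p i) ↔ p 0 ∨ p 1 ∨ p 2 := by
  constructor
  · rintro ⟨i, hi, h⟩
    interval_cases i <;> simp [h]
  · rintro (h | h | h)
    exacts [⟨0, by norm_num, h⟩, ⟨1, by norm_num, h⟩, ⟨2, by norm_num, h⟩]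

/-- A scene from an outer polygon and a hole, each given by two closed sets as in `Encloses`, whose
region is described by `F`, and the boundary points in it by `B`. -/
theorem exists_orthogonal_scene {O H : SimplePolygon} {R S R' S' F B : Plane → Prop}
    (hO : O.IsOrthogonal) (hH : H.IsOrthogonal) (eO : Encloses O R S) (eH : Encloses H R' S')
    (hin : ∀ z, R' z → ¬ S z) (hF : ∀ z, F z ↔ R z ∧ S' z)
    (hB : ∀ z, F z → (B z ↔ S z ∨ R' z)) {s : Plane} (hs : F s) (hs' : S s) :
    ∃ P : Scene, P.IsOrthogonal ∧ (∀ z, z ∈ P.region ↔ F z) ∧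
      (∀ z, z ∈ P.outer.boundary ∪ P.holeBoundary ↔ F z ∧ B z) ∧ P.start = s := by
  refine ⟨⟨O, some H, ?_, s, (eO.boundary s).2 ⟨((hF s).1 hs).1, hs'⟩⟩, ⟨hO, ?_⟩, fun z => ?_,
    fun z => ?_, rfl⟩
  · rintro H' hH' z hz
    obtain rfl : H = H' := by simpa using hH'
    exact (eO.inside z).2 (hin z ((eH.boundary z).1 hz).1)
  · rintro H' hH'
    obtain rfl : H = H' := by simpa using hH'
    exact hH
  · have h1 := eO.or_or z
    simp [Scene.region, eO.inside, eO.boundary, eH.inside, hF]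
    tauto
  · have h1 := eO.or_or z
    have h2 := eH.or_or z
    have h3 := hin z
    have h4 := hB z
    have h5 := hF z
    simp [Scene.holeBoundary, eO.boundary, eH.boundary]
    tauto

/-- The column of the blocked corridor belongs to the outer polygon if the corridor is the left or
the right one, and the other column is the hole. If the corridor in the middle is blocked, the hole
consists of both columns and the block. -/
theorem exists_zigzag_scene {j i i' : ℕ} (hj : j < 3) (hi : i < i') (hi' : i' < N) {a b : ℝ}
    (ha : a = i + 1 / 2) (hb : b = i' + 1 / 2) : ∃ P : Scene, P.IsOrthogonal ∧
      (∀ z, z ∈ P.region ↔ Free N j a b z) ∧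
      (∀ z, z ∈ P.outer.boundary ∪ P.holeBoundary ↔ Free N j a b z ∧ Solid N j a b z) ∧
      P.start = pt 0 (-1) := by
  have hN : 0 < N := by omega
  have hN' : (0 : ℝ) < N := by exact_mod_cast hN
  have s01 := sep_walls (N := N) (show 0 < 1 by norm_num)
  have s02 := sep_walls (N := N) (show 0 < 2 by norm_num)
  have s12 := sep_walls (N := N) (show 1 < 2 by norm_num)
  have s0 := sep_lwall_rwall (N := N) 0
  have s1 := sep_lwall_rwall (N := N) 1
  have s2 := sep_lwall_rwall (N := N) 2
  have hij' : (i : ℝ) + 1 ≤ i' := by exact_mod_cast hi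
  have hj' : (i' : ℝ) + 1 ≤ N := by exact_mod_cast hi'
  have hi0 : (0 : ℝ) ≤ i := Nat.cast_nonneg i
  have ha0 : 0 < a := by linarith
  have hab : a < b := by linarith
  have hbN : b < N := by linarith
  have hs0 : OnlyLev N 0 ((pt 0 (-1) : Plane) 1) := onlyLev_low hN (by simp)
  have e0 : lwall N 0 0 = 0 := by simp [lwall]
  have e2 : (0 : ℝ) ≤ rwall N 2 0 := by
    have := (lt_walls (N := N) (show 0 < 2 by norm_num) 0).2
    push_cast at this; linarith
  have hst : Rt N (lwall N 0) (pt 0 (-1)) := hs0.rt_iff.2 (by simp [e0])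
  have hst' : Lf N (lwall N 0) (pt 0 (-1)) := hs0.lf_iff.2 (by simp [e0])
  have hst2 : Lf N (rwall N 2) (pt 0 (-1)) := hs0.lf_iff.2 (by simpa using e2)
  have hFs : Free N j a b (pt 0 (-1)) :=
    ⟨⟨by simp, by simp; linarith⟩, hst, hst2, Or.inl (by simp)⟩
  have m0 := strictMono_lwall (N := N) 0
  have m1 := strictMono_lwall (N := N) 1
  have m2 := strictMono_lwall (N := N) 2
  have n0 := strictMono_rwall (N := N) 0
  have n1 := strictMono_rwall (N := N) 1
  have n2 := strictMono_rwall (N := N) 2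
  have h0 := fun z => lf_or_rt hN (lwall N 0) z
  have h1 := fun z => lf_or_rt hN (lwall N 1) z
  have h2 := fun z => lf_or_rt hN (lwall N 2) z
  have k0 := fun z => lf_or_rt hN (rwall N 0) z
  have k1 := fun z => lf_or_rt hN (rwall N 1) z
  have k2 := fun z => lf_or_rt hN (rwall N 2) z
  have c0 : ∀ {z}, Lf N (lwall N 0) z → Rt N (rwall N 0) z → False := s0.not_rt
  have c1 : ∀ {z}, Lf N (lwall N 1) z → Rt N (rwall N 1) z → False := s1.not_rt
  have c2 : ∀ {z}, Lf N (lwall N 2) z → Rt N (rwall N 2) z → False := s2.not_rt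
  have d0 : ∀ {z}, Lf N (rwall N 0) z → Rt N (lwall N 1) z → False := s01.2.2.1.not_rt
  have d1 : ∀ {z}, Lf N (rwall N 1) z → Rt N (lwall N 2) z → False := s12.2.2.1.not_rt
  interval_cases j
  · obtain ⟨O, hO, eO⟩ := exists_ring_left (s := -1) (t := N + 1) hN m0 n0 m1 n2
      s12.2.1 s01.2.2.1 s0 s02.2.2.2 s02.2.1 s01.1
      (x := 0 + 1 / 2) (fun k hk => by simpa using (lt_walls (show 0 < 1 by norm_num) k).1)
      (fun k hk => by simpa using (walls_lt 0 hk).2) (by norm_num) (by linarith)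
      hi hi' ha hb
    obtain ⟨H, hH, eH⟩ := exists_block_encloses (s := 0) (t := N) hN n1 m2 s12.2.2.1 le_rfl le_rfl
    refine exists_orthogonal_scene hO hH eO eH ?_ ?_ ?_ hFs (Or.inl (by simp))
    all_goals
      intro z
      have h0 := h0 z; have h1 := h1 z; have h2 := h2 z
      have k0 := k0 z; have k1 := k1 z; have k2 := k2 z
      have c0 := @c0 z; have c1 := @c1 z; have c2 := @c2 z; have d0 := @d0 z; have d1 := @d1 z
      simp only [Free, Solid, exists_lt_three, Corr]
      clear eO eH
      grind (splits := 40)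
  · obtain ⟨O, hO, eO⟩ := exists_block_encloses (s := -1) (t := N + 1) hN m0 n2 s02.2.1
      (by norm_num) (by linarith)
    obtain ⟨H, hH, eH⟩ := exists_ring_mid hN m1 n1 m2 n0 s01.2.2.1 s1 s12.2.2.1 s01.2.2.2 s02.2.2.1
      s12.1 hi hi' ha hb
    refine exists_orthogonal_scene hO hH eO eH ?_ ?_ ?_ hFs (Or.inl (by simp))
    all_goals
      intro z
      have h0 := h0 z; have h1 := h1 z; have h2 := h2 z
      have k0 := k0 z; have k1 := k1 z; have k2 := k2 z
      have c0 := @c0 z; have c1 := @c1 z; have c2 := @c2 z; have d0 := @d0 z; have d1 := @d1 z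
      simp only [Free, Solid, exists_lt_three, Corr]
      clear eO eH
      grind (splits := 40)
  · obtain ⟨O, hO, eO⟩ := exists_ring_right (s := -1) (t := N + 1) hN n2 m2 n1 m0
      s01.2.1 s12.2.2.1 s2 s02.1 s02.2.1 s12.2.2.2
      (x := 1 + 1 / 2) (fun k hk => by simpa using (walls_lt 1 hk).2)
      (fun k hk => by simpa using (lt_walls (show 1 < 2 by norm_num) k).1)
      (by norm_num) (by linarith)
      hi hi' ha hb
    obtain ⟨H, hH, eH⟩ := exists_block_encloses (s := 0) (t := N) hN n0 m1 s01.2.2.1 le_rfl le_rfl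
    refine exists_orthogonal_scene hO hH eO eH ?_ ?_ ?_ hFs (Or.inl (by simp))
    all_goals
      intro z
      have h0 := h0 z; have h1 := h1 z; have h2 := h2 z
      have k0 := k0 z; have k1 := k1 z; have k2 := k2 z
      have c0 := @c0 z; have c1 := @c1 z; have c2 := @c2 z; have d0 := @d0 z; have d1 := @d1 z
      simp only [Free, Solid, exists_lt_three, Corr]
      clear eO eH
      grind (splits := 40)

end

section

/-! ### What can be seen in a zigzag corridor -/

variable {N j i : ℕ} {a b : ℝ} {x z w : Plane}

theorem Corr.bounds (h : Corr N i z) : (i : ℝ) ≤ z 0 ∧ z 0 ≤ i + 3 / 8 := by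
  obtain ⟨⟨k, hk, h1⟩, ⟨k', hk', h2⟩⟩ := h
  exact ⟨(le_lwall i k).trans h1, h2.trans (rwall_le i hk'.1)⟩

theorem Corr.unique {i' : ℕ} (h : Corr N i z) (h' : (i' : ℝ) ≤ z 0 ∧ z 0 ≤ i' + 1 / 2) :
    i = i' := by
  have h1 := h.bounds
  have h3 : (i : ℝ) < i' + 1 := by linarith
  have h4 : (i' : ℝ) < i + 1 := by linarith
  have h3 : i < i' + 1 := by exact_mod_cast h3
  have h4 : i' < i + 1 := by exact_mod_cast h4
  omega

theorem Free.corr (h : Free N j a b z) (h0 : 0 < z 1) (hN : z 1 < N) :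
    ∃ i < 3, Corr N i z ∧ (i = j → z 1 ≤ a ∨ b ≤ z 1) := by
  rcases h.2.2.2 with h | h | h
  · linarith
  · linarith
  · exact h

theorem lt_affine {t l p q : ℝ} (t0 : 0 ≤ t) (t1 : t ≤ 1) (hp : l < p) (hq : l < q) :
    l < p + t * (q - p) := by
  rcases le_total p q with h | h
  · have := mul_nonneg t0 (sub_nonneg.2 h); linarith
  · have := mul_le_mul_of_nonneg_right t1 (sub_nonneg.2 h); linarith

theorem affine_lt {t l p q : ℝ} (t0 : 0 ≤ t) (t1 : t ≤ 1) (hp : p < l) (hq : q < l) :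
    p + t * (q - p) < l := by
  have := lt_affine t0 t1 (neg_lt_neg hp) (neg_lt_neg hq)
  linarith

/-- A segment at heights strictly between the rooms cannot change the corridor. -/
theorem Corr.of_segment (hx : Corr N i x) (h : ∀ z ∈ segment ℝ x w, Free N j a b z)
    (x0 : 0 < x 1) (xN : x 1 < N) (w0 : 0 < w 1) (wN : w 1 < N) : Corr N i w := by
  obtain ⟨i', hi', hw, -⟩ := (h w (right_mem_segment _ _ _)).corr w0 wN
  by_cases hii : i = i'
  · rwa [hii]
  exfalso
  have bx := hx.bounds
  have bw := hw.bounds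
  have key : ∀ m : ℕ, (x 0 < m + 1 / 2 ∧ m + 1 / 2 < w 0) ∨ (w 0 < m + 1 / 2 ∧ m + 1 / 2 < x 0) →
      False := by
    intro m hm
    have hne : w 0 - x 0 ≠ 0 := by
      rcases hm with hm | hm
      · have : 0 < w 0 - x 0 := by linarith
        exact this.ne'
      · have : w 0 - x 0 < 0 := by linarith
        exact this.ne
    set t := (m + 1 / 2 - x 0) / (w 0 - x 0) with ht
    have ht' : t * (w 0 - x 0) = m + 1 / 2 - x 0 := div_mul_cancel₀ _ hne
    have t0 : 0 ≤ t := by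
      rcases hm with hm | hm
      · exact div_nonneg (by linarith) (by linarith)
      · exact div_nonneg_of_nonpos (by linarith) (by linarith)
    have t1 : t ≤ 1 := by
      by_contra hlt
      rcases hm with hm | hm <;> nlinarith
    have hv := h (pt (m + 1 / 2) (x 1 + t * (w 1 - x 1)))
      (mem_segment_plane.2 ⟨t, t0, t1, by simp; linarith, by simp⟩)
    obtain ⟨i'', -, hc, -⟩ := hv.corr (by simpa using lt_affine t0 t1 x0 w0)
      (by simpa using affine_lt t0 t1 xN wN)
    have hb := hc.bounds
    simp only [pt_zero] at hb
    have h1 : (i'' : ℝ) < m + 1 := by linarith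
    have h2 : (m : ℝ) < i'' := by linarith
    have h1 : i'' < m + 1 := by exact_mod_cast h1
    have h2 : m < i'' := by exact_mod_cast h2
    omega
  rcases lt_or_gt_of_ne hii with hlt | hlt
  · have : (i : ℝ) + 1 ≤ i' := by exact_mod_cast hlt
    exact key i (Or.inl ⟨by linarith, by linarith⟩)
  · have : (i' : ℝ) + 1 ≤ i := by exact_mod_cast hlt
    exact key i' (Or.inr ⟨by linarith, by linarith⟩)

theorem affine_le_of_Ioo {p q l m m' : ℝ} (hm : m < m') (h : ∀ y, m < y → y < m' → l ≤ p + q * y) :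
    l ≤ p + q * m ∧ l ≤ p + q * m' := by
  have hc : IsClosed {y : ℝ | l ≤ p + q * y} := isClosed_le continuous_const (by fun_prop)
  have := hc.closure_subset_iff.2 (fun y (hy : y ∈ Set.Ioo m m') => h y hy.1 hy.2)
  rw [closure_Ioo hm.ne] at this
  exact ⟨this ⟨le_rfl, hm.le⟩, this ⟨hm.le, le_rfl⟩⟩

/-- A segment in the free space cannot pass three consecutive gates: the abscissas of the gates
have a second difference of `4 * disp N`, the gates have width `disp N`. -/
theorem not_three_gates {k : ℕ} (hk : 1 ≤ k) (hkN : k + 3 ≤ N) (hx : x 1 < k) (hw : k + 2 < w 1)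
    (h : ∀ z ∈ segment ℝ x w, Free N j a b z) : False := by
  have hkN' : (k : ℝ) + 3 ≤ N := by exact_mod_cast hkN
  have hk' : (1 : ℝ) ≤ k := by exact_mod_cast hk
  set q := (w 0 - x 0) / (w 1 - x 1) with hq
  set p := x 0 - q * x 1 with hp
  have hd : 0 < w 1 - x 1 := by linarith
  have hq' : q * (w 1 - x 1) = w 0 - x 0 := div_mul_cancel₀ _ hd.ne'
  have seg : ∀ y, x 1 ≤ y → y ≤ w 1 → pt (p + q * y) y ∈ segment ℝ x w := by
    intro y h1 h2
    refine mem_segment_plane.2 ⟨(y - x 1) / (w 1 - x 1), div_nonneg (by linarith) hd.le, ?_, ?_, ?_⟩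
    · rw [div_le_one hd]; linarith
    · simp only [pt_zero]; rw [← hq', hp]; field_simp; ring
    · simp only [pt_one]; field_simp; ring
  obtain ⟨i, -, hi, -⟩ := (h _ (seg k (by linarith) (by linarith))).corr (by simp; linarith)
    (by simp; linarith)
  have corr : ∀ y, x 1 < y → y < w 1 → 0 < y → y < N → Corr N i (pt (p + q * y) y) := by
    intro y h1 h2 h3 h4
    refine hi.of_segment (j := j) (a := a) (b := b) (fun z hz => h z ?_) (by simp; linarith)
      (by simp; linarith) (by simpa) (by simpa)
    exact (convex_segment x w).segment_subset (seg k (by linarith) (by linarith))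
      (seg y h1.le h2.le) hz
  have up : ∀ m : ℕ, m < N → x 1 < m → (m : ℝ) < w 1 → 1 ≤ m →
      (i : ℝ) + 2 * disp N * m ^ 2 ≤ p + q * m := by
    intro m h1 h2 h3 h4
    have h1' : (m : ℝ) + 1 ≤ N := by exact_mod_cast h1
    have h4' : (1 : ℝ) ≤ m := by exact_mod_cast h4
    refine (affine_le_of_Ioo (m' := min (m + 1) (w 1)) (lt_min (by linarith) h3) ?_).1
    intro y y1 y2
    have y3 := y2.trans_le (min_le_left _ _)
    have hc := corr y (by linarith) (y2.trans_le (min_le_right _ _)) (by linarith) (by linarith)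
    have ho : OnlyLev N m ((pt (p + q * y) y : Plane) 1) :=
      onlyLev_of h1 (Or.inr (by simpa)) (Or.inr (by simpa))
    have := ho.rt_iff.1 hc.1
    simpa [lwall] using this
  have down : ∀ m : ℕ, m < N → x 1 < m → (m : ℝ) < w 1 → 1 ≤ m →
      p + q * m ≤ (i : ℝ) + 2 * disp N * m ^ 2 + disp N := by
    intro m h1 h2 h3 h4
    have h1' : (m : ℝ) + 1 ≤ N := by exact_mod_cast h1
    have h4' : (1 : ℝ) ≤ m := by exact_mod_cast h4
    have h5 : ((m - 1 : ℕ) : ℝ) = m - 1 := by rw [Nat.cast_sub h4]; simp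
    have := (affine_le_of_Ioo (p := -p) (q := -q) (l := -(i + 2 * disp N * m ^ 2 + disp N))
      (m := max (m - 1) (x 1)) (m' := m) (max_lt (by linarith) h2) ?_).2
    · linarith
    intro y y1 y2
    have y3 := (le_max_left _ _).trans_lt y1
    have hc := corr y ((le_max_right _ _).trans_lt y1) (by linarith) (by linarith) (by linarith)
    have ho : OnlyLev N (m - 1) ((pt (p + q * y) y : Plane) 1) :=
      onlyLev_of (by omega) (Or.inr (by simp [h5]; linarith)) (Or.inr (by simpa [h5]))
    have := ho.lf_iff.1 hc.2
    simp only [rwall, h5, pt_zero, sub_add_cancel] at this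
    linarith
  have e1 := up k (by omega) hx (by linarith) hk
  have e2 := down (k + 1) (by omega) (by push_cast; linarith) (by push_cast; linarith) (by omega)
  have e3 := up (k + 2) (by omega) (by push_cast; linarith) (by push_cast; linarith) (by omega)
  have hd := disp_pos N
  push_cast at e2 e3
  nlinarith

/-- The part of strip `j` from which points of corridor `j` between the heights `a` and `b` may
possibly be seen. -/
def Zone (j : ℕ) (a b : ℝ) (z : Plane) : Prop :=
  ((j : ℝ) ≤ z 0 ∧ z 0 ≤ j + 1 / 2) ∧ a - 3 ≤ z 1 ∧ z 1 ≤ b + 3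

theorem isClosed_zone (j : ℕ) (a b : ℝ) : IsClosed {z | Zone j a b z} :=
  ((isClosed_le continuous_const (by fun_prop)).and
    (isClosed_le (by fun_prop) continuous_const)).and ((isClosed_le_height _).and (isClosed_height_le _))

/-- Whoever sees a point of corridor `j'` is in its zone: otherwise the line of sight would pass
three consecutive gates. The corridor may be any one, not just the blocked corridor `j`. -/
theorem zone_of_sees {j' i₁ i₂ : ℕ} (h1 : 4 ≤ i₁) (h2 : i₂ + 4 ≤ N)
    (h : ∀ z ∈ segment ℝ x w, Free N j a b z) (hw : Corr N j' w) (hwa : i₁ + 1 / 2 ≤ w 1)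
    (hwb : w 1 ≤ i₂ + 1 / 2) : Zone j' (i₁ + 1 / 2) (i₂ + 1 / 2) x ∧ Corr N j' x := by
  have h1' : (4 : ℝ) ≤ i₁ := by exact_mod_cast h1
  have h2' : (i₂ : ℝ) + 4 ≤ N := by exact_mod_cast h2
  have hi : (i₁ : ℝ) < i₂ + 1 := by linarith
  have hi : i₁ < i₂ + 1 := by exact_mod_cast hi
  have up : x 1 ≤ i₂ + 1 / 2 + 3 := by
    by_contra hc
    rw [segment_symm] at h
    exact not_three_gates (k := i₂ + 1) (by omega) (by omega) (by push_cast; linarith)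
      (by push_cast; linarith) h
  have down : i₁ + 1 / 2 - 3 ≤ x 1 := by
    by_contra hc
    refine not_three_gates (k := i₁ - 2) (by omega) (by omega) ?_ ?_ h
    · rw [Nat.cast_sub (by omega)]; push_cast; linarith
    · rw [Nat.cast_sub (by omega)]; push_cast; linarith
  have hc : Corr N j' x := hw.of_segment (segment_symm ℝ x w ▸ h) (by linarith) (by linarith)
    (by linarith) (by linarith)
  exact ⟨⟨⟨hc.bounds.1, by linarith [hc.bounds.2]⟩, down, up⟩, hc⟩

theorem Free.congr {j' : ℕ} {a' b' : ℝ} (h : Free N j a b z)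
    (h' : ¬ (Corr N j' z ∧ a' ≤ z 1 ∧ z 1 ≤ b')) : Free N j' a' b' z := by
  refine ⟨h.1, h.2.1, h.2.2.1, ?_⟩
  rcases h.2.2.2 with h1 | h1 | ⟨i, hi, h1, -⟩
  · exact Or.inl h1
  · exact Or.inr (Or.inl h1)
  · refine Or.inr (Or.inr ⟨i, hi, h1, ?_⟩)
    rintro rfl
    by_contra hc
    rw [not_or, not_le, not_le] at hc
    exact h' ⟨h1, hc.1.le, hc.2.le⟩

theorem Solid.congr {j' : ℕ} {a' b' : ℝ} (h : Solid N j a b z)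
    (h' : ¬ (Corr N j z ∧ a ≤ z 1 ∧ z 1 ≤ b)) : Solid N j' a' b' z := by
  rcases h with h | h | h | h | ⟨h, h1 | h1 | h1⟩
  · exact Or.inl h
  · exact Or.inr (Or.inl h)
  · exact Or.inr (Or.inr (Or.inl h))
  · exact Or.inr (Or.inr (Or.inr (Or.inl h)))
  · exact Or.inr (Or.inr (Or.inr (Or.inr ⟨h, Or.inl h1⟩)))
  · exact Or.inr (Or.inr (Or.inr (Or.inr ⟨h, Or.inr (Or.inl h1)⟩)))
  · exact (h' h1).elim

/-- `P` is the zigzag scene in which corridor `j` is blocked between the heights `i₁ + 1 / 2` and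
`i₂ + 1 / 2`. -/
structure IsZigzag (N j i₁ i₂ : ℕ) (P : Scene) : Prop where
  orthogonal : P.IsOrthogonal
  mem_region : ∀ z, z ∈ P.region ↔ Free N j (i₁ + 1 / 2) (i₂ + 1 / 2) z
  mem_boundary : ∀ z, z ∈ P.outer.boundary ∪ P.holeBoundary ↔
    Free N j (i₁ + 1 / 2) (i₂ + 1 / 2) z ∧ Solid N j (i₁ + 1 / 2) (i₂ + 1 / 2) z
  start : P.start = pt 0 (-1)

theorem exists_isZigzag {i₁ i₂ : ℕ} (hj : j < 3) (h : i₁ < i₂) (hN : i₂ < N) :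
    ∃ P, IsZigzag N j i₁ i₂ P := by
  obtain ⟨P, h1, h2, h3, h4⟩ := exists_zigzag_scene hj h hN rfl rfl
  exact ⟨P, h1, h2, h3, h4⟩

/-- Away from the zones of both scenes, the robot cannot tell the difference: a line of
sight does not meet the places where the scenes differ. -/
theorem IsZigzag.plainView_eq {i₁ i₂ j' i₁' i₂' : ℕ} {P P' : Scene} (hP : IsZigzag N j i₁ i₂ P)
    (hP' : IsZigzag N j' i₁' i₂' P') (h1 : 4 ≤ i₁) (h2 : i₂ + 4 ≤ N) (h1' : 4 ≤ i₁')
    (h2' : i₂' + 4 ≤ N) (hx : ¬ Zone j (i₁ + 1 / 2) (i₂ + 1 / 2) x)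
    (hx' : ¬ Zone j' (i₁' + 1 / 2) (i₂' + 1 / 2) x) : plainView P x = plainView P' x := by
  have key : ∀ {i₁ i₂ j' i₁' i₂' j : ℕ} {P P' : Scene} (_ : IsZigzag N j i₁ i₂ P)
      (_ : IsZigzag N j' i₁' i₂' P') (_ : 4 ≤ i₁) (_ : i₂ + 4 ≤ N) (_ : 4 ≤ i₁')
      (_ : i₂' + 4 ≤ N) (_ : ¬ Zone j (i₁ + 1 / 2) (i₂ + 1 / 2) x)
      (_ : ¬ Zone j' (i₁' + 1 / 2) (i₂' + 1 / 2) x) (z : Plane), z ∈ P.view x →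
      z ∈ P'.view x ∧ (z ∈ P.outer.boundary ∪ P.holeBoundary →
        z ∈ P'.outer.boundary ∪ P'.holeBoundary) := by
    intro i₁ i₂ j' i₁' i₂' j P P' hP hP' h1 h2 h1' h2' hx hx' z hz
    have hF : ∀ w ∈ segment ℝ x z, Free N j (i₁ + 1 / 2) (i₂ + 1 / 2) w :=
      fun w hw => (hP.mem_region w).1 (hz hw)
    have hsub : ∀ w ∈ segment ℝ x z, ∀ v ∈ segment ℝ x w,
        Free N j (i₁ + 1 / 2) (i₂ + 1 / 2) v := fun w hw v hv =>
      hF v ((convex_segment x z).segment_subset (left_mem_segment ℝ x z) hw hv)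
    have hF' : ∀ w ∈ segment ℝ x z, Free N j' (i₁' + 1 / 2) (i₂' + 1 / 2) w := fun w hw =>
      (hF w hw).congr fun h => hx' (zone_of_sees h1' h2' (hsub w hw) h.1 h.2.1 h.2.2).1
    refine ⟨fun w hw => (hP'.mem_region w).2 (hF' w hw), fun hb => ?_⟩
    rw [hP.mem_boundary] at hb
    rw [hP'.mem_boundary]
    exact ⟨hF' z (right_mem_segment _ _ _), hb.2.congr fun h =>
      hx (zone_of_sees h1 h2 hF h.1 h.2.1 h.2.2).1⟩
  have k1 := key hP hP' h1 h2 h1' h2' hx hx'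
  have k2 := key hP' hP h1' h2' h1 h2 hx' hx
  refine Prod.ext ?_ ?_
  · ext z
    exact ⟨fun h => (k1 z h).1, fun h => (k2 z h).1⟩
  · ext z
    exact ⟨fun h => ⟨(k1 z h.1).1, (k1 z h.1).2 h.2⟩, fun h => ⟨(k2 z h.1).1, (k2 z h.1).2 h.2⟩⟩

/-- The points at the lower and the upper end of the block can only be seen from the same side of
the block. -/
theorem zone_of_sees_end {i₁ i₂ : ℕ} (h12 : i₁ < i₂) (h1 : 4 ≤ i₁) (h2 : i₂ + 4 ≤ N)
    (h : ∀ z ∈ segment ℝ x w, Free N j (i₁ + 1 / 2) (i₂ + 1 / 2) z) (hw : Corr N j w) :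
    (w 1 = i₁ + 1 / 2 → Zone j (i₁ + 1 / 2) (i₂ + 1 / 2) x ∧ x 1 ≤ i₁ + 1 / 2) ∧
    (w 1 = i₂ + 1 / 2 → Zone j (i₁ + 1 / 2) (i₂ + 1 / 2) x ∧ i₂ + 1 / 2 ≤ x 1) := by
  have h12' : (i₁ : ℝ) + 1 ≤ i₂ := by exact_mod_cast h12
  have h1' : (4 : ℝ) ≤ i₁ := by exact_mod_cast h1
  have h2' : (i₂ : ℝ) + 4 ≤ N := by exact_mod_cast h2
  have mid : Corr N j x → i₁ + 1 / 2 - 3 ≤ x 1 → x 1 ≤ i₂ + 1 / 2 + 3 →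
      i₁ + 1 / 2 ≤ w 1 → w 1 ≤ i₂ + 1 / 2 → ∀ c : ℝ, i₁ + 1 / 2 < c → c < i₂ + 1 / 2 →
      ¬ ((x 1 < c ∧ c < w 1) ∨ (w 1 < c ∧ c < x 1)) := by
    intro hc q1 q2 q3 q4 c c1 c2 hcc
    have hne : w 1 - x 1 ≠ 0 := by
      rcases hcc with hm | hm
      · have : 0 < w 1 - x 1 := by linarith
        exact this.ne'
      · have : w 1 - x 1 < 0 := by linarith
        exact this.ne
    set t := (c - x 1) / (w 1 - x 1) with ht
    have ht' : t * (w 1 - x 1) = c - x 1 := div_mul_cancel₀ _ hne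
    have t0 : 0 ≤ t := by
      rcases hcc with hm | hm
      · exact div_nonneg (by linarith) (by linarith)
      · exact div_nonneg_of_nonpos (by linarith) (by linarith)
    have t1 : t ≤ 1 := by
      by_contra hlt
      rcases hcc with hm | hm <;> nlinarith
    have hm : pt (x 0 + t * (w 0 - x 0)) c ∈ segment ℝ x w :=
      mem_segment_plane.2 ⟨t, t0, t1, by simp, by simp; linarith⟩
    have hcv : Corr N j (pt (x 0 + t * (w 0 - x 0)) c) := by
      refine hc.of_segment (j := j) (a := i₁ + 1 / 2) (b := i₂ + 1 / 2) (fun z hz => h z ?_)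
        (by linarith) (by linarith) (by simp; linarith) (by simp; linarith)
      exact (convex_segment x w).segment_subset (left_mem_segment ℝ x w) hm hz
    obtain ⟨i, -, hi, hi'⟩ := (h _ hm).corr (by simp; linarith) (by simp; linarith)
    have : i = j := hi.unique ⟨hcv.bounds.1, by linarith [hcv.bounds.2]⟩
    have := hi' this
    simp only [pt_one] at this
    rcases this with h | h <;> linarith
  have bl : Corr N j x → i₁ + 1 / 2 - 3 ≤ x 1 → x 1 ≤ i₂ + 1 / 2 + 3 →
      x 1 ≤ i₁ + 1 / 2 ∨ i₂ + 1 / 2 ≤ x 1 := by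
    intro hc q1 q2
    obtain ⟨i, -, hi, hi'⟩ := (h x (left_mem_segment _ _ _)).corr (by linarith) (by linarith)
    exact hi' (hi.unique ⟨hc.bounds.1, by linarith [hc.bounds.2]⟩)
  constructor
  · intro hw1
    obtain ⟨hz, hc⟩ := zone_of_sees h1 h2 h hw hw1.ge (by linarith)
    refine ⟨hz, ?_⟩
    rcases bl hc hz.2.1 hz.2.2 with h' | h'
    · exact h'
    · exact (mid hc hz.2.1 hz.2.2 hw1.ge (by linarith) (i₁ + 1) (by linarith) (by linarith)
        (Or.inr ⟨by linarith, by linarith⟩)).elim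
  · intro hw1
    obtain ⟨hz, hc⟩ := zone_of_sees h1 h2 h hw (by linarith) hw1.le
    refine ⟨hz, ?_⟩
    rcases bl hc hz.2.1 hz.2.2 with h' | h'
    · exact (mid hc hz.2.1 hz.2.2 (by linarith) hw1.le (i₁ + 1) (by linarith) (by linarith)
        (Or.inl ⟨by linarith, by linarith⟩)).elim
    · exact h'

end

section

/-! ### Short tours of the zigzag scenes -/

variable {N j i : ℕ} {a b : ℝ} {x z w : Plane}

theorem le_affine {t l p q : ℝ} (t0 : 0 ≤ t) (t1 : t ≤ 1) (hp : l ≤ p) (hq : l ≤ q) :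
    l ≤ p + t * (q - p) := by
  rcases le_total p q with h | h
  · have := mul_nonneg t0 (sub_nonneg.2 h); linarith
  · have := mul_le_mul_of_nonneg_right t1 (sub_nonneg.2 h); linarith

theorem mem_rect_of_mem_segment {c c' d d' : ℝ} (hx : (c ≤ x 0 ∧ x 0 ≤ c') ∧ d ≤ x 1 ∧ x 1 ≤ d')
    (hw : (c ≤ w 0 ∧ w 0 ≤ c') ∧ d ≤ w 1 ∧ w 1 ≤ d') (hz : z ∈ segment ℝ x w) :
    (c ≤ z 0 ∧ z 0 ≤ c') ∧ d ≤ z 1 ∧ z 1 ≤ d' := by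
  obtain ⟨t, t0, t1, e0, e1⟩ := mem_segment_plane.1 hz
  rw [e0, e1]
  have h1 := le_affine t0 t1 hx.1.1 hw.1.1
  have h2 := le_affine t0 t1 (neg_le_neg hx.1.2) (neg_le_neg hw.1.2)
  have h3 := le_affine t0 t1 hx.2.1 hw.2.1
  have h4 := le_affine t0 t1 (neg_le_neg hx.2.2) (neg_le_neg hw.2.2)
  refine ⟨⟨h1, ?_⟩, h3, ?_⟩ <;> linarith

/-- The lower left corner of box `k` of corridor `i`; it also belongs to box `k - 1`. -/
noncomputable def gate (N i k : ℕ) : Plane := pt (lwall N i k) k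

theorem corr_of_box {k : ℕ} (hk : k < N) (h1 : k ≤ z 1 ∧ z 1 ≤ k + 1)
    (h0 : lwall N i k ≤ z 0 ∧ z 0 ≤ rwall N i k) : Corr N i z :=
  ⟨⟨k, ⟨hk, Or.inr h1.1, Or.inr h1.2⟩, h0.1⟩, ⟨k, ⟨hk, Or.inr h1.1, Or.inr h1.2⟩, h0.2⟩⟩

theorem lwall_succ_le_rwall (i k : ℕ) : lwall N i (k + 1) ≤ rwall N i k := by
  have := disp_pos N
  unfold lwall rwall; push_cast; linarith

theorem gate_box_low (i k : ℕ) : (lwall N i k ≤ gate N i k 0 ∧ gate N i k 0 ≤ rwall N i k) ∧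
    (k : ℝ) ≤ gate N i k 1 ∧ gate N i k 1 ≤ k + 1 := by
  have := lwall_le_rwall (N := N) i k
  simp [gate, this]

theorem gate_box_high (i k : ℕ) :
    (lwall N i k ≤ gate N i (k + 1) 0 ∧ gate N i (k + 1) 0 ≤ rwall N i k) ∧
    (k : ℝ) ≤ gate N i (k + 1) 1 ∧ gate N i (k + 1) 1 ≤ k + 1 := by
  have := lwall_succ_le_rwall (N := N) i k
  have := strictMono_lwall (N := N) i (Nat.lt_succ_self k)
  simp [gate]
  constructor <;> linarith

theorem corr_gate_step {k : ℕ} (hk : k < N) (hz : z ∈ segment ℝ (gate N i k) (gate N i (k + 1))) :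
    Corr N i z ∧ (k : ℝ) ≤ z 1 ∧ z 1 ≤ k + 1 := by
  have := mem_rect_of_mem_segment (gate_box_low i k) (gate_box_high i k) hz
  exact ⟨corr_of_box hk this.2 this.1, this.2⟩

theorem dist_gate (k : ℕ) :
    dist (gate N i k) (gate N i (k + 1)) ≤ 1 + (lwall N i (k + 1) - lwall N i k) := by
  refine (dist_le_coord _ _).trans ?_
  have := strictMono_lwall (N := N) i (Nat.lt_succ_self k)
  simp only [gate, pt_zero, pt_one]
  rw [abs_of_neg (by linarith), abs_of_neg (by push_cast; linarith)]
  push_cast; linarith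

theorem walk_climb {R : Set Plane} {m : ℕ} (n : ℕ) (hn : m + n ≤ N)
    (hR : ∀ z, Corr N i z → (m : ℝ) ≤ z 1 → z 1 ≤ m + n → z ∈ R) (hm : gate N i m ∈ R) :
    Walk R (gate N i m) (gate N i (m + n)) (n + (lwall N i (m + n) - lwall N i m))
      {x | ∃ k, m ≤ k ∧ k ≤ m + n ∧ x = gate N i k} := by
  induction n with
  | zero =>
    have := Walk.step (R := R) (p := gate N i m) (q := gate N i m) (by simpa)
    refine this.mono (by simp) ?_
    rintro x ⟨k, h1, h2, rfl⟩
    obtain rfl : k = m := by omega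
    exact left_mem_segment _ _ _
  | succ n ih =>
    have h1 := ih (by omega) fun z h h' h'' => hR z h h' (by push_cast; linarith)
    have h2 := Walk.step (R := R) (p := gate N i (m + n)) (q := gate N i (m + n + 1)) (by
      intro z hz
      have := corr_gate_step (by omega) hz
      push_cast at this
      exact hR z this.1 (by linarith [Nat.cast_nonneg (α := ℝ) n]) (by push_cast; linarith))
    have hmono := (strictMono_lwall (N := N) i).monotone (show m ≤ m + n by omega)
    have hd := dist_gate (N := N) (i := i) (m + n)
    refine (h1.append h2 (by
      have := Nat.cast_nonneg (α := ℝ) n; linarith) dist_nonneg).mono ?_ ?_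
    · push_cast; rw [← Nat.add_assoc]; linarith
    · rintro x ⟨k, h3, h4, rfl⟩
      rcases Nat.lt_or_ge (m + n) k with h | h
      · obtain rfl : k = m + n + 1 := by omega
        exact Or.inr (right_mem_segment _ _ _)
      · exact Or.inl ⟨k, h3, h, rfl⟩

theorem walk_descend {R : Set Plane} {m : ℕ} (n : ℕ) (hn : m + n ≤ N)
    (hR : ∀ z, Corr N i z → (m : ℝ) ≤ z 1 → z 1 ≤ m + n → z ∈ R) (hm : gate N i m ∈ R) :
    Walk R (gate N i (m + n)) (gate N i m) (n + (lwall N i (m + n) - lwall N i m))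
      {x | ∃ k, m ≤ k ∧ k ≤ m + n ∧ x = gate N i k} := by
  induction n with
  | zero =>
    have := Walk.step (R := R) (p := gate N i m) (q := gate N i m) (by simpa)
    refine this.mono (by simp) ?_
    rintro x ⟨k, h1, h2, rfl⟩
    obtain rfl : k = m := by omega
    exact left_mem_segment _ _ _
  | succ n ih =>
    have h1 := ih (by omega) fun z h h' h'' => hR z h h' (by push_cast; linarith)
    have h2 := Walk.step (R := R) (p := gate N i (m + n + 1)) (q := gate N i (m + n)) (by
      intro z hz
      rw [segment_symm] at hz
      have := corr_gate_step (by omega) hz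
      push_cast at this
      exact hR z this.1 (by linarith [Nat.cast_nonneg (α := ℝ) n]) (by push_cast; linarith))
    have hmono := (strictMono_lwall (N := N) i).monotone (show m ≤ m + n by omega)
    have hd := dist_gate (N := N) (i := i) (m + n)
    rw [dist_comm] at hd
    refine (h2.append h1 dist_nonneg (by
      have := Nat.cast_nonneg (α := ℝ) n; linarith)).mono ?_ ?_
    · push_cast; rw [← Nat.add_assoc]; linarith
    · rintro x ⟨k, h3, h4, rfl⟩
      rcases Nat.lt_or_ge (m + n) k with h | h
      · obtain rfl : k = m + n + 1 := by omega
        exact Or.inl (left_mem_segment _ _ _)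
      · exact Or.inr ⟨k, h3, h, rfl⟩

/-- Every point of a corridor is seen from a gate below it and from a gate above it. -/
theorem Corr.sees_gate (hz : Corr N i z) (h0 : 0 < z 1) (hN : z 1 < N) :
    (∃ k ≤ N, (k : ℝ) ≤ z 1 ∧ ∀ w ∈ segment ℝ (gate N i k) z,
      Corr N i w ∧ 0 ≤ w 1 ∧ w 1 ≤ z 1) ∧
    (∃ k ≤ N, z 1 ≤ k ∧ ∀ w ∈ segment ℝ (gate N i k) z, Corr N i w ∧ z 1 ≤ w 1 ∧ w 1 ≤ N) := by
  obtain ⟨k, hk⟩ : ∃ k : ℕ, k = ⌊z 1⌋₊ := ⟨_, rfl⟩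
  have k1 : (k : ℝ) ≤ z 1 := hk ▸ Nat.floor_le h0.le
  have k2 : z 1 < k + 1 := hk ▸ Nat.lt_floor_add_one (z 1)
  have k3 : (k : ℝ) < N := by linarith
  have k3 : k < N := by exact_mod_cast k3
  have k4 : (k : ℝ) + 1 ≤ N := by exact_mod_cast k3
  have k5 : (0 : ℝ) ≤ k := Nat.cast_nonneg k
  have lk : Lev N k (z 1) := ⟨k3, Or.inr k1, Or.inr k2.le⟩
  rcases k1.eq_or_lt with h | h
  · obtain ⟨⟨l, hl, e1⟩, ⟨l', hl', e2⟩⟩ := hz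
    have hk0 : 0 < k := by
      rw [Nat.pos_iff_ne_zero]; rintro rfl
      simp at h; linarith
    have c1 : lwall N i (k - 1) ≤ z 0 :=
      ((strictMono_lwall i).monotone (by have := lk.le_succ hl; omega)).trans e1
    have c2 : z 0 ≤ rwall N i k := by
      refine e2.trans ((strictMono_rwall i).monotone ?_)
      rcases hl'.2.1 with h' | h'
      · omega
      · rw [← h] at h'; exact_mod_cast h'
    have g0 : lwall N i (k - 1) ≤ gate N i k 0 := by
      simpa [gate] using (strictMono_lwall i).monotone (Nat.sub_le k 1)
    have key : ∀ w ∈ segment ℝ (gate N i k) z, Corr N i w ∧ w 1 = z 1 := by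
      intro w hw
      have := mem_rect_of_mem_segment (c := lwall N i (k - 1)) (c' := rwall N i k) (d := k)
        (d' := k)
        ⟨⟨g0, (gate_box_low i k).1.2⟩, by simp [gate], by simp [gate]⟩
        ⟨⟨c1, c2⟩, h.le, h.ge⟩ hw
      have e : w 1 = k := le_antisymm this.2.2 this.2.1
      have hk' : ((k - 1 : ℕ) : ℝ) = k - 1 := by rw [Nat.cast_sub hk0]; simp
      refine ⟨⟨⟨k - 1, ⟨by omega, Or.inr ?_, Or.inr ?_⟩, this.1.1⟩,
        ⟨k, ⟨k3, Or.inr e.ge, Or.inr (by linarith)⟩, this.1.2⟩⟩, by rw [e, h]⟩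
      · rw [hk', e]; linarith
      · rw [hk', e]; linarith
    exact ⟨⟨k, k3.le, k1, fun w hw => ⟨(key w hw).1, by linarith [(key w hw).2],
      (key w hw).2.le⟩⟩, ⟨k, k3.le, h.ge, fun w hw => ⟨(key w hw).1, (key w hw).2.ge,
      by linarith [(key w hw).2]⟩⟩⟩
  · have ho : OnlyLev N k (z 1) := onlyLev_of k3 (Or.inr h) (Or.inr k2)
    have hb : lwall N i k ≤ z 0 ∧ z 0 ≤ rwall N i k := ⟨ho.rt_iff.1 hz.1, ho.lf_iff.1 hz.2⟩
    refine ⟨⟨k, k3.le, k1, fun w hw => ?_⟩, ⟨k + 1, k3, by push_cast; linarith, fun w hw => ?_⟩⟩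
    · have := mem_rect_of_mem_segment (d' := z 1) ⟨(gate_box_low i k).1, (gate_box_low i k).2.1,
        by simpa [gate]⟩ ⟨hb, k1, le_rfl⟩ hw
      exact ⟨corr_of_box k3 ⟨this.2.1, by linarith [this.2.2]⟩ this.1, by linarith [this.2.1],
        this.2.2⟩
    · have := mem_rect_of_mem_segment (d := z 1) ⟨(gate_box_high i k).1, by simp [gate]; linarith,
        (gate_box_high i k).2.2⟩ ⟨hb, le_rfl, k2.le⟩ hw
      exact ⟨corr_of_box k3 ⟨by linarith [this.2.1], this.2.2⟩ this.1, this.2.1,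
        by linarith [this.2.2]⟩

theorem Corr.free (hz : Corr N i z) (hi : i < 3) (h0 : 0 ≤ z 1) (hN : z 1 ≤ N)
    (h : i = j → z 1 ≤ a ∨ b ≤ z 1) : Free N j a b z := by
  refine ⟨⟨by linarith, by linarith⟩, ?_, ?_, Or.inr (Or.inr ⟨i, hi, hz, h⟩)⟩
  · obtain ⟨k, hk, h1⟩ := hz.1
    refine ⟨k, hk, le_trans ?_ h1⟩
    unfold lwall
    have : (0 : ℝ) ≤ i := Nat.cast_nonneg i
    push_cast; linarith
  · obtain ⟨k, hk, h1⟩ := hz.2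
    refine ⟨k, hk, le_trans h1 ?_⟩
    unfold rwall
    have : (i : ℝ) ≤ (2 : ℕ) := by exact_mod_cast Nat.lt_succ_iff.1 hi
    linarith

/-- The bottom room and the top room are rectangles. -/
theorem free_of_room (hN : 0 < N) {k : ℕ}
    (hk : (k = 0 ∧ -1 ≤ z 1 ∧ z 1 ≤ 0) ∨ (k + 1 = N ∧ N ≤ z 1 ∧ z 1 ≤ N + 1))
    (h : lwall N 0 k ≤ z 0 ∧ z 0 ≤ rwall N 2 k) : Free N j a b z := by
  have hN' : (1 : ℝ) ≤ N := by exact_mod_cast hN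
  rcases hk with ⟨rfl, h1, h2⟩ | ⟨hk, h1, h2⟩
  · have ho : OnlyLev N 0 (z 1) := onlyLev_low hN (by linarith)
    exact ⟨⟨h1, by linarith⟩, ho.rt_iff.2 h.1, ho.lf_iff.2 h.2, Or.inl h2⟩
  · have ho : OnlyLev N k (z 1) := by
      rw [show k = N - 1 by omega]; exact onlyLev_high hN (by linarith)
    exact ⟨⟨by linarith, h2⟩, ho.rt_iff.2 h.1, ho.lf_iff.2 h.2, Or.inr (Or.inl h1)⟩

theorem Free.room_low (hN : 0 < N) (h : Free N j a b z) (hz : z 1 ≤ 0) :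
    (lwall N 0 0 ≤ z 0 ∧ z 0 ≤ rwall N 2 0) ∧ -1 ≤ z 1 ∧ z 1 ≤ 0 := by
  have ho : OnlyLev N 0 (z 1) := onlyLev_low hN (by linarith)
  exact ⟨⟨ho.rt_iff.1 h.2.1, ho.lf_iff.1 h.2.2.1⟩, h.1.1, hz⟩

theorem Free.room_high {k : ℕ} (hk : k + 1 = N) (h : Free N j a b z) (hz : N ≤ z 1) :
    (lwall N 0 k ≤ z 0 ∧ z 0 ≤ rwall N 2 k) ∧ (N : ℝ) ≤ z 1 ∧ z 1 ≤ N + 1 := by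
  have ho : OnlyLev N k (z 1) := by
    rw [show k = N - 1 by omega]; exact onlyLev_high (by omega) (by linarith)
  exact ⟨⟨ho.rt_iff.1 h.2.1, ho.lf_iff.1 h.2.2.1⟩, hz, h.1.2⟩

theorem gate_room_low (hi : i < 3) :
    (lwall N 0 0 ≤ gate N i 0 0 ∧ gate N i 0 0 ≤ rwall N 2 0) ∧ -1 ≤ gate N i 0 1 ∧
      gate N i 0 1 ≤ 0 := by
  have h1 : (i : ℝ) ≤ 2 := by exact_mod_cast Nat.lt_succ_iff.1 hi
  have h2 : (0 : ℝ) ≤ i := Nat.cast_nonneg i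
  have := disp_pos N
  simp [gate, lwall, rwall]
  linarith

theorem gate_room_high (hi : i < 3) {k : ℕ} (hk : k + 1 = N) :
    (lwall N 0 k ≤ gate N i N 0 ∧ gate N i N 0 ≤ rwall N 2 k) ∧ (N : ℝ) ≤ gate N i N 1 ∧
      gate N i N 1 ≤ N + 1 := by
  subst hk
  have h1 : (i : ℝ) ≤ 2 := by exact_mod_cast Nat.lt_succ_iff.1 hi
  have h2 : (0 : ℝ) ≤ i := Nat.cast_nonneg i
  have h3 := disp_pos (k + 1)
  have h4 : (k : ℝ) ^ 2 ≤ (k + 1) ^ 2 := by gcongr; linarith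
  simp only [gate, pt_zero, pt_one, lwall, rwall]
  push_cast
  refine ⟨⟨?_, ?_⟩, le_rfl, ?_⟩
  · nlinarith
  · linarith
  · linarith

theorem walk_room_low (hN : 0 < N) {R : Set Plane} (hR : ∀ z, Free N j a b z → z ∈ R)
    (hx : (lwall N 0 0 ≤ x 0 ∧ x 0 ≤ rwall N 2 0) ∧ -1 ≤ x 1 ∧ x 1 ≤ 0)
    (hw : (lwall N 0 0 ≤ w 0 ∧ w 0 ≤ rwall N 2 0) ∧ -1 ≤ w 1 ∧ w 1 ≤ 0) :
    Walk R x w 4 ∅ := by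
  refine (Walk.step fun z hz => hR z ?_).mono ?_ (Set.empty_subset _)
  · have := mem_rect_of_mem_segment hx hw hz
    exact free_of_room hN (Or.inl ⟨rfl, this.2⟩) this.1
  · refine (dist_le_coord _ _).trans ?_
    have h1 := rwall_le (N := N) 2 hN
    have h2 := le_lwall (N := N) 0 0
    push_cast at h1 h2
    have : |x 0 - w 0| ≤ 3 := abs_le.2 ⟨by linarith, by linarith⟩
    have : |x 1 - w 1| ≤ 1 := abs_le.2 ⟨by linarith, by linarith⟩
    linarith

theorem walk_room_high {k : ℕ} (hk : k + 1 = N) {R : Set Plane}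
    (hR : ∀ z, Free N j a b z → z ∈ R)
    (hx : (lwall N 0 k ≤ x 0 ∧ x 0 ≤ rwall N 2 k) ∧ (N : ℝ) ≤ x 1 ∧ x 1 ≤ N + 1)
    (hw : (lwall N 0 k ≤ w 0 ∧ w 0 ≤ rwall N 2 k) ∧ (N : ℝ) ≤ w 1 ∧ w 1 ≤ N + 1) :
    Walk R x w 4 ∅ := by
  refine (Walk.step fun z hz => hR z ?_).mono ?_ (Set.empty_subset _)
  · have := mem_rect_of_mem_segment hx hw hz
    exact free_of_room (by omega) (Or.inr ⟨hk, this.2⟩) this.1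
  · refine (dist_le_coord _ _).trans ?_
    have h1 := rwall_le (N := N) 2 (show k < N by omega)
    have h2 := le_lwall (N := N) 0 k
    push_cast at h1 h2
    have : |x 0 - w 0| ≤ 3 := abs_le.2 ⟨by linarith, by linarith⟩
    have : |x 1 - w 1| ≤ 1 := abs_le.2 ⟨by linarith, by linarith⟩
    linarith

theorem lwall_sub_le (i : ℕ) {m n : ℕ} (h : n ≤ N) : lwall N i n - lwall N i m ≤ 1 := by
  have h1 := le_lwall (N := N) i m
  have h0 := disp_pos N
  have h2 : (n : ℝ) ≤ N + 1 := by
    have : (n : ℝ) ≤ N := by exact_mod_cast h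
    linarith
  have h3 : (n : ℝ) ^ 2 ≤ (N + 1) ^ 2 := by gcongr
  have h4 := disp_mul N
  have : lwall N i n ≤ i + 1 := by unfold lwall; nlinarith
  linarith

/-- The tour climbs corridor `j₁`, visits the upper dead end of corridor `j`, descends corridor `j₂`
and visits the lower dead end of corridor `j`. -/
theorem IsZigzag.opt_le {i₁ i₂ : ℕ} {P : Scene} (hP : IsZigzag N j i₁ i₂ P) (hj : j < 3)
    (h12 : i₁ < i₂) (h2 : i₂ < N) :
    P.opt ≤ ENNReal.ofReal (2 * N + 2 * i₁ + 2 * (N - i₂) + 40) := by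
  obtain ⟨j₁, j₂, hj₁, hj₂, hn₁, hn₂, hall⟩ : ∃ j₁ j₂, j₁ < 3 ∧ j₂ < 3 ∧ j₁ ≠ j ∧ j₂ ≠ j ∧
      ∀ i < 3, i = j ∨ i = j₁ ∨ i = j₂ := by
    interval_cases j
    · exact ⟨1, 2, by omega, by omega, by omega, by omega, fun i hi => by omega⟩
    · exact ⟨0, 2, by omega, by omega, by omega, by omega, fun i hi => by omega⟩
    · exact ⟨0, 1, by omega, by omega, by omega, by omega, fun i hi => by omega⟩
  have hN : 0 < N := by omega
  have hN' : (1 : ℝ) ≤ N := by exact_mod_cast hN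
  have h12' : (i₁ : ℝ) + 1 ≤ i₂ := by exact_mod_cast h12
  have h2' : (i₂ : ℝ) + 1 ≤ N := by exact_mod_cast h2
  have hi0 : (0 : ℝ) ≤ i₁ := Nat.cast_nonneg i₁
  obtain ⟨K, hK⟩ : ∃ K, K + 1 = N := ⟨N - 1, by omega⟩
  obtain ⟨n, hn⟩ : ∃ n, i₂ + 1 + n = N := ⟨N - (i₂ + 1), by omega⟩
  have hn' : (i₂ : ℝ) + 1 + n = N := by exact_mod_cast hn
  have hR : ∀ z, Free N j (i₁ + 1 / 2) (i₂ + 1 / 2) z → z ∈ P.region :=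
    fun z => (hP.mem_region z).2
  have low : ∀ i < 3, gate N i 0 ∈ P.region := fun i hi => hR _ <| by
    have := gate_room_low (N := N) hi
    exact free_of_room hN (Or.inl ⟨rfl, this.2⟩) this.1
  have other : ∀ i < 3, i ≠ j → ∀ z, Corr N i z → ((0 : ℕ) : ℝ) ≤ z 1 → z 1 ≤ (0 : ℕ) + N →
      z ∈ P.region := fun i hi hij z h h1 h2 =>
    hR z (h.free hi (by simpa using h1) (by simpa using h2) fun e => (hij e).elim)
  have hs : (lwall N 0 0 ≤ P.start 0 ∧ P.start 0 ≤ rwall N 2 0) ∧ -1 ≤ P.start 1 ∧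
      P.start 1 ≤ 0 := by
    have := disp_pos N
    rw [hP.start]; simp [lwall, rwall]; linarith
  -- the parts of the tour
  have w1 := walk_room_low hN hR hs (gate_room_low hj₁)
  have w2 := walk_climb N (by omega) (other j₁ hj₁ hn₁) (low j₁ hj₁)
  have w3 := walk_room_high hK hR (gate_room_high hj₁ hK) (gate_room_high hj hK)
  have pocket : gate N j (i₂ + 1) ∈ P.region := by
    refine hR _ ((corr_of_box h2 (gate_box_high j i₂).2 (gate_box_high j i₂).1).free hj ?_ ?_ ?_)
    · simp [gate]; linarith
    · simpa [gate] using h2'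
    · intro _; right; simp [gate]; linarith
  have up : ∀ z, Corr N j z → ((i₂ + 1 : ℕ) : ℝ) ≤ z 1 → z 1 ≤ (i₂ + 1 : ℕ) + n → z ∈ P.region := by
    intro z hz h3 h4
    push_cast at h3 h4
    exact hR z (hz.free hj (by linarith) (by linarith) fun _ => Or.inr (by linarith))
  have w4 := walk_descend n (by omega) up pocket
  have w5 := walk_climb n (by omega) up pocket
  rw [hn] at w4 w5
  have w6 := walk_room_high hK hR (gate_room_high hj hK) (gate_room_high hj₂ hK)
  have w7 := walk_descend N (by omega) (other j₂ hj₂ hn₂) (low j₂ hj₂)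
  rw [zero_add] at w2 w7
  have w8 := walk_room_low hN hR (gate_room_low hj₂) (gate_room_low hj)
  have down : ∀ z, Corr N j z → ((0 : ℕ) : ℝ) ≤ z 1 → z 1 ≤ (0 : ℕ) + i₁ → z ∈ P.region := by
    intro z hz h3 h4
    simp at h3 h4
    exact hR z (hz.free hj (by linarith) (by linarith) fun _ => Or.inl (by linarith))
  have w9 := walk_climb i₁ (by omega) down (low j hj)
  have w10 := walk_descend i₁ (by omega) down (low j hj)
  rw [zero_add] at w9 w10
  have w11 := walk_room_low hN hR (gate_room_low hj) hs
  have w2 := w2.mono (L' := N + 1) (by linarith [lwall_sub_le (m := 0) j₁ (le_refl N)]) subset_rfl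
  have w4 := w4.mono (L' := n + 1) (by linarith [lwall_sub_le (m := i₂ + 1) j (le_refl N)])
    subset_rfl
  have w5 := w5.mono (L' := n + 1) (by linarith [lwall_sub_le (m := i₂ + 1) j (le_refl N)])
    subset_rfl
  have w7 := w7.mono (L' := N + 1) (by linarith [lwall_sub_le (m := 0) j₂ (le_refl N)]) subset_rfl
  have w9 := w9.mono (L' := i₁ + 1)
    (by linarith [lwall_sub_le (N := N) (m := 0) j (show i₁ ≤ N by omega)]) subset_rfl
  have w10 := w10.mono (L' := i₁ + 1)
    (by linarith [lwall_sub_le (N := N) (m := 0) j (show i₁ ≤ N by omega)]) subset_rfl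
  have e1 := w1.append w2 (by positivity) (by positivity)
  have e2 := e1.append w3 (by positivity) (by positivity)
  have e3 := e2.append w4 (by positivity) (by positivity)
  have e4 := e3.append w5 (by positivity) (by positivity)
  have e5 := e4.append w6 (by positivity) (by positivity)
  have e6 := e5.append w7 (by positivity) (by positivity)
  have e7 := e6.append w8 (by positivity) (by positivity)
  have e8 := e7.append w9 (by positivity) (by positivity)
  have e9 := e8.append w10 (by positivity) (by positivity)
  have e10 := e9.append w11 (by positivity) (by positivity)
  refine Scene.opt_le (e10.mono (V' := {x | ∃ i k, i < 3 ∧ k ≤ N ∧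
    (i = j → k ≤ i₁ ∨ i₂ + 1 ≤ k) ∧ x = gate N i k}) ?_ ?_) ?_
  · linarith
  · rintro x ⟨i, k, hi, hk, hij, rfl⟩
    rcases hall i hi with rfl | rfl | rfl
    · rcases hij rfl with h | h
      · refine Or.inl (Or.inl (Or.inr ⟨k, by omega, by omega, rfl⟩))
      · refine Or.inl (Or.inl (Or.inl (Or.inl (Or.inl (Or.inl (Or.inl (Or.inr
          ⟨k, by omega, by omega, rfl⟩)))))))
    · refine Or.inl (Or.inl (Or.inl (Or.inl (Or.inl (Or.inl (Or.inl (Or.inl (Or.inl (Or.inr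
        ⟨k, by omega, by omega, rfl⟩)))))))))
    · refine Or.inl (Or.inl (Or.inl (Or.inl (Or.inr ⟨k, by omega, by omega, rfl⟩))))
  · intro y hy
    have hF := (hP.mem_region y).1 hy
    rcases le_or_gt (y 1) 0 with h | h
    · refine ⟨gate N j₁ 0, ⟨j₁, 0, hj₁, by omega, fun e => (hn₁ e).elim, rfl⟩, fun z hz => hR z ?_⟩
      have := mem_rect_of_mem_segment (gate_room_low hj₁) (hF.room_low hN h) hz
      exact free_of_room hN (Or.inl ⟨rfl, this.2⟩) this.1
    rcases le_or_gt (N : ℝ) (y 1) with h' | h'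
    · refine ⟨gate N j₁ N, ⟨j₁, N, hj₁, by omega, fun e => (hn₁ e).elim, rfl⟩, fun z hz => hR z ?_⟩
      have := mem_rect_of_mem_segment (gate_room_high hj₁ hK) (hF.room_high hK h') hz
      exact free_of_room hN (Or.inr ⟨hK, this.2⟩) this.1
    obtain ⟨i, hi, hc, hij⟩ := hF.corr h h'
    obtain ⟨⟨k, hk, k1, k2⟩, ⟨l, hl, l1, l2⟩⟩ := hc.sees_gate h h'
    by_cases hcase : i = j ∧ i₂ + 1 / 2 ≤ y 1
    · refine ⟨gate N i l, ⟨i, l, hi, hl, fun _ => Or.inr ?_, rfl⟩, fun z hz => hR z ?_⟩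
      · have : (i₂ : ℝ) < l := by linarith [hcase.2]
        have : i₂ < l := by exact_mod_cast this
        omega
      · obtain ⟨q1, q2, q3⟩ := l2 z hz
        exact q1.free hi (by linarith) q3 fun _ => Or.inr (hcase.2.trans q2)
    · have hcase' : i = j → y 1 ≤ i₁ + 1 / 2 := fun e =>
        (hij e).resolve_right fun h => hcase ⟨e, h⟩
      refine ⟨gate N i k, ⟨i, k, hi, hk, fun e => Or.inl ?_, rfl⟩, fun z hz => hR z ?_⟩
      · have : (k : ℝ) < i₁ + 1 := by linarith [hcase' e]
        have : k < i₁ + 1 := by exact_mod_cast this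
        omega
      · obtain ⟨q1, q2, q3⟩ := k2 z hz
        exact q1.free hi q2 (by linarith) fun e => Or.inl (q3.trans (hcase' e))

end

section

/-! ### Lengths of trajectories in the zigzag scenes -/

/-- Three functions of which the sum of changes is locally bounded by the distance. Along a
trajectory, each of them is evaluated at the beginning, at a time of its own, and at the end. -/
theorem ofReal_three_le_eVariationOn {F G H : Plane → ℝ} {K : Set Plane} {r : ℝ} (hr : 0 < r)
    (hf : ∀ p ∈ K, ∀ q ∈ K, dist p q < r → |F p - F q| + |G p - G q| + |H p - H q| ≤ dist p q)
    {γ : ℝ≥0 → Plane} (hγ : Continuous γ) {a b : ℝ≥0} (hK : ∀ u ∈ Set.Icc a b, γ u ∈ K)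
    {x y z : ℝ≥0} (hx : x ∈ Set.Icc a b) (hy : y ∈ Set.Icc a b) (hz : z ∈ Set.Icc a b) :
    ENNReal.ofReal (|F (γ x) - F (γ a)| + |F (γ b) - F (γ x)| + (|G (γ y) - G (γ a)| +
      |G (γ b) - G (γ y)|) + (|H (γ z) - H (γ a)| + |H (γ b) - H (γ z)|)) ≤
      eVariationOn γ (Set.Icc a b) := by
  set d : ℝ≥0 → ℝ≥0 → ℝ := fun s t =>
    |F (γ t) - F (γ s)| + |G (γ t) - G (γ s)| + |H (γ t) - H (γ s)| with hd
  have d0 : ∀ s t, 0 ≤ d s t := fun s t => by positivity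
  -- the three changes are the change of one signed sum
  have two : ∀ s t, a ≤ s → s ≤ t → t ≤ b →
      ENNReal.ofReal (d s t) ≤ eVariationOn γ (Set.Icc s t) := by
    intro s t h1 h2 h3
    have sgn : ∀ f : Plane → ℝ,
        ∃ e : ℝ, |e| = 1 ∧ e * (f (γ t) - f (γ s)) = |f (γ t) - f (γ s)| := by
      intro f
      rcases le_total 0 (f (γ t) - f (γ s)) with h | h
      · exact ⟨1, by simp, by rw [abs_of_nonneg h, one_mul]⟩
      · exact ⟨-1, by simp, by rw [abs_of_nonpos h]; ring⟩
    obtain ⟨e, he, he'⟩ := sgn F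
    obtain ⟨e₁, he₁, he₁'⟩ := sgn G
    obtain ⟨e₂, he₂, he₂'⟩ := sgn H
    have key := abs_sub_le_eVariationOn (f := fun p => e * F p + e₁ * G p + e₂ * H p) hr
      (fun p hp q hq hpq => by
        refine le_trans ?_ (hf p hp q hq hpq)
        have : e * F p + e₁ * G p + e₂ * H p - (e * F q + e₁ * G q + e₂ * H q) =
          e * (F p - F q) + e₁ * (G p - G q) + e₂ * (H p - H q) := by ring
        rw [this]
        refine (abs_add_three _ _ _).trans ?_
        rw [abs_mul, abs_mul, abs_mul, he, he₁, he₂, one_mul, one_mul, one_mul]) hγ h2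
      (fun u hu => hK u ⟨h1.trans hu.1, hu.2.trans h3⟩)
    refine le_trans (ENNReal.ofReal_le_ofReal ?_) key
    refine le_trans (le_of_eq ?_) (le_abs_self _)
    simp only [hd, ← he', ← he₁', ← he₂']; ring
  have sorted : ∀ x y z : ℝ≥0, a ≤ x → x ≤ y → y ≤ z → z ≤ b →
      ENNReal.ofReal (d a x + d x y + d y z + d z b) ≤ eVariationOn γ (Set.Icc a b) := by
    intro x y z h1 h2 h3 h4
    rw [← eVariationOn_Icc_add_le_length γ h1 ((h2.trans h3).trans h4),
      ← eVariationOn_Icc_add_le_length γ h2 (h3.trans h4),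
      ← eVariationOn_Icc_add_le_length γ h3 h4]
    rw [show d a x + d x y + d y z + d z b = d a x + (d x y + (d y z + d z b)) by ring,
      ENNReal.ofReal_add (d0 _ _) (by have := d0 x y; have := d0 y z; have := d0 z b; linarith),
      ENNReal.ofReal_add (d0 _ _) (by have := d0 y z; have := d0 z b; linarith),
      ENNReal.ofReal_add (d0 _ _) (d0 _ _)]
    gcongr
    · exact two _ _ le_rfl h1 ((h2.trans h3).trans h4)
    · exact two _ _ h1 h2 (h3.trans h4)
    · exact two _ _ (h1.trans h2) h3 h4
    · exact two _ _ ((h1.trans h2).trans h3) h4 le_rfl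
  have tri : ∀ (f : Plane → ℝ) (s t u : ℝ≥0),
      |f (γ u) - f (γ s)| ≤ |f (γ t) - f (γ s)| + |f (γ u) - f (γ t)| := by
    intro f s t u
    have := abs_sub_le (f (γ u)) (f (γ t)) (f (γ s)); linarith
  have main : ∀ x' y' z' : ℝ≥0, a ≤ x' → x' ≤ y' → y' ≤ z' → z' ≤ b →
      (x = x' ∨ x = y' ∨ x = z') → (y = x' ∨ y = y' ∨ y = z') → (z = x' ∨ z = y' ∨ z = z') →
      ENNReal.ofReal (|F (γ x) - F (γ a)| + |F (γ b) - F (γ x)| + (|G (γ y) - G (γ a)| +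
        |G (γ b) - G (γ y)|) + (|H (γ z) - H (γ a)| + |H (γ b) - H (γ z)|)) ≤
        eVariationOn γ (Set.Icc a b) := by
    intro x' y' z' h1 h2 h3 h4 ex ey ez
    refine le_trans (ENNReal.ofReal_le_ofReal ?_) (sorted x' y' z' h1 h2 h3 h4)
    have four : ∀ (f : Plane → ℝ) (u : ℝ≥0), (u = x' ∨ u = y' ∨ u = z') →
        |f (γ u) - f (γ a)| + |f (γ b) - f (γ u)| ≤ |f (γ x') - f (γ a)| + |f (γ y') - f (γ x')| +
          |f (γ z') - f (γ y')| + |f (γ b) - f (γ z')| := by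
      rintro f u (rfl | rfl | rfl)
      · have := tri f u y' b; have := tri f y' z' b; linarith
      · have := tri f a x' u; have := tri f u z' b; linarith
      · have := tri f a x' u; have := tri f x' y' u; linarith
    have := four F x ex; have := four G y ey; have := four H z ez
    simp only [hd]; linarith
  rcases le_total x y with h1 | h1 <;> rcases le_total y z with h2 | h2 <;>
    rcases le_total x z with h3 | h3
  · exact main x y z hx.1 h1 h2 hz.2 (by simp) (by simp) (by simp)
  · exact main x y z hx.1 h1 h2 hz.2 (by simp) (by simp) (by simp)
  · exact main x z y hx.1 h3 h2 hy.2 (by simp) (by simp) (by simp)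
  · exact main z x y hz.1 h3 h1 hy.2 (by simp) (by simp) (by simp)
  · exact main y x z hy.1 h1 h3 hz.2 (by simp) (by simp) (by simp)
  · exact main y z x hy.1 h2 h3 hx.2 (by simp) (by simp) (by simp)
  · exact main z y x hz.1 h2 h1 hx.2 (by simp) (by simp) (by simp)
  · exact main z y x hz.1 h2 h1 hx.2 (by simp) (by simp) (by simp)

/-- The height, restricted to the corridors. -/
noncomputable def clip (N : ℕ) (y : ℝ) : ℝ := max 0 (min y N)

/-- The position on the way up or down, for a point at height `y` in strip `i`. The corridor `j₀` is
interrupted at height `m₀`, its lower part counts as bottom and its upper part as top. The way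
continues from the top into the part of corridor `j₁` above the height `m₁`, and backwards from the
bottom into the part below. -/
noncomputable def loopPos (N j₀ j₁ : ℕ) (m₀ m₁ : ℝ) (i : ℕ) (y : ℝ) : ℝ :=
  if i = j₀ then (if y ≤ m₀ then 0 else N)
  else if i = j₁ then (if y ≤ m₁ then -clip N y else 2 * N - clip N y)
  else clip N y

/-- The distance from the bottom in the lower part of corridor `j₀`. -/
noncomputable def lowDepth (N j₀ : ℕ) (m₀ : ℝ) (i : ℕ) (y : ℝ) : ℝ :=
  if i = j₀ ∧ y ≤ m₀ then clip N y else 0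

/-- The distance from the top in the upper part of corridor `j₀`. -/
noncomputable def highDepth (N j₀ : ℕ) (m₀ : ℝ) (i : ℕ) (y : ℝ) : ℝ :=
  if i = j₀ ∧ ¬ y ≤ m₀ then N - clip N y else 0

/-- The strip to which a point belongs. -/
noncomputable def strip (z : Plane) : ℕ := if z 0 < 3 / 4 then 0 else if z 0 < 7 / 4 then 1 else 2

variable {N j₀ j₁ i : ℕ} {m₀ m₁ : ℝ} {z : Plane}

theorem clip_of_le {y : ℝ} (h : y ≤ 0) : clip N y = 0 :=
  max_eq_left ((min_le_left _ _).trans h)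

theorem clip_of_ge {y : ℝ} (h : N ≤ y) : clip N y = N := by
  rw [clip, min_eq_right h, max_eq_right (Nat.cast_nonneg N)]

theorem clip_of_mem {y : ℝ} (h : 0 ≤ y) (h' : y ≤ N) : clip N y = y := by
  rw [clip, min_eq_left h', max_eq_right h]

theorem abs_clip_sub_le (y y' : ℝ) : |clip N y - clip N y'| ≤ |y - y'| := by
  refine (abs_max_sub_max_le_max _ _ _ _).trans ?_
  rw [sub_self, abs_zero]
  refine max_le (abs_nonneg _) ((abs_min_sub_min_le_max _ _ _ _).trans ?_)
  rw [sub_self, abs_zero]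
  exact max_le le_rfl (abs_nonneg _)

theorem Corr.strip_eq (h : Corr N i z) (hi : i < 3) : strip z = i := by
  have := h.bounds
  unfold strip
  interval_cases i <;> norm_num at this
  · rw [if_pos (by linarith)]
  · rw [if_neg (by linarith), if_pos (by linarith)]
  · rw [if_neg (by linarith), if_neg (by linarith)]

/-- The points that are in a room, or in a corridor and not too close to the interruptions. The
interruption of `j₀` is the block; the place `m₁` in `j₁` is where the trajectory is cut open. -/
def Clear (N j₀ j₁ : ℕ) (m₀ m₁ : ℝ) : Set Plane :=
  {z | z 1 ≤ 0 ∨ N ≤ z 1 ∨ ∃ i < 3, Corr N i z ∧ (i = j₀ → z 1 ≤ m₀ - 1 / 2 ∨ m₀ + 1 / 2 ≤ z 1) ∧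
    (i = j₁ → z 1 ≤ m₁ - 1 / 2 ∨ m₁ + 1 / 2 ≤ z 1)}

theorem change_le {y y' : ℝ} (h0 : i = j₀ → (y ≤ m₀ ↔ y' ≤ m₀))
    (h1 : i = j₁ → (y ≤ m₁ ↔ y' ≤ m₁)) :
    |loopPos N j₀ j₁ m₀ m₁ i y - loopPos N j₀ j₁ m₀ m₁ i y'| +
      |lowDepth N j₀ m₀ i y - lowDepth N j₀ m₀ i y'| +
      |highDepth N j₀ m₀ i y - highDepth N j₀ m₀ i y'| ≤ |y - y'| := by
  have hc := abs_clip_sub_le (N := N) y y'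
  have e1 : |-clip N y - -clip N y'| = |clip N y - clip N y'| := by
    rw [← abs_neg]; congr 1; ring
  have e2 : ∀ c : ℝ, |c - clip N y - (c - clip N y')| = |clip N y - clip N y'| := by
    intro c; rw [← abs_neg]; congr 1; ring
  unfold loopPos lowDepth highDepth
  by_cases hi : i = j₀
  · have h0 := h0 hi
    have hi := eq_true hi
    by_cases hy : y ≤ m₀
    · have hy' := eq_true (h0.1 hy)
      have hy := eq_true hy
      simpa only [hi, hy, hy', if_true, not_true, and_true, and_false, if_false, sub_self, abs_zero,
        add_zero, zero_add] using hc
    · have hy' := eq_false fun h => hy (h0.2 h)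
      have hy := eq_false hy
      simpa only [hi, hy, hy', if_true, not_false_iff, and_true, and_false, if_false, sub_self,
        abs_zero, add_zero, zero_add, e2] using hc
  · have hi := eq_false hi
    by_cases hi' : i = j₁
    · have h1 := h1 hi'
      have hi' := eq_true hi'
      by_cases hy : y ≤ m₁
      · have hy' := eq_true (h1.1 hy)
        have hy := eq_true hy
        simpa only [hi, hi', hy, hy', if_true, if_false, false_and, sub_self, abs_zero, add_zero,
          e1]
          using hc
      · have hy' := eq_false fun h => hy (h1.2 h)
        have hy := eq_false hy
        simpa only [hi, hi', hy, hy', if_true, if_false, false_and, sub_self, abs_zero, add_zero,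
          e2]
          using hc
    · have hi' := eq_false hi'
      simpa only [hi, hi', if_false, false_and, sub_self, abs_zero, add_zero] using hc

theorem loopPos_of_le (hm₀ : 0 ≤ m₀) (hm₁ : 0 ≤ m₁) {y : ℝ} (h : y ≤ 0) :
    loopPos N j₀ j₁ m₀ m₁ i y = 0 := by
  simp [loopPos, h.trans hm₀, h.trans hm₁, clip_of_le h]

theorem loopPos_of_ge (hm₀ : m₀ < N) (hm₁ : m₁ < N) {y : ℝ} (h : N ≤ y) :
    loopPos N j₀ j₁ m₀ m₁ i y = N := by
  simp only [loopPos, not_le.2 (hm₀.trans_le h), not_le.2 (hm₁.trans_le h), clip_of_ge h, if_false]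
  split_ifs <;> ring

theorem lowDepth_of_le {y : ℝ} (h : y ≤ 0) : lowDepth N j₀ m₀ i y = 0 := by
  simp [lowDepth, clip_of_le h]

theorem lowDepth_of_ge (hm₀ : m₀ < N) {y : ℝ} (h : N ≤ y) : lowDepth N j₀ m₀ i y = 0 := by
  simp [lowDepth, hm₀.trans_le h]

theorem highDepth_of_le (hm₀ : 0 ≤ m₀) {y : ℝ} (h : y ≤ 0) : highDepth N j₀ m₀ i y = 0 := by
  simp [highDepth, h.trans hm₀]

theorem highDepth_of_ge {y : ℝ} (h : N ≤ y) : highDepth N j₀ m₀ i y = 0 := by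
  simp [highDepth, clip_of_ge h]

/-- Between nearby clear points, at most one of the three functions changes, and it changes by at
most the difference of the heights. -/
theorem change_le_dist (hm₀ : 1 ≤ m₀ ∧ m₀ + 1 ≤ N) (hm₁ : 1 ≤ m₁ ∧ m₁ + 1 ≤ N) {p q : Plane}
    (hp : p ∈ Clear N j₀ j₁ m₀ m₁) (hq : q ∈ Clear N j₀ j₁ m₀ m₁) (hpq : dist p q < 1 / 4) :
    |loopPos N j₀ j₁ m₀ m₁ (strip p) (p 1) - loopPos N j₀ j₁ m₀ m₁ (strip q) (q 1)| +
      |lowDepth N j₀ m₀ (strip p) (p 1) - lowDepth N j₀ m₀ (strip q) (q 1)| +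
      |highDepth N j₀ m₀ (strip p) (p 1) - highDepth N j₀ m₀ (strip q) (q 1)| ≤ dist p q := by
  -- in the rooms, all strips are alike
  have room : ∀ p : Plane, (p 1 ≤ 0 ∨ N ≤ p 1) → ∀ i,
      loopPos N j₀ j₁ m₀ m₁ (strip p) (p 1) = loopPos N j₀ j₁ m₀ m₁ i (p 1) ∧
      lowDepth N j₀ m₀ (strip p) (p 1) = lowDepth N j₀ m₀ i (p 1) ∧
      highDepth N j₀ m₀ (strip p) (p 1) = highDepth N j₀ m₀ i (p 1) := by
    rintro p (h | h) i
    · simp only [loopPos_of_le (by linarith : 0 ≤ m₀) (by linarith : 0 ≤ m₁) h, lowDepth_of_le h,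
        highDepth_of_le (by linarith : 0 ≤ m₀) h, and_self]
    · simp only [loopPos_of_ge (by linarith : m₀ < N) (by linarith : m₁ < N) h,
        lowDepth_of_ge (by linarith : m₀ < N) h, highDepth_of_ge h, and_self]
  obtain ⟨i, hpi, hqi⟩ : ∃ i, (p 1 ≤ 0 ∨ N ≤ p 1 ∨ strip p = i ∧
        (i = j₀ → p 1 ≤ m₀ - 1 / 2 ∨ m₀ + 1 / 2 ≤ p 1) ∧
        (i = j₁ → p 1 ≤ m₁ - 1 / 2 ∨ m₁ + 1 / 2 ≤ p 1)) ∧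
      (q 1 ≤ 0 ∨ N ≤ q 1 ∨ strip q = i ∧ (i = j₀ → q 1 ≤ m₀ - 1 / 2 ∨ m₀ + 1 / 2 ≤ q 1) ∧
        (i = j₁ → q 1 ≤ m₁ - 1 / 2 ∨ m₁ + 1 / 2 ≤ q 1)) := by
    rcases hp with h | h | ⟨i, hi, hc, h⟩
    · rcases hq with h' | h' | ⟨i, hi, hc, h'⟩
      · exact ⟨0, Or.inl h, Or.inl h'⟩
      · exact ⟨0, Or.inl h, Or.inr (Or.inl h')⟩
      · exact ⟨i, Or.inl h, Or.inr (Or.inr ⟨hc.strip_eq hi, h'⟩)⟩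
    · rcases hq with h' | h' | ⟨i, hi, hc, h'⟩
      · exact ⟨0, Or.inr (Or.inl h), Or.inl h'⟩
      · exact ⟨0, Or.inr (Or.inl h), Or.inr (Or.inl h')⟩
      · exact ⟨i, Or.inr (Or.inl h), Or.inr (Or.inr ⟨hc.strip_eq hi, h'⟩)⟩
    · refine ⟨i, Or.inr (Or.inr ⟨hc.strip_eq hi, h⟩), ?_⟩
      rcases hq with h' | h' | ⟨i', hi', hc', h'⟩
      · exact Or.inl h'
      · exact Or.inr (Or.inl h')
      · have h0 := (abs_coord_sub_le p q 0).trans_lt hpq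
        rw [abs_lt] at h0
        have b := hc.bounds
        have b' := hc'.bounds
        have h1 : (i : ℝ) < i' + 1 := by linarith
        have h2 : (i' : ℝ) < i + 1 := by linarith
        have h1 : i < i' + 1 := by exact_mod_cast h1
        have h2 : i' < i + 1 := by exact_mod_cast h2
        obtain rfl : i = i' := by omega
        exact Or.inr (Or.inr ⟨hc'.strip_eq hi', h'⟩)
  have val : ∀ p : Plane, (p 1 ≤ 0 ∨ N ≤ p 1 ∨ strip p = i ∧
        (i = j₀ → p 1 ≤ m₀ - 1 / 2 ∨ m₀ + 1 / 2 ≤ p 1) ∧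
        (i = j₁ → p 1 ≤ m₁ - 1 / 2 ∨ m₁ + 1 / 2 ≤ p 1)) →
      (loopPos N j₀ j₁ m₀ m₁ (strip p) (p 1) = loopPos N j₀ j₁ m₀ m₁ i (p 1) ∧
      lowDepth N j₀ m₀ (strip p) (p 1) = lowDepth N j₀ m₀ i (p 1) ∧
      highDepth N j₀ m₀ (strip p) (p 1) = highDepth N j₀ m₀ i (p 1)) ∧
      (i = j₀ → p 1 ≤ m₀ - 1 / 2 ∨ m₀ + 1 / 2 ≤ p 1) ∧
      (i = j₁ → p 1 ≤ m₁ - 1 / 2 ∨ m₁ + 1 / 2 ≤ p 1) := by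
    rintro p (h | h | ⟨rfl, h⟩)
    · exact ⟨room p (Or.inl h) i, fun _ => Or.inl (by linarith), fun _ => Or.inl (by linarith)⟩
    · exact ⟨room p (Or.inr h) i, fun _ => Or.inr (by linarith), fun _ => Or.inr (by linarith)⟩
    · exact ⟨⟨rfl, rfl, rfl⟩, h⟩
  obtain ⟨⟨e1, e2, e3⟩, hp0, hp1⟩ := val p hpi
  obtain ⟨⟨f1, f2, f3⟩, hq0, hq1⟩ := val q hqi
  have h1 := abs_coord_sub_le p q 1
  have h1' := h1.trans_lt hpq
  rw [abs_lt] at h1'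
  rw [e1, e2, e3, f1, f2, f3]
  refine (change_le (fun hi => ?_) (fun hi => ?_)).trans h1
  · rcases hp0 hi with h | h <;> rcases hq0 hi with h' | h' <;> constructor <;> intro h'' <;>
      linarith
  · rcases hp1 hi with h | h <;> rcases hq1 hi with h' | h' <;> constructor <;> intro h'' <;>
      linarith

/-- A lower bound for the length of a piece of trajectory that passes the points `γ x`, `γ y` and
`γ z` in some order. -/
theorem le_eVariationOn_of_clear (hm₀ : 1 ≤ m₀ ∧ m₀ + 1 ≤ N) (hm₁ : 1 ≤ m₁ ∧ m₁ + 1 ≤ N)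
    {γ : ℝ≥0 → Plane} (hγ : Continuous γ) {a b : ℝ≥0}
    (hK : ∀ u ∈ Set.Icc a b, γ u ∈ Clear N j₀ j₁ m₀ m₁) {x y z : ℝ≥0} (hx : x ∈ Set.Icc a b)
    (hy : y ∈ Set.Icc a b) (hz : z ∈ Set.Icc a b) {f : ℝ≥0 → ℝ} {g : ℝ≥0 → ℝ} {h : ℝ≥0 → ℝ}
    (hf : ∀ t, f t = loopPos N j₀ j₁ m₀ m₁ (strip (γ t)) (γ t 1))
    (hg : ∀ t, g t = lowDepth N j₀ m₀ (strip (γ t)) (γ t 1))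
    (hh : ∀ t, h t = highDepth N j₀ m₀ (strip (γ t)) (γ t 1)) :
    ENNReal.ofReal (|f x - f a| + |f b - f x| + (|g y - g a| + |g b - g y|) +
      (|h z - h a| + |h b - h z|)) ≤ eVariationOn γ (Set.Icc a b) := by
  simp only [hf, hg, hh]
  exact ofReal_three_le_eVariationOn
    (F := fun p => loopPos N j₀ j₁ m₀ m₁ (strip p) (p 1))
    (G := fun p => lowDepth N j₀ m₀ (strip p) (p 1))
    (H := fun p => highDepth N j₀ m₀ (strip p) (p 1)) (r := 1 / 4) (by norm_num)
    (fun p hp q hq hpq => change_le_dist hm₀ hm₁ hp hq hpq) hγ hK hx hy hz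

end

section

/-! ### Tours that reach the blocked corridor last -/

variable {N j i : ℕ} {a b : ℝ} {z : Plane}

theorem Free.corr_of_strip (h : Free N j a b z) {i : ℕ} (hi : (i : ℝ) ≤ z 0 ∧ z 0 ≤ i + 1 / 2)
    (h0 : 0 < z 1) (hN : z 1 < N) : Corr N i z ∧ (i = j → z 1 ≤ a ∨ b ≤ z 1) := by
  obtain ⟨i', -, hc, h'⟩ := h.corr h0 hN
  obtain rfl := hc.unique hi
  exact ⟨hc, h'⟩

/-- At the first time at which a trajectory in the free space enters a zone, it is at one of the
two ends of the zone. -/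
theorem first_hit_height {γ : ℝ≥0 → Plane} (hγ : Continuous γ) (hF : ∀ t, Free N j a b (γ t))
    {c d : ℝ} (hc : 3 < c) (hd : d + 3 < N) {t : ℝ≥0} (h0 : γ 0 1 < 0)
    (ht : Zone i c d (γ t)) (hlt : ∀ τ < t, ¬ Zone i c d (γ τ)) :
    γ t 1 = c - 3 ∨ γ t 1 = d + 3 := by
  obtain ⟨hx, h1, h2⟩ := ht
  by_contra hne
  rw [not_or] at hne
  have h1 := lt_of_le_of_ne h1 (Ne.symm hne.1)
  have h2 := lt_of_le_of_ne h2 hne.2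
  have ht0 : 0 < t := by
    rw [pos_iff_ne_zero]; rintro rfl; linarith
  have hcorr := ((hF t).corr_of_strip hx (by linarith) (by linarith)).1.bounds
  have c0 : Continuous fun t => γ t 0 := by fun_prop
  have c1 : Continuous fun t => γ t 1 := by fun_prop
  have hU : {t | ((i : ℝ) - 1 / 2 < γ t 0 ∧ γ t 0 < i + 7 / 8) ∧ c - 3 < γ t 1 ∧ γ t 1 < d + 3} ∈
      nhds t := by
    refine IsOpen.mem_nhds ?_ ⟨⟨by linarith, by linarith⟩, h1, h2⟩
    exact ((isOpen_lt continuous_const c0).and (isOpen_lt c0 continuous_const)).and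
      ((isOpen_lt continuous_const c1).and (isOpen_lt c1 continuous_const))
  obtain ⟨l, hl, hl'⟩ := exists_Ioc_subset_of_mem_nhds hU ⟨0, ht0⟩
  obtain ⟨τ, hτ, hτ'⟩ := exists_between hl
  obtain ⟨⟨u1, u2⟩, u3, u4⟩ := hl' ⟨hτ, hτ'.le⟩
  obtain ⟨i', -, hi', -⟩ := (hF τ).corr (by linarith) (by linarith)
  have b := hi'.bounds
  have e1 : (i' : ℝ) < i + 1 := by linarith
  have e2 : (i : ℝ) < i' + 1 := by linarith
  have e1 : i' < i + 1 := by exact_mod_cast e1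
  have e2 : i < i' + 1 := by exact_mod_cast e2
  obtain rfl : i' = i := by omega
  exact hlt τ hτ' ⟨⟨b.1, by linarith⟩, u3.le, u4.le⟩

/-- A watchman tour visits the zone of the block from below and from above. -/
theorem Scene.IsWatchmanTour.exists_zone_ends {i₁ i₂ : ℕ} {P : Scene} {γ : ℝ≥0 → Plane}
    (hγ : P.IsWatchmanTour γ) (hP : IsZigzag N j i₁ i₂ P) (hj : j < 3) (h12 : i₁ < i₂)
    (h1 : 4 ≤ i₁) (h2 : i₂ + 4 ≤ N) :
    (∃ t, Zone j (i₁ + 1 / 2) (i₂ + 1 / 2) (γ t) ∧ γ t 1 ≤ i₁ + 1 / 2) ∧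
    (∃ t, Zone j (i₁ + 1 / 2) (i₂ + 1 / 2) (γ t) ∧ i₂ + 1 / 2 ≤ γ t 1) := by
  have h12' : (i₁ : ℝ) + 1 ≤ i₂ := by exact_mod_cast h12
  have h2' : (i₂ : ℝ) + 4 ≤ N := by exact_mod_cast h2
  have hi0 : (0 : ℝ) ≤ i₁ := Nat.cast_nonneg i₁
  have corr : ∀ k < N, Corr N j (pt (lwall N j k) (k + 1 / 2)) := fun k hk =>
    corr_of_box hk ⟨by simp, by simp; linarith⟩ ⟨by simp, by simpa using lwall_le_rwall j k⟩
  constructor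
  · have hc := corr i₁ (by omega)
    obtain ⟨t, ht⟩ := hγ.sees _ ((hP.mem_region _).2 (hc.free hj (by simp; linarith)
      (by simp; linarith) fun _ => Or.inl (by simp)))
    exact ⟨t, (zone_of_sees_end h12 h1 h2 (fun z hz => (hP.mem_region z).1 (ht hz)) hc).1 (by simp)⟩
  · have hc := corr i₂ (by omega)
    obtain ⟨t, ht⟩ := hγ.sees _ ((hP.mem_region _).2 (hc.free hj (by simp; linarith)
      (by simp; linarith) fun _ => Or.inr (by simp)))
    exact ⟨t, (zone_of_sees_end h12 h1 h2 (fun z hz => (hP.mem_region z).1 (ht hz)) hc).2 (by simp)⟩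

theorem IsZigzag.opt_pos {i₁ i₂ : ℕ} {P : Scene} (hP : IsZigzag N j i₁ i₂ P) (hj : j < 3)
    (h12 : i₁ < i₂) (h1 : 4 ≤ i₁) (h2 : i₂ + 4 ≤ N) : 0 < P.opt := by
  refine lt_of_lt_of_le (ENNReal.ofReal_pos.2 one_pos) (le_iInf₂ fun γ hγ => ?_)
  obtain ⟨t, ht, -⟩ := (hγ.exists_zone_ends hP hj h12 h1 h2).1
  refine ofReal_le_length (ofReal_coord_le_eVariationOn hγ.continuous 1 bot_le ?_ (s := 0) (t := t))
  rw [hγ.start, hP.start, pt_one]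
  have := ht.2.1
  have h1' : (4 : ℝ) ≤ i₁ := by exact_mod_cast h1
  exact le_trans (by linarith) (le_abs_self _)

/-- The zone in which the robot can see whether corridor `j` is blocked at the height `i + 1`. -/
abbrev UnitZone (j i : ℕ) (z : Plane) : Prop := Zone j (i + 1 / 2) ((i + 1 : ℕ) + 1 / 2) z

set_option maxHeartbeats 1000000 in
/-- Corridor `j₀` is blocked at the heights between `m + 1 / 2` and `n + 3 / 2`. If a robot has
looked everywhere else before it sees that, the last place outside of `j₀` being in corridor `j₁`,
then its tour has about twice the length of the tour in `IsZigzag.opt_le`. -/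
theorem le_length_of_order {P : Scene} {γ : ℝ≥0 → Plane} {m n i₁ j₀ j₁ : ℕ}
    (hγ : P.IsWatchmanTour γ) (hP : IsZigzag N j₀ m (n + 1) P) (hj₀ : j₀ < 3) (hj₁ : j₁ < 3)
    (hjj : j₁ ≠ j₀) (hm : 4 ≤ m) (hmn : m ≤ n) (hn : n + 5 ≤ N) (hi : 4 ≤ i₁) (hi' : i₁ + 5 ≤ N)
    {t₂ : ℝ≥0} (h₀ : ∀ t ≤ t₂, ¬ Zone j₀ (m + 1 / 2) ((n + 1 : ℕ) + 1 / 2) (γ t))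
    (h₁ : UnitZone j₁ i₁ (γ t₂)) (h₁' : ∀ t < t₂, ¬ UnitZone j₁ i₁ (γ t))
    (hother : ∀ j i, j < 3 → j ≠ j₀ → 4 ≤ i → i + 5 ≤ N → ∃ t ≤ t₂, UnitZone j i (γ t))
    (hlow : m = 4 ∨ ∃ t ≤ t₂, UnitZone j₀ (m - 1) (γ t))
    (hhigh : n + 5 = N ∨ ∃ t ≤ t₂, UnitZone j₀ (n + 1) (γ t)) :
    ENNReal.ofReal (4 * N + 4 * m + 4 * (N - n) - 60) ≤ length γ := by
  have hm' : (4 : ℝ) ≤ m := by exact_mod_cast hm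
  have hmn' : (m : ℝ) ≤ n := by exact_mod_cast hmn
  have hn' : (n : ℝ) + 5 ≤ N := by exact_mod_cast hn
  have hiR : (4 : ℝ) ≤ i₁ := by exact_mod_cast hi
  have hiR' : (i₁ : ℝ) + 5 ≤ N := by exact_mod_cast hi'
  have hF : ∀ t, Free N j₀ (m + 1 / 2) ((n + 1 : ℕ) + 1 / 2) (γ t) :=
    fun t => (hP.mem_region _).1 (hγ.mem_region t)
  simp only [UnitZone] at *
  push_cast at *
  have hc := hγ.continuous
  have hs : γ 0 1 = -1 := by rw [hγ.start, hP.start]; simp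
  obtain ⟨T, hT⟩ := hγ.returns
  obtain ⟨⟨u, hu, hu'⟩, v, hv, hv'⟩ :=
    hγ.exists_zone_ends hP hj₀ (by omega) hm (by omega)
  push_cast at hu hv hv'
  have htu : t₂ < u := not_le.1 fun h => h₀ u h hu
  have htv : t₂ < v := not_le.1 fun h => h₀ v h hv
  obtain ⟨b, hbT, hbu, hbv⟩ : ∃ b, T ≤ b ∧ u ≤ b ∧ v ≤ b :=
    ⟨max T (max u v), le_max_left _ _, (le_max_left _ _).trans (le_max_right _ _),
      (le_max_right _ _).trans (le_max_right _ _)⟩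
  have hb : γ b 1 = -1 := by rw [hT b hbT, hP.start]; simp
  have hm₀ : 1 ≤ (m + 1 : ℝ) ∧ (m + 1 : ℝ) + 1 ≤ N := ⟨by linarith, by linarith⟩
  have hm₁ : 1 ≤ (i₁ + 1 : ℝ) ∧ (i₁ + 1 : ℝ) + 1 ≤ N := ⟨by linarith, by linarith⟩
  -- the strip of a point in a zone
  have loc : ∀ t (j : ℕ), j < 3 → ((j : ℝ) ≤ γ t 0 ∧ γ t 0 ≤ j + 1 / 2) → 0 < γ t 1 → γ t 1 < N →
      strip (γ t) = j := fun t j hj hx h0 hN =>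
    ((hF t).corr_of_strip hx h0 hN).1.strip_eq hj
  have edge : γ t₂ 1 = i₁ - 5 / 2 ∨ γ t₂ 1 = i₁ + 9 / 2 := by
    have := first_hit_height hc hF (by linarith) (by linarith) (by linarith) h₁ h₁'
    refine this.imp (fun h => ?_) (fun h => ?_) <;> rw [h] <;> ring
  have st₂ : strip (γ t₂) = j₁ := loc t₂ j₁ hj₁ h₁.1 (by linarith [h₁.2.1]) (by linarith [h₁.2.2])
  have block : ∀ t i, Corr N i (γ t) → 0 < γ t 1 → γ t 1 < N → i = j₀ →
      γ t 1 ≤ (m + 1 : ℝ) - 1 / 2 ∨ (m + 1 : ℝ) + 1 / 2 ≤ γ t 1 := by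
    intro t i hi h0 hN e
    have hb := hi.bounds
    refine (((hF t).corr_of_strip ⟨hb.1, by linarith⟩ h0 hN).2 e).imp (fun h => ?_) fun h => ?_ <;>
      linarith
  have clear₁ : ∀ t ∈ Set.Icc 0 t₂, γ t ∈ Clear N j₀ j₁ (m + 1) (i₁ + 1) := by
    intro t ht
    rcases le_or_gt (γ t 1) 0 with h0 | h0
    · exact Or.inl h0
    rcases le_or_gt (N : ℝ) (γ t 1) with hN | hN
    · exact Or.inr (Or.inl hN)
    obtain ⟨i, hi, hcor, -⟩ := (hF t).corr h0 hN
    refine Or.inr (Or.inr ⟨i, hi, hcor, block t i hcor h0 hN, ?_⟩)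
    rintro rfl
    rcases ht.2.lt_or_eq with hlt | rfl
    · by_contra hcon
      rw [not_or, not_le, not_le] at hcon
      have hb := hcor.bounds
      exact h₁' t hlt ⟨⟨hb.1, by linarith⟩, by linarith, by linarith⟩
    · rcases edge with h | h
      · left; linarith
      · right; linarith
  have clear₂ : ∀ t ∈ Set.Icc t₂ b, γ t ∈ Clear N j₀ 3 (m + 1) (i₁ + 1) := by
    intro t ht
    rcases le_or_gt (γ t 1) 0 with h0 | h0
    · exact Or.inl h0
    rcases le_or_gt (N : ℝ) (γ t 1) with hN | hN
    · exact Or.inr (Or.inl hN)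
    obtain ⟨i, hi, hcor, -⟩ := (hF t).corr h0 hN
    exact Or.inr (Or.inr ⟨i, hi, hcor, block t i hcor h0 hN, by omega⟩)
  obtain ⟨f, hf⟩ : ∃ f : ℝ≥0 → ℝ, ∀ t, f t =
    loopPos N j₀ j₁ (m + 1) (i₁ + 1) (strip (γ t)) (γ t 1) := ⟨_, fun _ => rfl⟩
  obtain ⟨f', hf'⟩ : ∃ f : ℝ≥0 → ℝ, ∀ t, f t =
    loopPos N j₀ 3 (m + 1) (i₁ + 1) (strip (γ t)) (γ t 1) := ⟨_, fun _ => rfl⟩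
  obtain ⟨g, hg⟩ : ∃ f : ℝ≥0 → ℝ, ∀ t, f t =
    lowDepth N j₀ (m + 1) (strip (γ t)) (γ t 1) := ⟨_, fun _ => rfl⟩
  obtain ⟨h, hh⟩ : ∃ f : ℝ≥0 → ℝ, ∀ t, f t =
    highDepth N j₀ (m + 1) (strip (γ t)) (γ t 1) := ⟨_, fun _ => rfl⟩
  -- values at the beginning, at the time `t₂`, and at the end
  have f0 : f 0 = 0 := by
    rw [hf]; exact loopPos_of_le (by linarith) (by linarith) (by linarith)
  have g0 : g 0 = 0 := by rw [hg]; exact lowDepth_of_le (by linarith)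
  have h0 : h 0 = 0 := by rw [hh]; exact highDepth_of_le (by linarith) (by linarith)
  have fb : f' b = 0 := by
    rw [hf']; exact loopPos_of_le (by linarith) (by linarith) (by linarith)
  have gb : g b = 0 := by rw [hg]; exact lowDepth_of_le (by linarith)
  have hhb : h b = 0 := by rw [hh]; exact highDepth_of_le (by linarith) (by linarith)
  have gt : g t₂ = 0 := by rw [hg, st₂]; simp [lowDepth, hjj]
  have hht : h t₂ = 0 := by rw [hh, st₂]; simp [highDepth, hjj]
  have ct : clip N (γ t₂ 1) = γ t₂ 1 := clip_of_mem (by linarith [h₁.2.1]) (by linarith [h₁.2.2])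
  have ft' : f' t₂ = γ t₂ 1 := by
    rw [hf', st₂, loopPos, if_neg hjj, if_neg (by omega), ct]
  -- the way around
  have before : ∃ x ∈ Set.Icc 0 t₂, 2 * N + i₁ - 20 ≤ |f x - f 0| + |f t₂ - f x| := by
    rcases edge with he | he
    · obtain ⟨j₂, hj₂, hn₀, hn₁⟩ : ∃ j₂ < 3, j₂ ≠ j₀ ∧ j₂ ≠ j₁ := by
        by_cases q0 : 0 ≠ j₀ ∧ 0 ≠ j₁
        · exact ⟨0, by omega, q0⟩
        by_cases q1 : 1 ≠ j₀ ∧ 1 ≠ j₁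
        · exact ⟨1, by omega, q1⟩
        exact ⟨2, by omega, by omega, by omega⟩
      obtain ⟨x, hx, hzx⟩ := hother j₂ (N - 5) hj₂ hn₀ (by omega) (by omega)
      rw [Nat.cast_sub (by omega)] at hzx
      obtain ⟨hz0, hz1, hz2⟩ := hzx
      push_cast at hz1 hz2
      have sx : strip (γ x) = j₂ := loc x j₂ hj₂ hz0 (by linarith) (by linarith)
      have fx : f x = γ x 1 := by
        rw [hf, sx, loopPos, if_neg hn₀, if_neg hn₁, clip_of_mem (by linarith) (by linarith)]
      have ft : f t₂ = -γ t₂ 1 := by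
        rw [hf, st₂, loopPos, if_neg hjj, if_pos rfl, if_pos (by linarith), ct]
      refine ⟨x, ⟨bot_le, hx⟩, ?_⟩
      rw [f0, fx, ft, he]
      have := le_abs_self (γ x 1 - 0)
      have := neg_abs_le (-(i₁ - 5 / 2 : ℝ) - γ x 1)
      linarith
    · have ft : f t₂ = 2 * N - γ t₂ 1 := by
        rw [hf, st₂, loopPos, if_neg hjj, if_pos rfl, if_neg (by linarith), ct]
      by_cases h4 : i₁ = 4
      · refine ⟨0, ⟨le_rfl, bot_le⟩, ?_⟩
        have h4 : (i₁ : ℝ) = 4 := by exact_mod_cast h4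
        rw [f0, ft, he]
        have := le_abs_self (2 * N - (i₁ + 9 / 2 : ℝ) - 0)
        have := abs_nonneg ((0 : ℝ) - 0)
        linarith
      · obtain ⟨x, hx, hzx⟩ := hother j₁ (i₁ - 1) hj₁ hjj (by omega) (by omega)
        rw [Nat.cast_sub (by omega)] at hzx
        obtain ⟨hz0, hz1, hz2⟩ := hzx
        push_cast at hz1 hz2
        have hne : x ≠ t₂ := by rintro rfl; linarith
        have hlow : γ x 1 < i₁ - 5 / 2 := by
          by_contra hcon
          exact h₁' x (lt_of_le_of_ne hx hne) ⟨hz0, by linarith, by linarith⟩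
        have sx : strip (γ x) = j₁ := loc x j₁ hj₁ hz0 (by linarith) (by linarith)
        have fx : f x = -γ x 1 := by
          rw [hf, sx, loopPos, if_neg hjj, if_pos rfl, if_pos (by linarith),
            clip_of_mem (by linarith) (by linarith)]
        refine ⟨x, ⟨bot_le, hx⟩, ?_⟩
        rw [f0, fx, ft, he]
        have := neg_abs_le (-γ x 1 - 0)
        have := le_abs_self (2 * N - (i₁ + 9 / 2 : ℝ) - -γ x 1)
        linarith
  -- the dead ends, before
  have low₁ : ∃ y ∈ Set.Icc 0 t₂, 2 * (m - 4 : ℝ) ≤ |g y - g 0| + |g t₂ - g y| := by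
    by_cases h4 : m = 4
    · have h4 : (m : ℝ) = 4 := by exact_mod_cast h4
      exact ⟨0, ⟨le_rfl, bot_le⟩, by rw [h4]; norm_num⟩
    · obtain ⟨y, hy, hzy⟩ := hlow.resolve_left h4
      rw [Nat.cast_sub (by omega)] at hzy
      obtain ⟨hz0, hz1, hz2⟩ := hzy
      push_cast at hz1 hz2
      have hl : γ y 1 < m - 5 / 2 := by
        by_contra hcon
        exact h₀ y hy ⟨hz0, by linarith, by linarith⟩
      have gy : g y = γ y 1 := by
        rw [hg, loc y j₀ hj₀ hz0 (by linarith) (by linarith), lowDepth,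
          if_pos ⟨rfl, by linarith⟩, clip_of_mem (by linarith) (by linarith)]
      refine ⟨y, ⟨bot_le, hy⟩, ?_⟩
      rw [g0, gt, gy]
      have := le_abs_self (γ y 1 - 0)
      have := neg_abs_le (0 - γ y 1)
      linarith
  have high₁ : ∃ y ∈ Set.Icc 0 t₂, 2 * (N - n - 6 : ℝ) ≤ |h y - h 0| + |h t₂ - h y| := by
    by_cases h4 : n + 5 = N
    · have h4 : (n : ℝ) + 5 = N := by exact_mod_cast h4
      refine ⟨0, ⟨le_rfl, bot_le⟩, ?_⟩
      have := abs_nonneg (h 0 - h 0)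
      have := abs_nonneg (h t₂ - h 0)
      linarith
    · obtain ⟨y, hy, hz0, hz1, hz2⟩ := hhigh.resolve_left h4
      push_cast at hz1 hz2
      have hnN : n + 6 ≤ N := by omega
      have hnN : (n : ℝ) + 6 ≤ N := by exact_mod_cast hnN
      have hl : n + 9 / 2 < γ y 1 := by
        by_contra hcon
        exact h₀ y hy ⟨hz0, by linarith, by linarith⟩
      have hy' : h y = N - γ y 1 := by
        rw [hh, loc y j₀ hj₀ hz0 (by linarith) (by linarith), highDepth,
          if_pos ⟨rfl, by linarith⟩, clip_of_mem (by linarith) (by linarith)]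
      refine ⟨y, ⟨bot_le, hy⟩, ?_⟩
      rw [h0, hht, hy']
      have := le_abs_self (N - γ y 1 - 0)
      have := neg_abs_le (0 - (N - γ y 1))
      linarith
  -- afterwards
  obtain ⟨⟨hu0, hu1, hu2⟩, ⟨hv0, hv1, hv2⟩⟩ := And.intro hu hv
  have gu : g u = γ u 1 := by
    rw [hg, loc u j₀ hj₀ hu0 (by linarith) (by linarith), lowDepth,
      if_pos ⟨rfl, by linarith⟩, clip_of_mem (by linarith) (by linarith)]
  have hhv : h v = N - γ v 1 := by
    rw [hh, loc v j₀ hj₀ hv0 (by linarith) (by linarith), highDepth,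
      if_pos ⟨rfl, by linarith⟩, clip_of_mem (by linarith) (by linarith)]
  have fv : f' v = N := by
    rw [hf', loc v j₀ hj₀ hv0 (by linarith) (by linarith), loopPos, if_pos rfl,
      if_neg (by linarith)]
  obtain ⟨x, hx, hx'⟩ := before
  obtain ⟨y, hy, hy'⟩ := low₁
  obtain ⟨w, hw, hw'⟩ := high₁
  have part₁ := le_eVariationOn_of_clear hm₀ hm₁ hc clear₁ hx hy hw hf hg hh
  have part₂ := le_eVariationOn_of_clear hm₀ hm₁ hc clear₂ ⟨htv.le, hbv⟩ ⟨htu.le, hbu⟩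
    ⟨htv.le, hbv⟩ hf' hg hh
  refine ofReal_le_length ((ENNReal.ofReal_le_ofReal ?_).trans
    (ofReal_le_eVariationOn_add bot_le (htv.le.trans hbv) part₁ part₂))
  rw [gt] at hy'
  rw [hht] at hw'
  rw [ft', fv, fb, gu, gt, gb, hhv, hht, hhb]
  have q1 := le_abs_self (N - γ t₂ 1)
  have q2 := neg_abs_le (0 - (N : ℝ))
  have q3 := le_abs_self (γ u 1 - 0)
  have q4 := neg_abs_le (0 - γ u 1)
  have q5 := le_abs_self (N - γ v 1 - 0)
  have q6 := neg_abs_le (0 - (N - γ v 1))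
  have q7 : γ t₂ 1 ≤ i₁ + 9 / 2 := by rcases edge with h | h <;> linarith
  linarith

end

/-! ### The lower bound for orthogonal polygons -/

theorem exists_first_hit {γ : ℝ≥0 → Plane} (hγ : Continuous γ) {Z : Plane → Prop}
    (hZ : IsClosed {z | Z z}) (h : ∃ t, Z (γ t)) : ∃ t, Z (γ t) ∧ ∀ τ < t, ¬ Z (γ τ) := by
  have hcl : IsClosed (γ ⁻¹' {z | Z z}) := hZ.preimage hγ
  exact ⟨sInf (γ ⁻¹' {z | Z z}), hcl.csInf_mem h (OrderBot.bddBelow _), fun τ hτ hm =>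
    not_le.2 hτ (csInf_le (OrderBot.bddBelow _) (show τ ∈ γ ⁻¹' {z | Z z} from hm))⟩

/-- A maximal interval on which a predicate holds. -/
theorem exists_maximal_interval {p : ℕ → Prop} {l r c : ℕ} (hl : l ≤ c) (hr : c ≤ r) (hc : p c) :
    ∃ m n, l ≤ m ∧ m ≤ c ∧ c ≤ n ∧ n ≤ r ∧ (∀ i, m ≤ i → i ≤ n → p i) ∧
      (m = l ∨ ¬ p (m - 1)) ∧ (n = r ∨ ¬ p (n + 1)) := by
  classical
  have ex₁ : ∃ d, c - d = l ∨ ¬ p (c - d - 1) := ⟨c - l, Or.inl (by omega)⟩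
  have ex₂ : ∃ d, c + d = r ∨ ¬ p (c + d + 1) := ⟨r - c, Or.inl (by omega)⟩
  have le₁ : Nat.find ex₁ ≤ c - l := Nat.find_min' ex₁ (Or.inl (by omega))
  have le₂ : Nat.find ex₂ ≤ r - c := Nat.find_min' ex₂ (Or.inl (by omega))
  refine ⟨c - Nat.find ex₁, c + Nat.find ex₂, by omega, by omega, by omega, by omega, ?_,
    Nat.find_spec ex₁, Nat.find_spec ex₂⟩
  intro i h1 h2
  rcases lt_trichotomy i c with h | rfl | h
  · have := Nat.find_min ex₁ (show c - i - 1 < Nat.find ex₁ by omega)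
    rw [not_or, not_not] at this
    rw [show i = c - (c - i - 1) - 1 by omega]
    exact this.2
  · exact hc
  · have := Nat.find_min ex₂ (show i - c - 1 < Nat.find ex₂ by omega)
    rw [not_or, not_not] at this
    rw [show i = c + (i - c - 1) + 1 by omega]
    exact this.2

/-- The robot walks in the scene in which the block is detected last. Before it is, all other
places have been inspected. The blocked part is then moved and enlarged to the last group of places
that have been inspected: up to the moment before that, the robot cannot tell the difference. -/
theorem orthogonal_game (S : OnlineStrategy plainView {P | P.IsOrthogonal}) {N : ℕ} (hN : 9 ≤ N) :
    ∃ P ∈ {P : Scene | P.IsOrthogonal}, 0 < P.opt ∧ ∃ x : ℝ, 2 * N ≤ x ∧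
      ENNReal.ofReal (2 * x - 60) ≤ length (S.path P) ∧ P.opt ≤ ENNReal.ofReal (x + 40) := by
  have ex : ∀ j i₁ i₂, ∃ P, j < 3 → i₁ < i₂ → i₂ < N → IsZigzag N j i₁ i₂ P := by
    intro j i₁ i₂
    by_cases h : j < 3 ∧ i₁ < i₂ ∧ i₂ < N
    · obtain ⟨P, hP⟩ := exists_isZigzag h.1 h.2.1 h.2.2
      exact ⟨P, fun _ _ _ => hP⟩
    · obtain ⟨P, -⟩ := exists_isZigzag (N := 2) (j := 0) (i₁ := 0) (i₂ := 1) (by omega) (by omega)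
        (by omega)
      exact ⟨P, fun h1 h2 h3 => (h ⟨h1, h2, h3⟩).elim⟩
  choose sc hsc using ex
  have tour : ∀ {j i₁ i₂ P}, IsZigzag N j i₁ i₂ P → P.IsWatchmanTour (S.path P) :=
    fun hP => S.tour _ hP.orthogonal
  -- the paths in two scenes agree as long as both zones are avoided
  have agree : ∀ {j i₁ i₂ P j' i₁' i₂' P'}, IsZigzag N j i₁ i₂ P → IsZigzag N j' i₁' i₂' P' →
      4 ≤ i₁ → i₂ + 4 ≤ N → 4 ≤ i₁' → i₂' + 4 ≤ N → ∀ t,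
      (∀ τ < t, ¬ Zone j (i₁ + 1 / 2) (i₂ + 1 / 2) (S.path P τ)) →
      (∀ τ < t, ¬ Zone j' (i₁' + 1 / 2) (i₂' + 1 / 2) (S.path P τ)) →
      ∀ τ ≤ t, S.path P' τ = S.path P τ := by
    intro j i₁ i₂ P j' i₁' i₂' P' hP hP' h1 h2 h1' h2' t hz hz'
    exact S.online P hP.orthogonal P' hP'.orthogonal (hP.start.trans hP'.start.symm) t
      fun τ hτ => hP.plainView_eq hP' h1 h2 h1' h2' (hz τ hτ) (hz' τ hτ)
  set I := Finset.range 3 ×ˢ Finset.Icc 4 (N - 5) with hI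
  have memI : ∀ {σ : ℕ × ℕ}, σ ∈ I ↔ σ.1 < 3 ∧ 4 ≤ σ.2 ∧ σ.2 + 5 ≤ N := by
    intro σ
    simp only [hI, Finset.mem_product, Finset.mem_range, Finset.mem_Icc]
    omega
  have single : ∀ σ ∈ I, IsZigzag N σ.1 σ.2 (σ.2 + 1) (sc σ.1 σ.2 (σ.2 + 1)) := fun σ hσ => by
    have := memI.1 hσ
    exact hsc _ _ _ this.1 (by omega) (by omega)
  have hT : ∀ σ : ℕ × ℕ, ∃ t, σ ∈ I → UnitZone σ.1 σ.2 (S.path (sc σ.1 σ.2 (σ.2 + 1)) t) ∧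
      ∀ τ < t, ¬ UnitZone σ.1 σ.2 (S.path (sc σ.1 σ.2 (σ.2 + 1)) τ) := by
    intro σ
    by_cases hσ : σ ∈ I
    · have h := memI.1 hσ
      have ht := tour (single σ hσ)
      obtain ⟨⟨t, ht', -⟩, -⟩ := ht.exists_zone_ends (single σ hσ) h.1 (by omega) h.2.1 (by omega)
      obtain ⟨t, ht⟩ := exists_first_hit ht.continuous (isClosed_zone _ _ _) ⟨t, ht'⟩
      exact ⟨t, fun _ => ht⟩
    · exact ⟨0, fun h => (hσ h).elim⟩
  choose T hT using hT
  have mem0 : ((0, 4) : ℕ × ℕ) ∈ I := memI.2 ⟨by norm_num, by norm_num, by simpa using hN⟩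
  obtain ⟨σ, hσ, hmax⟩ := I.exists_max_image T ⟨_, mem0⟩
  obtain ⟨γ, hγ⟩ : ∃ γ, γ = S.path (sc σ.1 σ.2 (σ.2 + 1)) := ⟨_, rfl⟩
  have hγt : (sc σ.1 σ.2 (σ.2 + 1)).IsWatchmanTour γ := hγ ▸ tour (single σ hσ)
  have hγσ : ∀ τ < T σ, ¬ UnitZone σ.1 σ.2 (γ τ) := hγ ▸ (hT σ hσ).2
  have hit : ∀ σ' ∈ I, ∃ t ≤ T σ, UnitZone σ'.1 σ'.2 (γ t) := by
    intro σ' hσ'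
    by_contra! hcon
    have h := memI.1 hσ
    have h' := memI.1 hσ'
    have := agree (single σ hσ) (single σ' hσ') h.2.1 (by omega) h'.2.1 (by omega) (T σ)
      (hγ ▸ hγσ) (fun τ hτ => hγ ▸ hcon τ hτ.le)
    have h1 := (hT σ' hσ').1
    rw [this _ (hmax σ' hσ'), ← hγ] at h1
    exact hcon _ (hmax σ' hσ') h1
  have hh : ∀ σ' : ℕ × ℕ, ∃ t, σ' ∈ I → UnitZone σ'.1 σ'.2 (γ t) ∧
      ∀ τ < t, ¬ UnitZone σ'.1 σ'.2 (γ τ) := by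
    intro σ'
    by_cases hσ' : σ' ∈ I
    · obtain ⟨t, -, ht⟩ := hit σ' hσ'
      obtain ⟨t, ht⟩ := exists_first_hit hγt.continuous (isClosed_zone _ _ _) ⟨t, ht⟩
      exact ⟨t, fun _ => ht⟩
    · exact ⟨0, fun h => (hσ' h).elim⟩
  choose h hh using hh
  have hle : ∀ σ' ∈ I, h σ' ≤ T σ := by
    intro σ' hσ'
    obtain ⟨t, ht, ht'⟩ := hit σ' hσ'
    exact (not_lt.1 fun hlt => (hh σ' hσ').2 t hlt ht').trans ht
  -- the corridor that is completely inspected last, and the last place elsewhere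
  obtain ⟨⟨j₀, c⟩, hσ₀, hmax₀⟩ := I.exists_max_image h ⟨_, mem0⟩
  obtain ⟨j', hj', hne'⟩ : ∃ j' < 3, j' ≠ j₀ := by
    by_cases h0 : j₀ = 0
    · exact ⟨1, by omega, by omega⟩
    · exact ⟨0, by omega, by omega⟩
  obtain ⟨⟨j₁, i₁⟩, hσ₁, hmax₁⟩ := (I.filter fun σ' => σ'.1 ≠ j₀).exists_max_image h
    ⟨(j', 4), Finset.mem_filter.2 ⟨memI.2 ⟨hj', by norm_num, by simpa using hN⟩, hne'⟩⟩
  rw [Finset.mem_filter] at hσ₁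
  obtain ⟨hσ₁, hjj⟩ := hσ₁
  simp only [ne_eq] at hjj
  have m₀ := memI.1 hσ₀
  have m₁ := memI.1 hσ₁
  simp only at m₀ m₁
  have hlt : h (j₁, i₁) < h (j₀, c) := by
    refine lt_of_le_of_ne (hmax₀ _ hσ₁) fun e => hjj ?_
    have z₀ := (hh _ hσ₀).1.1
    have z₁ := (hh _ hσ₁).1.1
    rw [e] at z₁
    simp only at z₀ z₁
    have q1 : (j₀ : ℝ) < j₁ + 1 := by linarith
    have q2 : (j₁ : ℝ) < j₀ + 1 := by linarith
    have q1 : j₀ < j₁ + 1 := by exact_mod_cast q1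
    have q2 : j₁ < j₀ + 1 := by exact_mod_cast q2
    omega
  obtain ⟨m, n, hm, hmc, hcn, hn, hall, hlow, hhigh⟩ := exists_maximal_interval
    (p := fun i => h (j₁, i₁) < h (j₀, i)) (l := 4) (r := N - 5) m₀.2.1 (by omega) hlt
  have hP := hsc j₀ m (n + 1) m₀.1 (by omega) (by omega)
  obtain ⟨P, rfl⟩ : ∃ P, P = sc j₀ m (n + 1) := ⟨_, rfl⟩
  -- the zone of the enlarged block is the union of the zones of its parts
  have avoid : ∀ t ≤ h (j₁, i₁), ¬ Zone j₀ (m + 1 / 2) ((n + 1 : ℕ) + 1 / 2) (γ t) := by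
    rintro t ht ⟨hz0, hz1, hz2⟩
    push_cast at hz2
    have part : ∃ i, m ≤ i ∧ i ≤ n ∧ (i : ℝ) + 1 / 2 - 3 ≤ γ t 1 ∧
        γ t 1 ≤ ((i + 1 : ℕ) : ℝ) + 1 / 2 + 3 := by
      by_cases hb : (n : ℝ) + 1 / 2 - 3 ≤ γ t 1
      · exact ⟨n, by omega, le_rfl, hb, by push_cast; linarith⟩
      · have hm' : (4 : ℝ) ≤ m := by exact_mod_cast hm
        have hpos : 0 ≤ γ t 1 + 5 / 2 := by linarith
        refine ⟨⌊γ t 1 + 5 / 2⌋₊, ?_, ?_, ?_, ?_⟩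
        · exact Nat.le_floor (by linarith)
        · have : ⌊γ t 1 + 5 / 2⌋₊ < n + 1 := by
            rw [Nat.floor_lt hpos]; push_cast; linarith
          omega
        · linarith [Nat.floor_le hpos]
        · push_cast; linarith [Nat.lt_floor_add_one (γ t 1 + 5 / 2)]
    obtain ⟨i, hi1, hi2, hi3, hi4⟩ := part
    exact (hh (j₀, i) (memI.2 ⟨m₀.1, by simp only; omega, by simp only; omega⟩)).2 t
      (ht.trans_lt (hall i hi1 hi2)) ⟨hz0, hi3, hi4⟩
  have mσ := memI.1 hσ
  have same : ∀ τ ≤ h (j₁, i₁), S.path (sc j₀ m (n + 1)) τ = γ τ := by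
    have := agree (single σ hσ) hP mσ.2.1 (by omega) hm (by omega) (h (j₁, i₁))
      (fun τ hτ => hγ ▸ hγσ τ (hτ.trans_le (hle _ hσ₁))) (fun τ hτ => hγ ▸ avoid τ hτ.le)
    rwa [← hγ] at this
  have mn : (m : ℝ) ≤ n := by exact_mod_cast hmc.trans hcn
  have nN : (n : ℝ) + 5 ≤ N := by
    have : n + 5 ≤ N := by omega
    exact_mod_cast this
  refine ⟨_, hP.orthogonal, hP.opt_pos m₀.1 (by omega) hm (by omega), 2 * N + 2 * m + 2 * (N - n),
    by linarith [Nat.cast_nonneg (α := ℝ) m], ?_, ?_⟩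
  · have := le_length_of_order (tour hP) hP m₀.1 m₁.1 hjj hm (by omega) (by omega) m₁.2.1 m₁.2.2
      (t₂ := h (j₁, i₁)) (fun t ht => by rw [same t ht]; exact avoid t ht)
      (by rw [same _ le_rfl]; exact (hh _ hσ₁).1)
      (fun t ht => by rw [same t ht.le]; exact (hh _ hσ₁).2 t ht) ?_ ?_ ?_
    · refine le_trans (ENNReal.ofReal_le_ofReal ?_) this
      linarith
    · intro j i hj hj0 hi hi'
      have hmem : (j, i) ∈ I := memI.2 ⟨hj, hi, hi'⟩
      have hle' := hmax₁ (j, i) (Finset.mem_filter.2 ⟨hmem, hj0⟩)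
      exact ⟨_, hle', by rw [same _ hle']; exact (hh _ hmem).1⟩
    · by_cases h4 : m = 4
      · exact Or.inl h4
      · have hle' := not_lt.1 (hlow.resolve_left h4)
        exact Or.inr ⟨_, hle', by
          rw [same _ hle']
          exact (hh (j₀, m - 1) (memI.2 ⟨m₀.1, by simp only; omega, by simp only; omega⟩)).1⟩
    · by_cases h4 : n + 5 = N
      · exact Or.inl h4
      · have hle' := not_lt.1 (hhigh.resolve_left (by omega))
        exact Or.inr ⟨_, hle', by
          rw [same _ hle']
          exact (hh (j₀, n + 1) (memI.2 ⟨m₀.1, by simp only; omega, by simp only; omega⟩)).1⟩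
  · refine (hP.opt_le m₀.1 (by omega) (by omega)).trans (ENNReal.ofReal_le_ofReal ?_)
    push_cast; linarith

theorem orthogonal_ratio (S : OnlineStrategy plainView {P | P.IsOrthogonal}) :
    2 ≤ S.competitiveRatio := by
  rw [show (2 : ℝ≥0∞) = ENNReal.ofReal 2 by simp]
  refine S.ofReal_le_competitiveRatio fun η hη => ?_
  obtain ⟨N, hN⟩ := exists_nat_ge (9 + 70 / η)
  have hq : 0 < 70 / η := by positivity
  have hN9 : (9 : ℝ) ≤ N := by linarith
  obtain ⟨P, hP, hpos, x, hx, hl, ho⟩ := orthogonal_game S (N := N) (by exact_mod_cast hN9)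
  refine ⟨P, hP, hpos, 2 * x - 60, x + 40, by linarith, hl, ho, ?_⟩
  have h1 : 70 ≤ η * N := by
    have h2 : 70 / η ≤ N := by linarith
    rw [div_le_iff₀ hη] at h2; linarith
  have h3 : η * (2 * N) ≤ η * x := by gcongr
  linarith

end Watchman

theorem theorem1 :
    (∀ S : Watchman.OnlineStrategy Watchman.plainView {P | P.IsOrthogonal},
      2 ≤ S.competitiveRatio) ∧
    (∀ S : Watchman.OnlineStrategy Watchman.plainView Set.univ,
      ENNReal.ofReal ((3 + Real.sqrt 5) / 2) ≤ S.competitiveRatio) ∧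
    (∀ S : Watchman.OnlineStrategy Watchman.coloredView Set.univ,
      ENNReal.ofReal ((3 + Real.sqrt 5) / 2) ≤ S.competitiveRatio) := by
  exact ⟨Watchman.orthogonal_ratio, Watchman.plain_ratio, Watchman.colored_ratio⟩
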